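/- **Conventions.** An *$n$-folding sequence* is a finite sequence in $\{+1,-1\}$ obtained by folding a strip of paper $n$ times in two (each time up or down) and unfolding it: the empty sequence is the $0$-folding sequence, and the $(n+1)$-folding sequences are the sequences $(\overline S,\varepsilon,S)$ with $S$ an $n$-folding sequence, $\varepsilon=\pm1$ and $\overline{(a_1,\dots,a_m)}=(-a_m,\dots,-a_1)$. A *complete folding sequence* is a sequence $(a_h)_{h\in\mathbb Z}$ in $\{+1,-1\}$ each finite subword (finite block of consecutive terms) of which is a subword of an $n$-folding sequence for some $n$. Two sequences indexed by $\mathbb Z$ are *locally isomorphic* if they have the same finite subwords. For a complete folding sequence $S=(a_h)$ and $n\ge 0$, put $E_n(S)=h_n+2^n\mathbb Z$, where $h_n$ is any integer with $a_{h_n+k2^{n+1}}=(-1)^ka_{h_n}$ for all $k\in\mathbb Z$ (such $h_n$ exist, and the set does not depend on the choice). Fix $0<\alpha<1/4$. For $x,y\in\mathbb Z$ and $\zeta,\eta\in\{+1,-1\}$, let $C_H(x,y,\zeta,\eta)$ be the polygonal line with successive vertices $(x+\alpha,y+\zeta\alpha)$, $(x+2\alpha,y)$, $(x+1-2\alpha,y)$,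 $(x+1-\alpha,y+\eta\alpha)$, with horizontal *support* $[(x,y),(x+1,y)]$, and $C_V(x,y,\zeta,\eta)$ the polygonal line with successive vertices $(x+\zeta\alpha,y+\alpha)$, $(x,y+2\alpha)$, $(x,y+1-2\alpha)$, $(x+\eta\alpha,y+1-\alpha)$, with vertical support $[(x,y),(x,y+1)]$. A *segment* is one of these lines with one of its two orientations; its *initial* and *terminal points* are the correspondingly ordered endpoints of its support. The *tile* of a segment is the square having its support as a diagonal, to which one adds the closed square with edges of length $2\alpha$, parallel to the axes, centred at the end of the oriented line, and from which one then removes the open square of the same size centred at its beginning. Two segments $C_1,C_2$ are *consecutive* if they have just one common point and the end of $C_1$ is the beginning of $C_2$. A *complete curve* is a sequence $(C_i)_{i\in\mathbb Z}$ of consecutive segments with distinct supports; its *associated sequence* is $(\eta_i)_{i\in\mathbb Z}$, where $\eta_i=+1$ (resp. $-1$) if one turns left (resp. right) when passing from $C_i$ to $C_{i+1}$. It is a *complete folding curve* if its associated sequence $S$ is a complete folding sequence. Such a curve $C$ has *type* $H$ (resp. $V$) if the segments $C_i$ with $i\in E_1(S)$ all have horizontal (resp. vertical) supports. The *derivative*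 of a curve, drawn on the same figure, is obtained, for a suitable indexation such that the turns at the terminal points of the segments with odd index are alternately left and right, by replacing each pair $(C_{2i-1},C_{2i})$ with one segment from the initial point of $C_{2i-1}$ to the terminal point of $C_{2i}$. A complete folding curve $C$ has an $n$-th derivative $C^{(n)}$ for each $n\ge 0$, with $C^{(0)}=C$, and $E_n(C)\subset\mathbb Z^2$ is the translate of $2^k\mathbb Z^2$ if $n=2k$, resp. of $(2^k,2^k)\mathbb Z+(2^k,-2^k)\mathbb Z$ if $n=2k+1$, which contains all the vertices of $C^{(n)}$. A *covering* of $\mathbb R^2$ is a set $\mathcal E$ of segments such that (1) each interval $[(x,y),(x+1,y)]$ or $[(x,y),(x,y+1)]$ with $x,y\in\mathbb Z$ is the support of a unique segment of $\mathcal E$; (2) if two distinct non consecutive segments of $\mathcal E$ have supports with a common endpoint $X$, then they can be completed into pairs of consecutive segments of $\mathcal E$, with all four segments having distinct supports which contain $X$. It is a *covering by complete folding curves* if it is a union of complete folding curves; its curves are the complete curves consisting of segments of $\mathcal E$. It *satisfies the local isomorphism property* if the set $\mathcal T$ of the tiles of its segments does: for each bounded set of tiles $\mathcal F\subset\mathcal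 T$, there exists $r>0$ such that each ball of radius $r$ in $\mathbb R^2$ contains the image of $\mathcal F$ under a translation, as a set of tiles of $\mathcal T$. **Theorem 3.5.** Let $\mathcal C$ be a covering of $\mathbb R^2$ by complete folding curves. Then $\mathcal C$ satisfies the local isomorphism property if and only if all its curves have the same type ($H$ or $V$), define the same sets $E_k$ (that is, $E_k(C)=E_k(D)$ for all curves $C,D$ of $\mathcal C$ and all $k\ge 0$), and have pairwise locally isomorphic associated sequences. -/

import Mathlib

namespace Paperfolding

/-! ### Folding sequences

The elements of `{+1, -1}` are the units `ℤˣ` of `ℤ`. -/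

/-- `barWord (a₁, …, aₙ) = (-aₙ, …, -a₁)`. -/
def barWord (S : List ℤˣ) : List ℤˣ := (S.map fun a => -a).reverse

/-- `n`-folding sequences: folding a strip once more, as the first fold, turns an `n`-folding
sequence `S` into `(barWord S, ε, S)` where `ε` is the sign of the new (middle) fold. -/
inductive IsNFoldingWord : ℕ → List ℤˣ → Prop
  | zero : IsNFoldingWord 0 []
  | succ (n : ℕ) (S : List ℤˣ) (ε : ℤˣ) :
      IsNFoldingWord n S → IsNFoldingWord (n + 1) (barWord S ++ ε :: S)

/-- Finite folding sequences: the subwords of the `n`-folding sequences. -/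
def IsFoldingWord (w : List ℤˣ) : Prop :=
  ∃ (n : ℕ) (S : List ℤˣ), IsNFoldingWord n S ∧ w <:+: S

/-- `w` is a finite subword of the two-sided sequence `a`. -/
def IsSubword (w : List ℤˣ) (a : ℤ → ℤˣ) : Prop :=
  ∃ h : ℤ, w = (List.range w.length).map fun k => a (h + (k : ℤ))

/-- Complete folding sequences: all the finite subwords are folding sequences. -/
def IsCompleteFoldingSeq (a : ℤ → ℤˣ) : Prop :=
  ∀ w : List ℤˣ, IsSubword w a → IsFoldingWord w

/-- Two sequences are locally isomorphic if they have the same finite subwords. -/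
def SeqLocallyIsomorphic (a b : ℤ → ℤˣ) : Prop :=
  ∀ w : List ℤˣ, IsSubword w a ↔ IsSubword w b

/-- The set `E_n(S) = h_n + 2ⁿ ℤ` of a complete folding sequence `S = (a_h)`, where `h_n` is any
integer with `a (h_n + k 2ⁿ⁺¹) = (-1)ᵏ a (h_n)` for all `k` (the set does not depend on the
choice of `h_n`). -/
def seqE (a : ℤ → ℤˣ) (n : ℕ) : Set ℤ :=
  {h | ∃ h₀ : ℤ, (∀ k : ℤ, a (h₀ + k * 2 ^ (n + 1)) = (-1) ^ k * a h₀) ∧ (2 : ℤ) ^ n ∣ h - h₀}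

/-! ### Segments, curves and tiles -/

/-- The Euclidean plane. -/
abbrev Plane : Type := EuclideanSpace ℝ (Fin 2)

/-- Horizontal or vertical: the two directions of supports, and the two types of curves. -/
inductive Axis : Type
  | H
  | V

/-- The oriented segments of curves `C_H^±(x, y, ζ, η)` and `C_V^±(x, y, ζ, η)`;
`dir = 1` is the orientation from left to right, resp. from bottom to top, and `dir = -1` is the
opposite one. -/
structure Segment : Type where
  axis : Axis
  dir : ℤˣ
  x : ℤ
  y : ℤ
  ζ : ℤˣ
  η : ℤˣ

namespace Segment

/-- The support `[(x, y), (x + 1, y)]` or `[(x, y), (x, y + 1)]`, given by its direction and its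
left, resp. lower, endpoint. -/
def support (s : Segment) : Axis × ℤ × ℤ := (s.axis, s.x, s.y)

/-- The left, resp. lower, endpoint of the support. -/
def lower (s : Segment) : ℤ × ℤ := (s.x, s.y)

/-- The right, resp. upper, endpoint of the support. -/
def upper (s : Segment) : ℤ × ℤ :=
  match s.axis with
  | .H => (s.x + 1, s.y)
  | .V => (s.x, s.y + 1)

/-- The initial point of an oriented segment (an endpoint of its support). -/
def initial (s : Segment) : ℤ × ℤ := if s.dir = 1 then s.lower else s.upper

/-- The terminal point of an oriented segment (an endpoint of its support). -/
def terminal (s : Segment) : ℤ × ℤ := if s.dir = 1 then s.upper else s.lower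

/-- `X` is one of the two endpoints of `s`. -/
def HasEndpoint (s : Segment) (X : ℤ × ℤ) : Prop := X = s.initial ∨ X = s.terminal

/-- The point at distance `a` from the lower endpoint along the support and at signed distance `b`
from the support: `(x + a, y + b)` for `H` and `(x + b, y + a)` for `V`. -/
noncomputable def pt (s : Segment) (a b : ℝ) : Plane :=
  match s.axis with
  | .H => !₂[(s.x : ℝ) + a, (s.y : ℝ) + b]
  | .V => !₂[(s.x : ℝ) + b, (s.y : ℝ) + a]

/-- The end of the polygonal line near the lower endpoint of the support. -/
noncomputable def lowerTip (α : ℝ) (s : Segment) : Plane := s.pt α (((s.ζ : ℤ) : ℝ) * α)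

/-- The end of the polygonal line near the upper endpoint of the support. -/
noncomputable def upperTip (α : ℝ) (s : Segment) : Plane := s.pt (1 - α) (((s.η : ℤ) : ℝ) * α)

/-- The polygonal line `C_H(x, y, ζ, η)` or `C_V(x, y, ζ, η)` as a subset of the plane. -/
noncomputable def carrier (α : ℝ) (s : Segment) : Set Plane :=
  segment ℝ (s.lowerTip α) (s.pt (2 * α) 0) ∪ segment ℝ (s.pt (2 * α) 0) (s.pt (1 - 2 * α) 0) ∪
    segment ℝ (s.pt (1 - 2 * α) 0) (s.upperTip α)

/-- The beginning of the oriented polygonal line. -/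
noncomputable def beginning (α : ℝ) (s : Segment) : Plane :=
  if s.dir = 1 then s.lowerTip α else s.upperTip α

/-- The end of the oriented polygonal line. -/
noncomputable def ending (α : ℝ) (s : Segment) : Plane :=
  if s.dir = 1 then s.upperTip α else s.lowerTip α

/-- The square with edges of length `√2 / 2` having the support of `s` as a diagonal. -/
noncomputable def diamond (s : Segment) : Set Plane :=
  {p | ∃ a b : ℝ, p = s.pt a b ∧ |a - 1 / 2| + |b| ≤ 1 / 2}

/-- The tile `P_H^±(x, y, ζ, η)` or `P_V^±(x, y, ζ, η)`: the square `diamond s` with a bump at the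
end of `s` and a dent at its beginning. -/
noncomputable def tile (α : ℝ) (s : Segment) : Set Plane :=
  if s.dir = 1 then
    (s.diamond ∪
      {p | ∃ a b : ℝ, p = s.pt a b ∧ max |a - (1 - α)| |b - ((s.η : ℤ) : ℝ) * α| ≤ α}) \
      {p | ∃ a b : ℝ, p = s.pt a b ∧ max |a - α| |b - ((s.ζ : ℤ) : ℝ) * α| < α}
  else
    (s.diamond ∪
      {p | ∃ a b : ℝ, p = s.pt a b ∧ max |a - α| |b - ((s.ζ : ℤ) : ℝ) * α| ≤ α}) \
      {p | ∃ a b : ℝ, p = s.pt a b ∧ max |a - (1 - α)| |b - ((s.η : ℤ) : ℝ) * α| < α}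

end Segment

/-- `s, t` are consecutive: they have just one common point, and the end of `s` is the beginning
of `t`. -/
def Consecutive (α : ℝ) (s t : Segment) : Prop :=
  s.ending α = t.beginning α ∧ ∃ p : Plane, s.carrier α ∩ t.carrier α = {p}

/-- Complete curves: two-sided sequences of consecutive segments with distinct supports. -/
def IsCompleteCurve (α : ℝ) (C : ℤ → Segment) : Prop :=
  (∀ i : ℤ, Consecutive α (C i) (C (i + 1))) ∧ Function.Injective fun i => (C i).support

/-- The sequence of vertices of a complete curve, the terminal point of `C i` having index `i`. -/
def vertexSeq (C : ℤ → Segment) : ℤ → ℤ × ℤ := fun i => (C i).terminal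

/-- `+1` if we turn left at `q` on the way from `p` to `q` and then to `r`, and `-1` otherwise
(used for right-angled turns only). -/
def turn (p q r : ℤ × ℤ) : ℤˣ :=
  if 0 < (q.1 - p.1) * (r.2 - q.2) - (q.2 - p.2) * (r.1 - q.1) then 1 else -1

/-- The sequence of turns of a path: the turn at `p i`. -/
def turnSeq (p : ℤ → ℤ × ℤ) : ℤ → ℤˣ := fun i => turn (p (i - 1)) (p i) (p (i + 1))

/-- The sequence associated to a complete curve; its `i`-th term is the turn made when passing
from `C i` to `C (i + 1)`. -/
def assocSeq (C : ℤ → Segment) : ℤ → ℤˣ := turnSeq (vertexSeq C)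

/-- Complete folding curves. -/
def IsCompleteFoldingCurve (α : ℝ) (C : ℤ → Segment) : Prop :=
  IsCompleteCurve α C ∧ IsCompleteFoldingSeq (assocSeq C)

/-! ### Derivatives, the sets `E_n` of a curve, types -/

/-- `q` is the vertex sequence of the derivative of the curve with vertex sequence `p`, drawn on
the same figure: after a change of the initial point of indexation, each pair of segments number
`2i - 1, 2i` is replaced with the segment joining its ends, and the curve alternates around its
derivative, i.e. the turns at the vertices left out are alternately left and right. -/
def IsDerivative (p q : ℤ → ℤ × ℤ) : Prop :=
  ∃ k : ℤ, (∀ i : ℤ, q i = p (2 * i + k)) ∧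
    ∀ i : ℤ, turnSeq p (2 * i + 1 + k) = (-1) ^ i * turnSeq p (1 + k)

/-- `q` is the vertex sequence of the `n`-th derivative. -/
def IsNthDerivative : ℕ → (ℤ → ℤ × ℤ) → (ℤ → ℤ × ℤ) → Prop
  | 0, p, q => q = p
  | n + 1, p, q => ∃ r : ℤ → ℤ × ℤ, IsNthDerivative n p r ∧ IsDerivative r q

/-- The lattice `2ᵏ ℤ²` for `n = 2k`, and `(2ᵏ, 2ᵏ) ℤ + (2ᵏ, -2ᵏ) ℤ` for `n = 2k + 1`. -/
def foldLattice (n : ℕ) : Set (ℤ × ℤ) :=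
  if Even n then {v | ∃ a b : ℤ, v = (2 ^ (n / 2) * a, 2 ^ (n / 2) * b)}
  else {v | ∃ a b : ℤ, v = (2 ^ (n / 2) * (a + b), 2 ^ (n / 2) * (a - b))}

/-- The set `E_n(C)`: the translate of `foldLattice n` which contains all the vertices of the
`n`-th derivative of `C`. -/
def curveE (C : ℤ → Segment) (n : ℕ) : Set (ℤ × ℤ) :=
  {X | ∃ q : ℤ → ℤ × ℤ, IsNthDerivative n (vertexSeq C) q ∧ ∃ i : ℤ, X - q i ∈ foldLattice n}

/-- `C` has the type `A`: the segments `C i` with `i ∈ E_1` have supports of direction `A`. -/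
def HasType (C : ℤ → Segment) (A : Axis) : Prop :=
  ∀ i ∈ seqE (assocSeq C) 1, (C i).axis = A

/-! ### Coverings -/

/-- Coverings of the plane by segments. -/
structure IsCovering (α : ℝ) (𝓔 : Set Segment) : Prop where
  /-- Each unit interval of the grid is the support of a unique segment. -/
  existsUnique_support : ∀ I : Axis × ℤ × ℤ, ∃! s : Segment, s ∈ 𝓔 ∧ s.support = I
  /-- Two distinct non consecutive segments with a common endpoint can be completed into pairs of
  consecutive segments, with all four segments having distinct supports which contain it. -/
  completion : ∀ s ∈ 𝓔, ∀ t ∈ 𝓔, s ≠ t → ¬ Consecutive α s t → ¬ Consecutive α t s →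
    ∀ X : ℤ × ℤ, s.HasEndpoint X → t.HasEndpoint X →
      ∃ s' ∈ 𝓔, ∃ t' ∈ 𝓔,
        (Consecutive α s s' ∨ Consecutive α s' s) ∧ (Consecutive α t t' ∨ Consecutive α t' t) ∧
        s'.HasEndpoint X ∧ t'.HasEndpoint X ∧
        [s.support, s'.support, t.support, t'.support].Pairwise (· ≠ ·)

/-- The curves of a set `𝓔` of segments: the complete curves which consist of segments of `𝓔`. -/
def IsCurveOf (α : ℝ) (𝓔 : Set Segment) (C : ℤ → Segment) : Prop :=
  IsCompleteCurve α C ∧ ∀ i : ℤ, C i ∈ 𝓔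

/-- Coverings of the plane by complete folding curves: coverings which are unions of complete
folding curves. (In a covering, each segment has just one successor and one predecessor, so that
two curves are disjoint or differ only in the indexation, and all the curves are obtained so.) -/
def IsCoveringByCompleteFoldingCurves (α : ℝ) (𝓔 : Set Segment) : Prop :=
  IsCovering α 𝓔 ∧
    ∀ s ∈ 𝓔, ∃ C : ℤ → Segment,
      IsCompleteFoldingCurve α C ∧ (∀ i : ℤ, C i ∈ 𝓔) ∧ ∃ i : ℤ, C i = s

/-- The local isomorphism property of a set `𝒯` of tiles: for each bounded set `ℱ` of tiles of
`𝒯`, there is `r > 0` such that each ball of radius `r` contains the image of `ℱ` under some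
translation, as a set of tiles of `𝒯`. -/
def TilingLocalIsomorphismProperty (𝒯 : Set (Set Plane)) : Prop :=
  ∀ ℱ : Set (Set Plane), ℱ ⊆ 𝒯 → Bornology.IsBounded (⋃₀ ℱ) →
    ∃ r : ℝ, 0 < r ∧ ∀ c : Plane, ∃ v : Plane, ∀ P ∈ ℱ,
      (fun p => v + p) '' P ∈ 𝒯 ∧ (fun p => v + p) '' P ⊆ Metric.ball c r

/-- A covering satisfies the local isomorphism property if the associated tiling does. -/
def LocalIsomorphismProperty (α : ℝ) (𝓔 : Set Segment) : Prop :=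
  TilingLocalIsomorphismProperty (Segment.tile α '' 𝓔)

end Paperfolding

open Paperfolding

namespace Paperfolding

/-! ### Sequences with the alternation property of complete folding sequences -/

/-! Two rigidity facts carry the theorem. Points of the plane lattice are treated as Gaussian
integers, so that `foldLattice n` is the ideal generated by `(1 + gi) ^ n` and each derivative
multiplies the steps of a curve by `1 + gi` up to a unit.

A complete folding sequence alternates, for each `n`, along a class modulo `2 ^ (n + 1)`. This alone
(`IsAlt`) gives the nested classes `E_n`, and an integer of level `n`, i.e. in `E_n` but not in
`E_(n+1)`, is one where the level `n` alternation takes place (`altAt_iff`). Membership in `E_n` is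
detected by a finite window (`mem_seqE_iff_of_agree`). Along a curve, level and turn are arithmetic
data of the vertex: the vertices of `E_n` are those congruent to each other modulo `(1 + gi) ^ n`
(`FoldPath.dvd_sub_iff`), and two vertices of level `n` carry the same turn exactly when they are
congruent modulo `(1 + gi) ^ (n + 2)` (`FoldPath.eq_iff_dvd`).

Local isomorphism implies uniformity because every folding curve contains all the edges at the
vertices of arbitrarily large squares (`FoldPath.exists_fullSquare`). A tile determines its segment
up to an integral translation (`Segment.eq_translate_of_tile`). Hence, given finite pieces of two
curves `C` and `D`, a single translation carries both pieces into a square filled by `C`, so both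
become pieces of `C` (`IsGoodCurve.exists_translate`). Subwords, types and the sets `E_n` of `D` can
then be compared with those of `C` inside `C` itself.

Conversely, if types, sets `E_n` and subwords agree, the congruence rule for turns holds across
different curves (`FoldPath.eq_iff_dvd_of_locallyIsomorphic`), and curves meeting at a vertex turn
the same way there. The covering is therefore encoded by one marking of the lattice: nested cosets
`E n` and a sign at each point (`HasUniformCurves.exists_marking`). Orientations are read off from
`E 1` and the type, bends from the signs. In a finite region at most one point has large or infinite
level; moving it to a point of finite level with the same sign, by a vector highly divisible by `1 +
gi`, preserves all signs of the region. Such vectors occur within bounded distance of every point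
(`IsMarking.exists_translation`), which is the local isomorphism property. -/

/-- The terms of `a` of index in `h + 2ⁿ⁺¹ ℤ` are alternately `1` and `-1`. -/
def AltAt (a : ℤ → ℤˣ) (n : ℕ) (h : ℤ) : Prop :=
  ∀ k : ℤ, a (h + k * 2 ^ (n + 1)) = (-1) ^ k * a h

/-- At each level `n`, some class modulo `2ⁿ⁺¹` carries an alternating subsequence. -/
def IsAlt (a : ℤ → ℤˣ) : Prop := ∀ n, ∃ h, AltAt a n h

lemma isSubword_iff {w : List ℤˣ} {a : ℤ → ℤˣ} :
    IsSubword w a ↔ ∃ h : ℤ, w = (List.range w.length).map fun k : ℕ => a (h + (k : ℤ)) := by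
  -- The cast of the list of indices to integers in `IsSubword` unfolds to a monadic bind; `e`
  -- rewrites it as a `map`.
  have e : ∀ l : List ℕ, (do let x ← l; pure (x : ℤ)) = l.map fun x : ℕ => (x : ℤ) := by
    intro l
    exact List.map_eq_flatMap.symm
  unfold IsSubword
  simp only [e, List.map_map, Function.comp_def]

lemma isSubword_map_range (a : ℤ → ℤˣ) (h : ℤ) (n : ℕ) :
    IsSubword ((List.range n).map fun k : ℕ => a (h + (k : ℤ))) a :=
  isSubword_iff.2 ⟨h, by simp⟩

lemma exists_agree_of_isSubword {a b : ℤ → ℤˣ} {h : ℤ} {n : ℕ}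
    (H : IsSubword ((List.range n).map fun k : ℕ => a (h + (k : ℤ))) b) :
    ∃ g : ℤ, ∀ k : ℕ, k < n → a (h + k) = b (g + k) := by
  obtain ⟨g, hg⟩ := isSubword_iff.1 H
  refine ⟨g, fun k hk => ?_⟩
  have := congrArg (fun l => l[k]?) hg
  simpa [hk] using this

lemma unit_ne_neg (u : ℤˣ) : u ≠ -u := by
  rcases Int.units_eq_one_or u with h | h <;> subst h <;> decide

lemma negOne_zpow_add_one (k : ℤ) : (-1 : ℤˣ) ^ (k + 1) = -(-1) ^ k := by
  rw [zpow_add_one]; simp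

lemma AltAt.shift {a : ℤ → ℤˣ} {n : ℕ} {h : ℤ} (H : AltAt a n h) (j : ℤ) :
    AltAt a n (h + j * 2 ^ (n + 1)) := by
  intro k
  rw [H j, show h + j * 2 ^ (n + 1) + k * 2 ^ (n + 1) = h + (k + j) * 2 ^ (n + 1) by ring, H,
    zpow_add, mul_assoc]

lemma AltAt.of_dvd {a : ℤ → ℤˣ} {n : ℕ} {h i : ℤ} (H : AltAt a n h)
    (hi : (2 : ℤ) ^ (n + 1) ∣ i - h) : AltAt a n i := by
  obtain ⟨j, hj⟩ := hi
  rw [show i = h + j * 2 ^ (n + 1) by linarith]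
  exact H.shift j

lemma altAt_of_neg {a : ℤ → ℤˣ} {n : ℕ} {h : ℤ}
    (H : ∀ k : ℤ, a (h + k * 2 ^ (n + 1) + 2 ^ (n + 1)) = -a (h + k * 2 ^ (n + 1))) :
    AltAt a n h := by
  intro k
  induction k using Int.induction_on with
  | zero => simp
  | succ k ih =>
    rw [negOne_zpow_add_one, neg_mul, ← ih, ← H]; congr 1; ring
  | pred k ih =>
    have h1 := H (-k - 1)
    rw [show h + (-(k : ℤ) - 1) * 2 ^ (n + 1) + 2 ^ (n + 1) = h + -(k : ℤ) * 2 ^ (n + 1) by ring,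
      ih] at h1
    have h2 := negOne_zpow_add_one (-(k : ℤ) - 1)
    rw [sub_add_cancel] at h2
    rw [h2, neg_mul] at h1
    exact (neg_injective h1).symm

lemma AltAt.add_pow {a : ℤ → ℤˣ} {n : ℕ} {h : ℤ} (H : AltAt a n h) :
    a (h + 2 ^ (n + 1)) = -a h := by
  have := H 1
  simpa using this

lemma AltAt.add_two_pow {a : ℤ → ℤˣ} {n : ℕ} {h : ℤ} (H : AltAt a n h) (t : ℤ) :
    a (h + t * 2 ^ (n + 2)) = a h := by
  have := H (t * 2)
  rw [zpow_mul'] at this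
  simp only [zpow_ofNat, even_two, Even.neg_pow, one_pow, one_zpow, one_mul] at this
  rw [← this]; congr 1; ring

/-- Otherwise the level `m` alternation would pass through `h'` and give there the period `2 ^ (m +
2)`, which divides `2 ^ (n + 1)`, against the sign change of level `n`. -/
lemma AltAt.not_dvd {a : ℤ → ℤˣ} {m n : ℕ} {h h' : ℤ} (H : AltAt a m h) (H' : AltAt a n h')
    (hmn : m < n) : ¬ (2 : ℤ) ^ (m + 1) ∣ h' - h := by
  intro hd
  have H1 := H.of_dvd hd
  have h1 := H'.add_pow
  have h2 := H1.add_two_pow (2 ^ (n - m - 1))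
  rw [← pow_add, show n - m - 1 + (m + 2) = n + 1 by omega] at h2
  exact unit_ne_neg _ (h2.symm.trans h1)

lemma two_pow_succ_dvd_sub {m : ℕ} {x y : ℤ} (hx : (2 : ℤ) ^ m ∣ x) (hy : (2 : ℤ) ^ m ∣ y)
    (hx' : ¬ (2 : ℤ) ^ (m + 1) ∣ x) (hy' : ¬ (2 : ℤ) ^ (m + 1) ∣ y) :
    (2 : ℤ) ^ (m + 1) ∣ x - y := by
  obtain ⟨x, rfl⟩ := hx
  obtain ⟨y, rfl⟩ := hy
  have h2 : (2 : ℤ) ^ m ≠ 0 := by positivity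
  rw [pow_succ, mul_dvd_mul_iff_left h2] at hx' hy'
  rw [← mul_sub, pow_succ, mul_dvd_mul_iff_left h2]
  omega

/-- Induction on `m`: points of level above `m` lie in the class of level `m` points modulo `2 ^ m`
but avoid it modulo `2 ^ (m + 1)`, and only one other class remains. -/
lemma AltAt.dvd {a : ℤ → ℤˣ} (ha : IsAlt a) {m n : ℕ} {h h' : ℤ} (H : AltAt a m h)
    (H' : AltAt a n h') (hmn : m ≤ n) : (2 : ℤ) ^ m ∣ h' - h := by
  induction m generalizing h h' n with
  | zero => simp
  | succ m ih =>
    obtain ⟨h0, H0⟩ := ha m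
    have e : h' - h = (h' - h0) - (h - h0) := by ring
    rw [e]
    exact two_pow_succ_dvd_sub (ih H0 H' (by omega)) (ih H0 H (by omega))
      (H0.not_dvd H' (by omega)) (H0.not_dvd H (by omega))

lemma mem_seqE_iff {a : ℤ → ℤˣ} (ha : IsAlt a) {n : ℕ} {h i : ℤ} (H : AltAt a n h) :
    i ∈ seqE a n ↔ (2 : ℤ) ^ n ∣ i - h := by
  constructor
  · rintro ⟨h', H', hd⟩
    have := H.dvd ha H' le_rfl
    have e : i - h = (i - h') + (h' - h) := by ring
    rw [e]
    exact dvd_add hd this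
  · exact fun hd => ⟨h, H, hd⟩

lemma AltAt.mem_seqE {a : ℤ → ℤˣ} {n : ℕ} {h : ℤ} (H : AltAt a n h) : h ∈ seqE a n :=
  ⟨h, H, by simp⟩

lemma seqE_nonempty {a : ℤ → ℤˣ} (ha : IsAlt a) (n : ℕ) : (seqE a n).Nonempty := by
  obtain ⟨h, H⟩ := ha n
  exact ⟨h, H.mem_seqE⟩

lemma mem_seqE_zero {a : ℤ → ℤˣ} (ha : IsAlt a) (i : ℤ) : i ∈ seqE a 0 := by
  obtain ⟨h, H⟩ := ha 0
  simp [mem_seqE_iff ha H]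

lemma mem_seqE_iff_dvd {a : ℤ → ℤˣ} (ha : IsAlt a) {n : ℕ} {i j : ℤ} (hi : i ∈ seqE a n) :
    j ∈ seqE a n ↔ (2 : ℤ) ^ n ∣ j - i := by
  obtain ⟨h, H⟩ := ha n
  rw [mem_seqE_iff ha H] at hi ⊢
  rw [show j - h = (j - i) + (i - h) by ring, dvd_add_left hi]

lemma seqE_antitone {a : ℤ → ℤˣ} (ha : IsAlt a) : Antitone (seqE a) := by
  apply antitone_nat_of_succ_le
  intro n i hi
  obtain ⟨h, H⟩ := ha n
  obtain ⟨h', H'⟩ := ha (n + 1)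
  rw [mem_seqE_iff ha H'] at hi
  rw [mem_seqE_iff ha H, show i - h = (i - h') + (h' - h) by ring]
  exact dvd_add ((pow_dvd_pow 2 (Nat.le_succ n)).trans hi) (H.dvd ha H' (Nat.le_succ n))

/-- Identifies the alternating indices with the level sets `E_n \ E_(n+1)`; everything later is
phrased through levels. -/
lemma altAt_iff {a : ℤ → ℤˣ} (ha : IsAlt a) {n : ℕ} {i : ℤ} :
    AltAt a n i ↔ i ∈ seqE a n ∧ i ∉ seqE a (n + 1) := by
  obtain ⟨h', H'⟩ := ha (n + 1)
  constructor
  · intro H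
    refine ⟨H.mem_seqE, fun hi => ?_⟩
    rw [mem_seqE_iff ha H'] at hi
    exact H.not_dvd H' (Nat.lt_succ_self n) (by rwa [← dvd_neg, neg_sub])
  · rintro ⟨h1, h2⟩
    obtain ⟨h, H⟩ := ha n
    rw [mem_seqE_iff ha H'] at h2
    have h3 := mem_seqE_iff ha H |>.1 h1
    have h4 := H.dvd ha H' (Nat.le_succ n)
    have h5 : (2 : ℤ) ^ n ∣ i - h' := by
      rw [show i - h' = (i - h) - (h' - h) by ring]
      exact dvd_sub h3 h4
    refine H.of_dvd ?_
    rw [show i - h = (i - h') - (h - h') by ring]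
    refine two_pow_succ_dvd_sub h5 (by rwa [← dvd_neg, neg_sub]) h2 ?_
    rw [← dvd_neg, neg_sub]
    exact H.not_dvd H' (Nat.lt_succ_self n)

lemma exists_altAt_of_notMem {a : ℤ → ℤˣ} (ha : IsAlt a) {n : ℕ} {i : ℤ} (hi : i ∉ seqE a n) :
    ∃ m < n, AltAt a m i := by
  induction n with
  | zero => exact absurd (mem_seqE_zero ha i) hi
  | succ n ih =>
    by_cases h : i ∈ seqE a n
    · exact ⟨n, Nat.lt_succ_self n, (altAt_iff ha).2 ⟨h, hi⟩⟩
    · obtain ⟨m, hm, H⟩ := ih h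
      exact ⟨m, by omega, H⟩

/-- Such an index has a level `m < n`, hence the period `2 ^ (m + 2)`, a divisor of `2 ^ (n + 1)`.
-/
lemma add_period_of_notMem {a : ℤ → ℤˣ} (ha : IsAlt a) {n : ℕ} {i : ℤ} (hi : i ∉ seqE a n)
    (t : ℤ) : a (i + t * 2 ^ (n + 1)) = a i := by
  obtain ⟨m, hm, H⟩ := exists_altAt_of_notMem ha hi
  have := H.add_two_pow (t * 2 ^ (n - m - 1))
  rw [mul_assoc, ← pow_add, show n - m - 1 + (m + 2) = n + 1 by omega] at this
  exact this

lemma add_mul_pow_mem_seqE {a : ℤ → ℤˣ} (ha : IsAlt a) {n : ℕ} {i : ℤ} (hi : i ∈ seqE a n)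
    (t : ℤ) : i + t * 2 ^ n ∈ seqE a n := by
  rw [mem_seqE_iff_dvd ha hi]
  exact ⟨t, by ring⟩

lemma altAt_add_pow {a : ℤ → ℤˣ} (ha : IsAlt a) {n : ℕ} {i : ℤ} (hi : i ∈ seqE a (n + 1)) :
    AltAt a n (i + 2 ^ n) := by
  rw [altAt_iff ha]
  constructor
  · have := add_mul_pow_mem_seqE ha (seqE_antitone ha (Nat.le_succ n) hi) 1
    simpa using this
  · rw [mem_seqE_iff_dvd ha hi, add_sub_cancel_left, pow_succ]
    intro h
    have h2 : (2 : ℤ) ^ n ≠ 0 := by positivity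
    obtain ⟨t, ht⟩ := h
    rw [mul_assoc] at ht
    have := mul_left_cancel₀ h2 ((mul_one _).trans ht)
    omega

/-- Levels are visible in finite windows. Four indices in progression of difference `2 ^ (n + 1)`
suffice: if `h'` had level `n`, `b` would alternate on them, giving equal values at distance `2 ^ (n
+ 2)`. But `h` lies in `E_(n+1)`, so one of `h`, `h + 2 ^ (n + 1)` has level `n + 1`, and `a`
changes sign from it over that distance. -/
lemma mem_seqE_succ_of_agree {a b : ℤ → ℤˣ} (ha : IsAlt a) (hb : IsAlt b) {n : ℕ} {h h' : ℤ}
    (hab : ∀ j : ℕ, j < 2 ^ (n + 2) → a (h + j) = b (h' + j)) (hh : h ∈ seqE a n) :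
    h' ∈ seqE b n := by
  induction n with
  | zero => exact mem_seqE_zero hb h'
  | succ n ih =>
    have h1 := ih (fun j hj => hab j (hj.trans (Nat.pow_lt_pow_right (by norm_num) (by omega))))
      (seqE_antitone ha (Nat.le_succ n) hh)
    by_contra hcon
    have H' : AltAt b n h' := (altAt_iff hb).2 ⟨h1, hcon⟩
    have e1 := hab 0 (by positivity)
    have hp : 0 < 2 ^ (n + 1) := by positivity
    have hp4 : 2 ^ (n + 1 + 2) = 4 * 2 ^ (n + 1) := by ring
    have e2 := hab (2 ^ (n + 1)) (by rw [hp4]; omega)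
    have e3 := hab (2 * 2 ^ (n + 1)) (by rw [hp4]; omega)
    have e4 := hab (3 * 2 ^ (n + 1)) (by rw [hp4]; omega)
    push_cast at e1 e2 e3 e4
    rw [add_zero, add_zero] at e1
    have f2 := H' 1
    have f3 := H' 2
    have f4 := H' 3
    rw [f3] at e3
    rw [f4] at e4
    rw [one_mul] at f2
    rw [f2] at e2
    by_cases hc : h ∈ seqE a (n + 2)
    · have g := (altAt_add_pow ha hc).add_pow
      rw [show h + 2 ^ (n + 1) + 2 ^ (n + 1 + 1) = h + 3 * 2 ^ (n + 1) by ring, e4, e2] at g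
      exact unit_ne_neg _ g
    · have g := ((altAt_iff ha).2 ⟨hh, hc⟩).add_pow
      rw [show h + 2 ^ (n + 1 + 1) = h + 2 * 2 ^ (n + 1) by ring, e3, e1, zpow_ofNat,
        neg_one_sq, one_mul] at g
      exact unit_ne_neg _ g

lemma mem_seqE_iff_of_agree {a b : ℤ → ℤˣ} (ha : IsAlt a) (hb : IsAlt b) {n : ℕ} {h h' : ℤ}
    (hab : ∀ j : ℕ, j < 2 ^ (n + 2) → a (h + j) = b (h' + j)) : h ∈ seqE a n ↔ h' ∈ seqE b n :=
  ⟨mem_seqE_succ_of_agree ha hb hab, mem_seqE_succ_of_agree hb ha fun j hj => (hab j hj).symm⟩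

/-- Locally isomorphic sequences agree just after the integers of level `n + 1`. -/
lemma eq_of_seqLocallyIsomorphic {a b : ℤ → ℤˣ} (ha : IsAlt a) (hb : IsAlt b)
    (hab : SeqLocallyIsomorphic a b) {n : ℕ} {h h' : ℤ} (H : AltAt a n h) (H' : AltAt b n h')
    {j : ℕ} (hj : 0 < j) (hj' : j < 2 ^ n) : a (h + j) = b (h' + j) := by
  obtain ⟨g, hag⟩ := exists_agree_of_isSubword
    ((hab _).1 (isSubword_map_range a h (2 ^ (n + 3))))
  have hlt : 2 ^ (n + 2) < 2 ^ (n + 3) := Nat.pow_lt_pow_right (by norm_num) (by omega)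
  have hG : AltAt b n g := by
    rw [altAt_iff hb, ← mem_seqE_iff_of_agree ha hb hag,
      ← mem_seqE_iff_of_agree ha hb fun j hj => hag j (hj.trans hlt), ← altAt_iff ha]
    exact H
  rw [hag j (hj'.trans (Nat.pow_lt_pow_right (by norm_num) (by omega)))]
  obtain ⟨t, ht⟩ := (mem_seqE_iff_dvd hb hG.mem_seqE).1 H'.mem_seqE
  -- The bounds `0 < j < 2 ^ n` keep the index strictly between two elements of `E_n`, so the value
  -- is periodic there.
  have hnot : g + j ∉ seqE b n := by
    rw [mem_seqE_iff_dvd hb hG.mem_seqE, add_sub_cancel_left]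
    intro h
    have := Int.le_of_dvd (by exact_mod_cast hj) h
    have : 2 ^ n ≤ j := by exact_mod_cast this
    omega
  -- Two integers of the same level `n` are congruent modulo `2 ^ (n + 1)`, since both avoid
  -- `E_(n+1)`.
  have hdd : (2 : ℤ) ^ (n + 1) ∣ h' - g := by
    by_contra hnd
    obtain ⟨r, hr⟩ := hb (n + 1)
    have h1 := hG.not_dvd hr (Nat.lt_succ_self n)
    have h2 := H'.not_dvd hr (Nat.lt_succ_self n)
    apply hnd
    rw [show h' - g = (r - g) - (r - h') by ring]
    exact two_pow_succ_dvd_sub (hG.dvd hb hr (Nat.le_succ n)) (H'.dvd hb hr (Nat.le_succ n)) h1 h2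
  obtain ⟨t, ht⟩ := hdd
  have := add_period_of_notMem hb hnot t
  rw [← this]
  congr 1
  linarith

/-! ### Complete folding sequences have the alternation property -/

lemma IsNFoldingWord.length_add_one {n : ℕ} {S : List ℤˣ} (h : IsNFoldingWord n S) :
    S.length + 1 = 2 ^ n := by
  induction h with
  | zero => rfl
  | succ n S ε _ ih => simp [barWord, pow_succ]; omega

lemma barWord_getElem? {S : List ℤˣ} {i j : ℕ} (h : i + j + 1 = S.length) :
    (barWord S)[i]? = S[j]?.map (- ·) := by
  rw [barWord, List.getElem?_reverse (by simp; omega), List.getElem?_map]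
  simp only [List.length_map]
  congr 2
  omega

/-- In an `n`-folding word, indexed from `1`, the terms of index in `2ᵐ + 2ᵐ⁺¹ ℕ` alternate. -/
lemma IsNFoldingWord.alternate {n : ℕ} {S : List ℤˣ} (h : IsNFoldingWord n S) (m i : ℕ)
    (hi : (i + 1) % 2 ^ (m + 1) = 2 ^ m) (hlt : i + 2 ^ (m + 1) + 1 < 2 ^ n) :
    S[i + 2 ^ (m + 1)]? = S[i]?.map (- ·) := by
  induction h generalizing i with
  | zero => simp at hlt
  | succ n S ε hS ih =>
    have hl := hS.length_add_one
    have hb : (barWord S).length = S.length := by simp [barWord]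
    have hpos : 0 < 2 ^ m := by positivity
    have hm1 : 2 ^ (m + 1) = 2 * 2 ^ m := by ring
    have hn1 : 2 ^ (n + 1) = 2 * 2 ^ n := by ring
    have hmn : m + 1 < n + 1 := by
      rw [← Nat.pow_lt_pow_iff_right (a := 2) (by norm_num)]; omega
    -- With `M = 2 ^ (m + 1)`, the middle fold has index `M * q` (from `1`) and the term considered
    -- has index `M * d + 2 ^ m`. Comparing `d` with `q` locates it, and the next term of the class,
    -- with respect to the middle.
    obtain ⟨q, hq⟩ : 2 ^ (m + 1) ∣ 2 ^ n := pow_dvd_pow 2 (by omega)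
    have hi' := Nat.div_add_mod (i + 1) (2 ^ (m + 1))
    rw [hi] at hi'
    set d := (i + 1) / 2 ^ (m + 1) with hd
    clear_value d
    set M := 2 ^ (m + 1) with hM
    have hright : ∀ j, (barWord S ++ ε :: S)[S.length + 1 + j]? = S[j]? := by
      intro j
      rw [List.getElem?_append_right (by omega), hb,
        show S.length + 1 + j - S.length = j + 1 by omega, List.getElem?_cons_succ]
    have hleft : ∀ j j', j + j' + 1 = S.length →
        (barWord S ++ ε :: S)[j]? = S[j']?.map (- ·) := by
      intro j j' hj
      rw [List.getElem?_append_left (by omega), barWord_getElem? hj]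
    rcases lt_trichotomy d q with hdq | hdq | hdq
    · rcases Nat.lt_or_ge (d + 1) q with hdq' | hdq'
      · obtain ⟨e, rfl⟩ : ∃ e, q = d + 1 + 1 + e := ⟨q - (d + 2), by omega⟩
        have hexp : M * (d + 1 + 1 + e) = M * d + M + M + M * e := by ring
        rw [hleft (i + M) (M * e + 2 ^ m - 1) (by omega),
          hleft i (M * e + 2 ^ m - 1 + M) (by omega)]
        rw [ih (M * e + 2 ^ m - 1) _ (by omega)]
        · simp
        · rw [show M * e + 2 ^ m - 1 + 1 = 2 ^ m + M * e by omega, Nat.add_mul_mod_self_left]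
          exact Nat.mod_eq_of_lt (by omega)
      -- The two terms are mirror images across the middle, so the bar operation gives opposite
      -- signs at once.
      · obtain rfl : q = d + 1 := by omega
        have hexp : M * (d + 1) = M * d + M := by ring
        rw [show i + M = S.length + 1 + (2 ^ m - 1) by omega, hright,
          hleft i (2 ^ m - 1) (by omega)]
        simp
    · subst hdq
      obtain ⟨j, rfl⟩ : ∃ j, i = S.length + 1 + j := ⟨i - (S.length + 1), by omega⟩
      rw [add_assoc, hright, hright, ih j _ (by omega)]
      have : j + 1 = 2 ^ m := by omega
      rw [this]
      exact Nat.mod_eq_of_lt (by omega)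
    · obtain ⟨e, rfl⟩ : ∃ e, d = q + e := ⟨d - q, by omega⟩
      have hexp : M * (q + e) = M * q + M * e := by ring
      obtain ⟨j, rfl⟩ : ∃ j, i = S.length + 1 + j := ⟨i - (S.length + 1), by omega⟩
      rw [add_assoc, hright, hright, ih j _ (by omega)]
      rw [show j + 1 = 2 ^ m + M * e by omega, Nat.add_mul_mod_self_left]
      exact Nat.mod_eq_of_lt (by omega)

/-- Compactness: each window `[-M, M)` has some residue along which the terms alternate, there are
finitely many residues, and a residue that works for a window works for the smaller ones; so one
residue works for all windows. -/
lemma IsCompleteFoldingSeq.isAlt {a : ℤ → ℤˣ} (ha : IsCompleteFoldingSeq a) : IsAlt a := by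
  intro n
  have hwin : ∀ M : ℕ, ∃ h ∈ Finset.range (2 ^ (n + 1)), ∀ x : ℤ, (2 : ℤ) ^ (n + 1) ∣ x - (h : ℤ) →
      -(M : ℤ) ≤ x → x + 2 ^ (n + 1) < M → a (x + 2 ^ (n + 1)) = -a x := by
    intro M
    obtain ⟨N, S, hS, u, v, huv⟩ := ha _ (isSubword_map_range a (-(M : ℤ)) (2 * M))
    have hget : ∀ k : ℕ, k < 2 * M → S[u.length + k]? = some (a (-(M : ℤ) + k)) := by
      intro k hk
      rw [← huv, List.append_assoc, List.getElem?_append_right (by omega),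
        List.getElem?_append_left (by simp; omega)]
      simp [hk]
    set P : ℤ := 2 ^ (n + 1) with hP
    have hPpos : 0 < P := by positivity
    have hPn : ((2 ^ (n + 1) : ℕ) : ℤ) = P := by simp [hP]
    -- The integer `x` of the window has index `x + M + u.length + 1` (from `1`) in `S`; the
    -- alternating terms are those with index congruent to `2 ^ n` modulo `P`.
    refine ⟨((2 ^ n - (u.length + 1 + M : ℤ)) % P).toNat, ?_, ?_⟩
    · rw [Finset.mem_range]
      have := Int.emod_lt_of_pos (2 ^ n - (u.length + 1 + M : ℤ)) hPpos
      have := Int.emod_nonneg (2 ^ n - (u.length + 1 + M : ℤ)) hPpos.ne'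
      omega
    · intro x hx h1 h2
      rw [Int.toNat_of_nonneg (Int.emod_nonneg _ hPpos.ne')] at hx
      obtain ⟨k, hk⟩ : ∃ k : ℕ, x = -(M : ℤ) + k := ⟨(x + M).toNat, by omega⟩
      have hk1 : k < 2 * M := by omega
      have hk2 : k + 2 ^ (n + 1) < 2 * M := by omega
      have hlt : u.length + (k + 2 ^ (n + 1)) < S.length := by
        rw [← huv]; simp; omega
      have halt := hS.alternate n (u.length + k) ?_ ?_
      · rw [add_assoc, hget _ hk2, hget _ hk1, Option.map_some, Option.some_inj] at halt
        rw [hk, ← halt, add_assoc, ← hPn]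
        push_cast
        rfl
      · zify
        have hd : P ∣ (u.length + k + 1 : ℤ) - 2 ^ n := by
          have h3 := Int.dvd_sub_self_of_emod_eq (a := (2 ^ n - (u.length + 1 + M : ℤ))) (b := P) rfl
          have e : (u.length + k + 1 : ℤ) - 2 ^ n =
              (x - (2 ^ n - (u.length + 1 + M : ℤ)) % P) +
                ((2 ^ n - (u.length + 1 + M : ℤ)) % P - (2 ^ n - (u.length + 1 + M : ℤ))) := by
            rw [hk]; ring
          rw [e]
          exact dvd_add hx h3
        have h5 : (u.length + k + 1 : ℤ) % P = 2 ^ n % P := ((Int.modEq_iff_dvd).2 hd).symm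
        rw [← hP, h5]
        refine Int.emod_eq_of_lt (by positivity) ?_
        rw [hP, pow_succ]
        have : (0 : ℤ) < 2 ^ n := by positivity
        omega
      · have := hS.length_add_one
        omega
  obtain ⟨h, hh⟩ : ∃ h ∈ Finset.range (2 ^ (n + 1)), ∀ M : ℕ, ∀ x : ℤ,
      (2 : ℤ) ^ (n + 1) ∣ x - (h : ℤ) → -(M : ℤ) ≤ x → x + 2 ^ (n + 1) < M →
      a (x + 2 ^ (n + 1)) = -a x := by
    by_contra! hcon
    choose! M x hM using hcon
    -- If every residue `h` fails for some window `M h`, the window of size the supremum of these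
    -- contradicts `hwin`.
    obtain ⟨h, hh, H⟩ := hwin ((Finset.range (2 ^ (n + 1))).sup M)
    have hle : M h ≤ (Finset.range (2 ^ (n + 1))).sup M := Finset.le_sup hh
    obtain ⟨h1, h2, h3, h4⟩ := hM h hh
    exact h4 (H _ h1 (by omega) (by omega))
  refine ⟨h, altAt_of_neg fun k => ?_⟩
  set x : ℤ := (h : ℤ) + k * 2 ^ (n + 1) with hx
  refine hh.2 (x.natAbs + 2 ^ (n + 1) + 1) x ⟨k, by rw [hx]; ring⟩ ?_ ?_
  · have := neg_abs_le x
    push_cast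
    have : (0 : ℤ) < 2 ^ (n + 1) := by positivity
    linarith
  · have := le_abs_self x
    push_cast
    linarith

/-! ### Folding paths in the Gaussian integers -/

/-- The imaginary unit of the Gaussian integers. -/
def gi : GaussianInt := ⟨0, 1⟩

@[simp] lemma gi_re : gi.re = 0 := rfl
@[simp] lemma gi_im : gi.im = 1 := rfl

lemma gi_mul_gi : gi * gi = -1 := by
  ext <;> simp

lemma gi_sq : gi ^ 2 = -1 := by rw [sq, gi_mul_gi]

lemma isUnit_gi : IsUnit gi := IsUnit.of_mul_eq_one (-gi) (by rw [mul_neg, gi_mul_gi, neg_neg])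

lemma isUnit_cases {u : GaussianInt} (hu : IsUnit u) : u = 1 ∨ u = -1 ∨ u = gi ∨ u = -gi := by
  rw [← Zsqrtd.norm_eq_one_iff] at hu
  have h : u.re * u.re + u.im * u.im = 1 := by
    have h0 := GaussianInt.norm_nonneg u
    have h1 : u.norm = 1 := by omega
    rw [Zsqrtd.norm_def] at h1
    linarith
  have h1 : u.re ≤ 1 := by nlinarith
  have h2 : -1 ≤ u.re := by nlinarith
  have h3 : u.im ≤ 1 := by nlinarith
  have h4 : -1 ≤ u.im := by nlinarith
  simp only [Zsqrtd.ext_iff]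
  generalize u.re = x at *
  generalize u.im = y at *
  interval_cases x <;> interval_cases y <;> simp at h ⊢

lemma one_add_gi_dvd {z : GaussianInt} : 1 + gi ∣ z ↔ (2 : ℤ) ∣ z.re + z.im := by
  constructor
  · rintro ⟨w, rfl⟩
    refine ⟨w.re, ?_⟩
    simp
    ring
  · rintro ⟨c, hc⟩
    refine ⟨⟨c, z.im - c⟩, ?_⟩
    ext
    · simp; linarith
    · simp

lemma one_add_gi_dvd_intCast {n : ℤ} : 1 + gi ∣ (n : GaussianInt) ↔ (2 : ℤ) ∣ n := by
  simp [one_add_gi_dvd]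

lemma one_add_gi_ne_zero : (1 + gi) ≠ 0 := by
  intro h
  have := congrArg Zsqrtd.re h
  simp at this

lemma one_add_gi_sq : (1 + gi) ^ 2 = 2 * gi := by
  linear_combination gi_sq

lemma one_add_gi_dvd_unit_sub_one {u : GaussianInt} (hu : IsUnit u) : 1 + gi ∣ u - 1 := by
  rw [one_add_gi_dvd]
  rcases isUnit_cases hu with rfl | rfl | rfl | rfl <;> simp

/-- The embedding of `{1, -1}` into the Gaussian integers. -/
def sgn (a : ℤˣ) : GaussianInt := ((a : ℤ) : GaussianInt)

@[simp] lemma sgn_one : sgn 1 = 1 := by simp [sgn]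
@[simp] lemma sgn_neg (a : ℤˣ) : sgn (-a) = -sgn a := by simp [sgn]
lemma sgn_mul_self (a : ℤˣ) : sgn a * sgn a = 1 := by
  rcases Int.units_eq_one_or a with rfl | rfl <;> simp

lemma isUnit_sgn (a : ℤˣ) : IsUnit (sgn a) := IsUnit.of_mul_eq_one _ (sgn_mul_self a)

lemma one_add_gi_mul_sgn (a : ℤˣ) : ∃ u, IsUnit u ∧ 1 + gi * sgn a = (1 + gi) * u := by
  rcases Int.units_eq_one_or a with rfl | rfl
  · exact ⟨1, isUnit_one, by simp⟩
  · exact ⟨-gi, isUnit_gi.neg, by simp only [sgn_neg, sgn_one]; linear_combination gi_sq⟩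

/-- A path whose steps have the form `g * u` with `u` a unit, and which turns left or right
according to `a`. -/
structure FoldPath (g : GaussianInt) (p : ℤ → GaussianInt) (a : ℤ → ℤˣ) : Prop where
  step_zero : ∃ u, IsUnit u ∧ p 1 - p 0 = g * u
  turn : ∀ i, p (i + 1) - p i = gi * sgn (a i) * (p i - p (i - 1))

namespace FoldPath

variable {g : GaussianInt} {p : ℤ → GaussianInt} {a : ℤ → ℤˣ}

lemma step (H : FoldPath g p a) (i : ℤ) : ∃ u, IsUnit u ∧ p (i + 1) - p i = g * u := by
  induction i using Int.induction_on with
  | zero => simpa using H.step_zero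
  | succ i ih =>
    obtain ⟨u, hu, e⟩ := ih
    refine ⟨gi * sgn (a (i + 1)) * u, (isUnit_gi.mul (isUnit_sgn _)).mul hu, ?_⟩
    rw [H.turn, add_sub_cancel_right, e]
    ring
  | pred i ih =>
    obtain ⟨u, hu, e⟩ := ih
    refine ⟨-gi * sgn (a (-i)) * u, (isUnit_gi.neg.mul (isUnit_sgn _)).mul hu, ?_⟩
    rw [H.turn] at e
    rw [sub_add_cancel]
    linear_combination (-gi * sgn (a (-i))) * e +
      (p (-i) - p (-i - 1)) * (gi_sq + gi ^ 2 * (sgn_mul_self (a (-i))))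

lemma shift (H : FoldPath g p a) (c : ℤ) :
    FoldPath g (fun i => p (i + c)) (fun i => a (i + c)) where
  step_zero := by
    obtain ⟨u, hu, e⟩ := H.step c
    exact ⟨u, hu, by simpa [add_comm] using e⟩
  turn i := by
    have := H.turn (i + c)
    rwa [show i + c + 1 = i + 1 + c by ring, show i + c - 1 = i - 1 + c by ring] at this

lemma two_step (H : FoldPath g p a) (i : ℤ) :
    p (i + 2) - p i = (p (i + 1) - p i) * (1 + gi * sgn (a (i + 1))) := by
  have := H.turn (i + 1)
  rw [add_sub_cancel_right, show i + 1 + 1 = i + 2 by ring] at this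
  linear_combination this

/-- A pair of steps is `v` followed by `i s v`, with sum `v (1 + i s)`, and `1 + i s` is `1 + i` up
to a unit. The next pair has middle turn `-s`, and `i s (1 - i s) = 1 + i s` shows that the derived
path turns by `a (2 * i)`. -/
lemma derive (H : FoldPath g p a) (ha : ∀ i, a (2 * i + 1) = -a (2 * i - 1)) :
    FoldPath (g * (1 + gi)) (fun i => p (2 * i)) (fun i => a (2 * i)) where
  step_zero := by
    obtain ⟨u, hu, e⟩ := H.step 0
    obtain ⟨v, hv, e'⟩ := one_add_gi_mul_sgn (a (0 + 1))
    refine ⟨u * v, hu.mul hv, ?_⟩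
    have := H.two_step 0
    rw [e, e'] at this
    simp only [mul_one, mul_zero]
    rw [zero_add] at this
    rw [this]
    ring
  turn i := by
    have h1 := H.two_step (2 * i)
    have h2 := H.two_step (2 * i - 2)
    have h3 := H.turn (2 * i)
    have h4 := H.turn (2 * i - 1)
    simp only [sub_add_cancel, show 2 * i - 2 + 1 = 2 * i - 1 by ring,
      show 2 * i - 1 - 1 = 2 * i - 2 by ring] at h2 h4
    have h5 := congrArg sgn (ha i)
    rw [sgn_neg] at h5
    rw [show 2 * (i + 1) = 2 * i + 2 by ring, show 2 * (i - 1) = 2 * i - 2 by ring]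
    have hs := sgn_mul_self (a (2 * i - 1))
    rw [h1, h2, h3, h4, h5]
    linear_combination (gi * sgn (a (2 * i)) * (p (2 * i - 1) - p (2 * i - 2))) *
      (-hs * gi ^ 2 - gi_sq)

end FoldPath

/-- Every unit is `1` modulo `1 + gi`, so a sum of `j` units has the parity of `j`. -/
lemma exists_sum_units {g : GaussianInt} {f : ℤ → GaussianInt}
    (H : ∀ i, ∃ u, IsUnit u ∧ f (i + 1) - f i = g * u) (j : ℤ) :
    ∃ s, f j - f 0 = g * s ∧ 1 + gi ∣ s - j := by
  induction j using Int.induction_on with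
  | zero => exact ⟨0, by simp⟩
  | succ i ih =>
    obtain ⟨s, h1, h2⟩ := ih
    obtain ⟨u, hu, h3⟩ := H i
    refine ⟨s + u, by linear_combination h1 + h3, ?_⟩
    have := dvd_add h2 (one_add_gi_dvd_unit_sub_one hu)
    convert this using 1
    push_cast
    ring
  | pred i ih =>
    obtain ⟨s, h1, h2⟩ := ih
    obtain ⟨u, hu, h3⟩ := H (-i - 1)
    rw [sub_add_cancel] at h3
    refine ⟨s - u, by linear_combination h1 - h3, ?_⟩
    have := dvd_sub h2 (one_add_gi_dvd_unit_sub_one hu)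
    convert this using 1
    push_cast
    ring

lemma one_add_gi_dvd_iff_of_dvd_sub {s : GaussianInt} {j : ℤ} (h : 1 + gi ∣ s - j) :
    1 + gi ∣ s ↔ (2 : ℤ) ∣ j := by
  rw [← one_add_gi_dvd_intCast]
  exact (dvd_iff_dvd_of_dvd_sub h)

lemma two_dvd_one_add_gi_sq (z : GaussianInt) : (1 + gi) ^ 2 ∣ 2 * z := by
  rw [one_add_gi_sq]
  exact ⟨-gi * z, by linear_combination (2 * z) * gi_sq⟩

namespace FoldPath

variable {g : GaussianInt} {p : ℤ → GaussianInt} {a : ℤ → ℤˣ}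

/-- The path through the vertices of the `n`-th derivative. -/
lemma iterate (H : FoldPath g p a) (ha : IsAlt a) {n : ℕ} {i : ℤ} (hi : i ∈ seqE a n) :
    FoldPath (g * (1 + gi) ^ n) (fun j => p (2 ^ n * j + i)) (fun j => a (2 ^ n * j + i)) := by
  induction n with
  | zero => simpa using H.shift i
  | succ n ih =>
    have h1 := ih (seqE_antitone ha (Nat.le_succ n) hi)
    have h2 := h1.derive fun j => ?_
    · simp only [← mul_assoc, ← pow_succ] at h2
      rw [pow_succ, ← mul_assoc]
      exact h2
    · have h3 := (altAt_add_pow ha (add_mul_pow_mem_seqE ha hi (j - 1))).add_pow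
      convert h3 using 2
      · ring
      · congr 1; ring

/-- If `j` has level `m < n`, then `j` is at an odd number of steps from `i` in the `m`-th
derivative, so the displacement is divisible by `g * (1 + gi) ^ m` and no further. -/
lemma dvd_sub_iff (H : FoldPath g p a) (hg : g ≠ 0) (ha : IsAlt a) {n : ℕ} {i j : ℤ}
    (hi : i ∈ seqE a n) : g * (1 + gi) ^ n ∣ p j - p i ↔ j ∈ seqE a n := by
  constructor
  · intro hd
    by_contra hj
    obtain ⟨m, hm, Hm⟩ := exists_altAt_of_notMem ha hj
    have hi1 : i ∈ seqE a (m + 1) := seqE_antitone ha hm hi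
    have hi0 : i ∈ seqE a m := seqE_antitone ha (Nat.le_succ m) hi1
    obtain ⟨k, hk⟩ := (mem_seqE_iff_dvd ha hi0).1 Hm.mem_seqE
    obtain ⟨s, hs, hsk⟩ := exists_sum_units (f := fun j => p (2 ^ m * j + i)) (H.iterate ha hi0).step k
    simp only [mul_zero, zero_add, ← hk, sub_add_cancel] at hs
    have hgm : g * (1 + gi) ^ m ≠ 0 := mul_ne_zero hg (pow_ne_zero _ one_add_gi_ne_zero)
    have h1 : g * (1 + gi) ^ m * (1 + gi) ∣ g * (1 + gi) ^ m * s := by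
      rw [← hs, mul_assoc, ← pow_succ]
      exact (mul_dvd_mul_left g (pow_dvd_pow _ hm)).trans hd
    rw [mul_dvd_mul_iff_left hgm, one_add_gi_dvd_iff_of_dvd_sub hsk] at h1
    obtain ⟨t, rfl⟩ := h1
    refine ((altAt_iff ha).1 Hm).2 ((mem_seqE_iff_dvd ha hi1).2 ⟨t, ?_⟩)
    rw [hk]; ring
  · intro hj
    obtain ⟨k, hk⟩ := (mem_seqE_iff_dvd ha hi).1 hj
    obtain ⟨s, hs, -⟩ := exists_sum_units (f := fun j => p (2 ^ n * j + i)) (H.iterate ha hi).step k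
    simp only [mul_zero, zero_add, ← hk, sub_add_cancel] at hs
    exact ⟨s, hs⟩

/-- Two successive steps of the `n`-th derivative are perpendicular, so their sum gains a factor `1
+ gi`. This is the displacement between neighbouring vertices of level `n`. -/
lemma double_step (H : FoldPath g p a) (ha : IsAlt a) {n : ℕ} {h : ℤ} (hh : h ∈ seqE a n) (j : ℤ) :
    ∃ u, IsUnit u ∧
      p (2 ^ n * (2 * (j + 1)) + h) - p (2 ^ n * (2 * j) + h) = g * (1 + gi) ^ (n + 1) * u := by
  have H2 := H.iterate ha hh
  obtain ⟨u, hu, e⟩ := H2.step (2 * j)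
  obtain ⟨v, hv, e'⟩ := one_add_gi_mul_sgn (a (2 ^ n * (2 * j + 1) + h))
  refine ⟨u * v, hu.mul hv, ?_⟩
  have := H2.two_step (2 * j)
  rw [e, e'] at this
  rw [mul_add, mul_one, this]
  ring

/-- On the vertices of level `n`, the turn is determined by the class modulo `(1 + i)ⁿ⁺²`. -/
lemma eq_iff_dvd (H : FoldPath g p a) (hg : g ≠ 0) (ha : IsAlt a) {n : ℕ} {h h' : ℤ}
    (Hh : AltAt a n h) (Hh' : AltAt a n h') :
    a h' = a h ↔ g * (1 + gi) ^ (n + 2) ∣ p h' - p h := by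
  obtain ⟨k, hk⟩ : (2 : ℤ) ^ (n + 1) ∣ h' - h := by
    obtain ⟨r, hr⟩ := ha (n + 1)
    rw [show h' - h = (r - h) - (r - h') by ring]
    exact two_pow_succ_dvd_sub (Hh.dvd ha hr (Nat.le_succ n)) (Hh'.dvd ha hr (Nat.le_succ n))
      (Hh.not_dvd hr (Nat.lt_succ_self n)) (Hh'.not_dvd hr (Nat.lt_succ_self n))
  have hstep := H.double_step ha Hh.mem_seqE
  obtain ⟨s, hs, hsk⟩ := exists_sum_units (f := fun j => p (2 ^ n * (2 * j) + h)) hstep k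
  have hgm : g * (1 + gi) ^ (n + 1) ≠ 0 := mul_ne_zero hg (pow_ne_zero _ one_add_gi_ne_zero)
  have e : 2 ^ n * (2 * k) + h = h' := by
    rw [← mul_assoc, ← pow_succ, ← hk]; ring
  simp only [e, mul_zero, zero_add] at hs
  rw [hs, show n + 2 = (n + 1) + 1 from rfl, pow_succ _ (n + 1), ← mul_assoc,
    mul_dvd_mul_iff_left hgm, one_add_gi_dvd_iff_of_dvd_sub hsk]
  have := Hh k
  rw [show h + k * 2 ^ (n + 1) = h' by rw [mul_comm, ← hk]; ring] at this
  rw [this]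
  rcases Int.even_or_odd k with hk2 | hk2
  · simp [hk2.neg_one_zpow, hk2.two_dvd]
  · rw [hk2.neg_one_zpow]
    have h1 : ¬ (2 : ℤ) ∣ k := by
      rw [← even_iff_two_dvd]; exact Int.not_even_iff_odd.2 hk2
    simp only [h1, iff_false, neg_mul, one_mul]
    exact fun h => unit_ne_neg _ h.symm

variable {q : ℤ → GaussianInt} {b : ℤ → ℤˣ}

/-- Equal turns propagate the ratio `ε` of the initial steps to all later ones, hence to
displacements. -/
lemma agree (H : FoldPath g p a) (H' : FoldPath g q b) {h h' : ℤ} {ε : GaussianInt}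
    (hε : p (h + 1) - p h = ε * (q (h' + 1) - q h')) (k : ℕ)
    (hk : ∀ j : ℕ, 0 < j → j < k → a (h + j) = b (h' + j)) :
    p (h + k) - p h = ε * (q (h' + k) - q h') := by
  have hdir : ∀ j : ℕ, j < k → p (h + j + 1) - p (h + j) = ε * (q (h' + j + 1) - q (h' + j)) := by
    intro j
    induction j with
    | zero => simpa using fun _ => hε
    | succ j ih =>
      intro hj
      have h1 := ih (by omega)
      have h2 := H.turn (h + (j + 1 : ℕ))
      have h3 := H'.turn (h' + (j + 1 : ℕ))
      rw [hk (j + 1) (by omega) hj] at h2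
      rw [h2, h3]
      push_cast
      rw [show h + (j + 1 : ℤ) - 1 = h + j by ring, show h' + (j + 1 : ℤ) - 1 = h' + j by ring,
        ← add_assoc, ← add_assoc, h1]
      ring
  clear hk
  induction k with
  | zero => simp
  | succ k ih =>
    have h1 := ih fun j hj => hdir j (by omega)
    have h2 := hdir k (by omega)
    push_cast
    rw [← add_assoc, ← add_assoc]
    linear_combination h1 + h2

/-- Two folding paths with locally isomorphic turns, the same lattices and the same type make
the same turns at congruent vertices. -/
lemma eq_iff_dvd_of_locallyIsomorphic (H : FoldPath g p a) (H' : FoldPath g q b) (hg : g ≠ 0)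
    (ha : IsAlt a) (hb : IsAlt b) (hab : SeqLocallyIsomorphic a b)
    (hE : ∀ n, ∀ i ∈ seqE a n, ∀ j ∈ seqE b n, g * (1 + gi) ^ n ∣ p i - q j)
    (hdir : ∀ i ∈ seqE a 1, ∀ j ∈ seqE b 1, p (i + 1) - p i = q (j + 1) - q j ∨
      p (i + 1) - p i = -(q (j + 1) - q j))
    {n : ℕ} {h h' : ℤ} (Hh : AltAt a n h) (Hh' : AltAt b n h') :
    a h = b h' ↔ g * (1 + gi) ^ (n + 2) ∣ p h - q h' := by
  -- Reference vertices: `s` in `E_(n+2)`, then `r` of level `n + 1`, then `r + 2 ^ n` of level `n`.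
  -- Local isomorphism forces equal turns just after `r` and `r'`, in particular at the level `n`
  -- reference vertices.
  obtain ⟨s, hs⟩ := seqE_nonempty ha (n + 2)
  obtain ⟨s', hs'⟩ := seqE_nonempty hb (n + 2)
  have hr := altAt_add_pow ha hs
  have hr' := altAt_add_pow hb hs'
  set r := s + 2 ^ (n + 1) with hrs
  set r' := s' + 2 ^ (n + 1) with hrs'
  have hr1 := hr.mem_seqE
  have hr1' := hr'.mem_seqE
  have K := altAt_add_pow ha hr1
  have K' := altAt_add_pow hb hr1'
  have hcast : ((2 ^ n : ℕ) : ℤ) = 2 ^ n := by push_cast; rfl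
  have hlt : 2 ^ n < 2 ^ (n + 1) := Nat.pow_lt_pow_right (by norm_num) (by omega)
  have e1 : a (r + 2 ^ n) = b (r' + 2 ^ n) := by
    have := eq_of_seqLocallyIsomorphic ha hb hab hr hr' (j := 2 ^ n) (by positivity) hlt
    rwa [hcast] at this
  have hunits : ∀ {u v : GaussianInt}, IsUnit u → IsUnit v →
      g * (1 + gi) ^ (n + 2) ∣ g * (1 + gi) ^ (n + 1) * u - g * (1 + gi) ^ (n + 1) * v := by
    intro u v hu hv
    have := dvd_sub (one_add_gi_dvd_unit_sub_one hu) (one_add_gi_dvd_unit_sub_one hv)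
    rw [sub_sub_sub_cancel_right] at this
    rw [← mul_sub, show n + 2 = n + 1 + 1 from rfl, pow_succ _ (n + 1), ← mul_assoc]
    exact mul_dvd_mul_left _ this
  -- The vertices at `s` and `s'` are congruent by `hE`, and both displacements to `r`, `r'` are `g
  -- * (1 + gi) ^ (n + 1)` times a unit.
  have hbase : g * (1 + gi) ^ (n + 2) ∣ p r - q r' := by
    obtain ⟨u, hu, e⟩ := (H.iterate ha (seqE_antitone ha (Nat.le_succ (n + 1)) hs)).step 0
    obtain ⟨v, hv, e'⟩ := (H'.iterate hb (seqE_antitone hb (Nat.le_succ (n + 1)) hs')).step 0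
    rw [zero_add, mul_one, mul_zero, zero_add, add_comm, ← hrs] at e
    rw [zero_add, mul_one, mul_zero, zero_add, add_comm, ← hrs'] at e'
    have e2 : p r - q r' = (p s - q s') + ((p r - p s) - (q r' - q s')) := by ring
    rw [e2, e, e']
    exact dvd_add (hE _ _ hs _ hs') (hunits hu hv)
  have hK : g * (1 + gi) ^ (n + 2) ∣ p (r + 2 ^ n) - q (r' + 2 ^ n) := by
    have hag : ∀ ε : GaussianInt, p (r + 1) - p r = ε * (q (r' + 1) - q r') →
        p (r + 2 ^ n) - p r = ε * (q (r' + 2 ^ n) - q r') := by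
      intro ε hε
      have := H.agree H' hε (2 ^ n) fun j h0 hj =>
        eq_of_seqLocallyIsomorphic ha hb hab hr hr' h0 (hj.trans hlt)
      rwa [hcast] at this
    obtain ⟨u, hu, e⟩ := (H'.iterate hb (seqE_antitone hb (Nat.le_succ n) hr1')).step 0
    rw [zero_add, mul_one, mul_zero, zero_add, add_comm] at e
    -- Equality of types makes the initial steps equal or opposite. In the opposite case the
    -- displacements differ by twice a multiple of `(1 + gi) ^ n`, and `2` is associated to `(1 +
    -- gi) ^ 2`, so the congruence survives.
    rcases hdir r (seqE_antitone ha (by omega : 1 ≤ n + 1) hr1) r'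
      (seqE_antitone hb (by omega : 1 ≤ n + 1) hr1') with h1 | h1
    · have h2 := hag 1 (by rw [h1, one_mul])
      rw [show p (r + 2 ^ n) - q (r' + 2 ^ n) = p r - q r' by linear_combination h2]
      exact hbase
    · have h2 := hag (-1) (by rw [h1, neg_one_mul])
      rw [show p (r + 2 ^ n) - q (r' + 2 ^ n) =
        (p r - q r') - g * (1 + gi) ^ n * (2 * u) by linear_combination h2 - 2 * e]
      refine dvd_sub hbase ?_
      rw [pow_add, ← mul_assoc]
      exact mul_dvd_mul_left _ (two_dvd_one_add_gi_sq u)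
  -- One congruent pair of level `n` vertices with the common turn `a h` suffices, by the criterion
  -- inside each path. If the reference pair has the other turn, both vertices are moved by one
  -- period `2 ^ (n + 1)`.
  have main : ∀ k k' : ℤ, AltAt a n k → AltAt b n k' → a k = b k' → a k = a h →
      g * (1 + gi) ^ (n + 2) ∣ p k - q k' →
      (a h = b h' ↔ g * (1 + gi) ^ (n + 2) ∣ p h - q h') := by
    intro k k' hk hk' h1 h2 h3
    rw [← h2, h1, eq_comm, H'.eq_iff_dvd hg hb hk' Hh']
    have h4 := (H.eq_iff_dvd hg ha Hh hk).1 h2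
    rw [← dvd_neg, show p h - q h' = (-(q h' - q k')) + ((p k - q k') - (p k - p h)) by ring]
    exact (dvd_add_left (dvd_sub h3 h4)).symm
  by_cases hah : a (r + 2 ^ n) = a h
  · exact main _ _ K K' e1 hah hK
  · obtain ⟨u, hu, f⟩ := H.double_step ha K.mem_seqE 0
    obtain ⟨v, hv, f'⟩ := H'.double_step hb K'.mem_seqE 0
    have hx : ∀ x : ℤ, 2 ^ n * (2 * (0 + 1)) + x = x + 1 * 2 ^ (n + 1) := fun x => by ring
    have hy : ∀ x : ℤ, 2 ^ n * (2 * 0) + x = x := fun x => by ring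
    rw [hx, hy] at f f'
    refine main _ _ (K.shift 1) (K'.shift 1) ?_ ?_ ?_
    · rw [K, K', e1]
    · rw [K]
      rcases Int.units_eq_one_or (a h) with h1 | h1 <;>
      rcases Int.units_eq_one_or (a (r + 2 ^ n)) with h2 | h2 <;> simp_all
    · rw [show p (r + 2 ^ n + 1 * 2 ^ (n + 1)) - q (r' + 2 ^ n + 1 * 2 ^ (n + 1)) =
        (p (r + 2 ^ n) - q (r' + 2 ^ n)) + (g * (1 + gi) ^ (n + 1) * u - g * (1 + gi) ^ (n + 1) * v)
        by linear_combination f - f']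
      exact dvd_add hK (hunits hu hv)

end FoldPath

/-! ### Vertices of curves as Gaussian integers, derivatives -/

/-- A point of `ℤ²` as a Gaussian integer. -/
def toG (X : ℤ × ℤ) : GaussianInt := ⟨X.1, X.2⟩

@[simp] lemma toG_re (X : ℤ × ℤ) : (toG X).re = X.1 := rfl
@[simp] lemma toG_im (X : ℤ × ℤ) : (toG X).im = X.2 := rfl

lemma toG_sub (X Y : ℤ × ℤ) : toG (X - Y) = toG X - toG Y := by ext <;> simp

lemma toG_add (X Y : ℤ × ℤ) : toG (X + Y) = toG X + toG Y := by ext <;> simp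

lemma toG_injective : Function.Injective toG := by
  intro X Y h
  exact Prod.ext (congrArg Zsqrtd.re h) (congrArg Zsqrtd.im h)

lemma two_pow_dvd_iff (k : ℕ) (z : GaussianInt) :
    2 ^ k ∣ z ↔ ∃ a b : ℤ, z = ⟨2 ^ k * a, 2 ^ k * b⟩ := by
  have e : (2 ^ k : GaussianInt) = ((2 ^ k : ℤ) : GaussianInt) := by push_cast; rfl
  rw [e]
  generalize (2 : ℤ) ^ k = m
  constructor
  · rintro ⟨w, rfl⟩
    exact ⟨w.re, w.im, by ext <;> simp⟩
  · rintro ⟨a, b, rfl⟩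
    exact ⟨⟨a, b⟩, by ext <;> simp⟩

lemma associated_one_add_gi_pow (k : ℕ) : Associated ((1 + gi) ^ (2 * k)) (2 ^ k) := by
  rw [pow_mul, one_add_gi_sq]
  refine Associated.pow_pow ?_
  exact (associated_mul_unit_left _ _ isUnit_gi)

lemma mem_foldLattice_iff (n : ℕ) (v : ℤ × ℤ) : v ∈ foldLattice n ↔ (1 + gi) ^ n ∣ toG v := by
  unfold foldLattice
  rcases Nat.even_or_odd' n with ⟨k, rfl | rfl⟩
  · rw [if_pos (even_two_mul k), (associated_one_add_gi_pow k).dvd_iff_dvd_left, two_pow_dvd_iff,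
      Nat.mul_div_cancel_left _ (by norm_num : 0 < 2)]
    simp [Prod.ext_iff, Zsqrtd.ext_iff]
  · have hodd : ¬ Even (2 * k + 1) := Nat.not_even_iff_odd.2 ⟨k, rfl⟩
    rw [if_neg hodd, pow_succ, show (2 * k + 1) / 2 = k by omega,
      ((associated_one_add_gi_pow k).mul_right (1 + gi)).dvd_iff_dvd_left]
    have e : (2 ^ k : GaussianInt) = ((2 ^ k : ℤ) : GaussianInt) := by push_cast; rfl
    rw [e]
    generalize (2 : ℤ) ^ k = m
    constructor
    · rintro ⟨a, b, rfl⟩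
      refine ⟨⟨a, -b⟩, ?_⟩
      ext <;> simp <;> ring
    · rintro ⟨w, hw⟩
      refine ⟨w.re, -w.im, toG_injective ?_⟩
      rw [hw]
      ext <;> simp <;> ring

lemma turn_eq {P Q R : ℤ × ℤ} {ε : ℤˣ}
    (h : toG R - toG Q = gi * sgn ε * (toG Q - toG P)) (hne : toG Q - toG P ≠ 0) :
    turn P Q R = ε := by
  have h1 := congrArg Zsqrtd.re h
  have h2 := congrArg Zsqrtd.im h
  have hpos : 0 < (Q.1 - P.1) * (Q.1 - P.1) + (Q.2 - P.2) * (Q.2 - P.2) := by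
    rcases eq_or_ne (Q.1 - P.1) 0 with h3 | h3
    · rcases eq_or_ne (Q.2 - P.2) 0 with h4 | h4
      · exact absurd (by ext <;> simp [h3, h4]) hne
      · have := mul_self_pos.2 h4
        nlinarith [mul_self_nonneg (Q.1 - P.1)]
    · have := mul_self_pos.2 h3
      nlinarith [mul_self_nonneg (Q.2 - P.2)]
  unfold turn
  rcases Int.units_eq_one_or ε with rfl | rfl
  · simp at h1 h2
    rw [if_pos]
    rw [h1, h2]
    linarith
  · simp at h1 h2
    rw [if_neg]
    rw [h1, h2]
    linarith

namespace FoldPath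

variable {g : GaussianInt} {p q : ℤ → ℤ × ℤ} {a : ℤ → ℤˣ}

lemma turnSeq_eq (H : FoldPath g (fun i => toG (p i)) a) (hg : g ≠ 0) : turnSeq p = a := by
  funext i
  refine turn_eq (H.turn i) ?_
  obtain ⟨u, hu, e⟩ := H.step (i - 1)
  rw [sub_add_cancel] at e
  rw [e]
  exact mul_ne_zero hg hu.ne_zero

/-- A derivative is unique up to indexation: the vertices left out must alternate, so they have
level exactly `n`, and the vertices kept, at distance `2 ^ n` from them, lie in `E_(n+1)`. -/
lemma exists_of_isNthDerivative (H : FoldPath g (fun i => toG (p i)) a) (hg : g ≠ 0)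
    (ha : IsAlt a) {n : ℕ} (hq : IsNthDerivative n p q) :
    ∃ c ∈ seqE a n, q = fun i => p (2 ^ n * i + c) := by
  induction n generalizing q with
  | zero =>
    obtain rfl : q = p := hq
    exact ⟨0, mem_seqE_zero ha 0, by simp⟩
  | succ n ih =>
    obtain ⟨r, hr, k, hqr, hk⟩ := hq
    obtain ⟨c, hc, rfl⟩ := ih hr
    have hg' : g * (1 + gi) ^ n ≠ 0 := mul_ne_zero hg (pow_ne_zero _ one_add_gi_ne_zero)
    rw [(H.iterate ha hc).turnSeq_eq hg'] at hk
    refine ⟨2 ^ n * k + c, ?_, ?_⟩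
    · have h1 : AltAt a n (2 ^ n * (1 + k) + c) := by
        intro j
        convert hk j using 2
        ring
      have h2 : 2 ^ n * k + c ∈ seqE a n := by
        have := add_mul_pow_mem_seqE ha hc k
        rwa [mul_comm k, add_comm] at this
      by_contra h3
      have h4 := (altAt_iff ha).2 ⟨h2, h3⟩
      obtain ⟨r, hr⟩ := ha (n + 1)
      have h5 := two_pow_succ_dvd_sub (h1.dvd ha hr (Nat.le_succ n)) (h4.dvd ha hr (Nat.le_succ n))
        (h1.not_dvd hr (Nat.lt_succ_self n)) (h4.not_dvd hr (Nat.lt_succ_self n))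
      rw [show r - (2 ^ n * (1 + k) + c) - (r - (2 ^ n * k + c)) = -2 ^ n by ring, dvd_neg,
        pow_succ] at h5
      obtain ⟨t, ht⟩ := h5
      have h6 : (2 : ℤ) ^ n ≠ 0 := by positivity
      rw [mul_assoc] at ht
      have := mul_left_cancel₀ h6 ((mul_one _).trans ht)
      omega
    · funext i
      rw [hqr]
      simp only
      congr 1
      ring

lemma isNthDerivative (H : FoldPath g (fun i => toG (p i)) a) (hg : g ≠ 0) (ha : IsAlt a) (n : ℕ) :
    ∃ c ∈ seqE a n, IsNthDerivative n p fun i => p (2 ^ n * i + c) := by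
  induction n with
  | zero => exact ⟨0, mem_seqE_zero ha 0, by simp [IsNthDerivative]⟩
  | succ n ih =>
    obtain ⟨c, hc, hd⟩ := ih
    obtain ⟨c', hc'⟩ := seqE_nonempty ha (n + 1)
    obtain ⟨k, hk⟩ := (mem_seqE_iff_dvd ha hc).1 (seqE_antitone ha (Nat.le_succ n) hc')
    obtain rfl : c' = 2 ^ n * k + c := by linarith
    have hg' : g * (1 + gi) ^ n ≠ 0 := mul_ne_zero hg (pow_ne_zero _ one_add_gi_ne_zero)
    refine ⟨_, hc', _, hd, k, fun i => ?_, fun i => ?_⟩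
    · simp only
      congr 1
      ring
    · rw [(H.iterate ha hc).turnSeq_eq hg']
      convert (altAt_add_pow ha hc') i using 2 <;> ring_nf

/-- Replaces derivatives by congruences: `E_n(C)` is the coset of `(1 + gi) ^ n` through any vertex
with index in `E_n` of the sequence. -/
lemma mem_curveE_iff {C : ℤ → Segment} (H : FoldPath g (fun i => toG (vertexSeq C i)) a)
    (hg : IsUnit g) (ha : IsAlt a) {n : ℕ} {c : ℤ} (hc : c ∈ seqE a n) {X : ℤ × ℤ} :
    X ∈ curveE C n ↔ (1 + gi) ^ n ∣ toG X - toG (vertexSeq C c) := by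
  have key : ∀ c' ∈ seqE a n, ∀ i : ℤ, (1 + gi) ^ n ∣ toG X - toG (vertexSeq C (2 ^ n * i + c')) ↔
      (1 + gi) ^ n ∣ toG X - toG (vertexSeq C c) := by
    intro c' hc' i
    have h1 : 2 ^ n * i + c' ∈ seqE a n := by
      have := add_mul_pow_mem_seqE ha hc' i
      rwa [mul_comm i, add_comm] at this
    have h2 := (H.dvd_sub_iff hg.ne_zero ha hc).2 h1
    rw [hg.mul_left_dvd] at h2
    rw [← sub_add_sub_cancel (toG X) (toG (vertexSeq C (2 ^ n * i + c'))) (toG (vertexSeq C c))]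
    exact (dvd_add_left h2).symm
  constructor
  · rintro ⟨q, hq, i, hi⟩
    obtain ⟨c', hc', rfl⟩ := H.exists_of_isNthDerivative hg.ne_zero ha hq
    rw [mem_foldLattice_iff, toG_sub] at hi
    exact (key c' hc' i).1 hi
  · intro h
    obtain ⟨c', hc', hd⟩ := H.isNthDerivative hg.ne_zero ha n
    refine ⟨_, hd, 0, ?_⟩
    rw [mem_foldLattice_iff, toG_sub]
    exact (key c' hc' 0).2 h

end FoldPath

/-! ### Folding paths cover large squares -/

/-- The unoriented edge between `z` and `w` belongs to the path `p`. -/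
def PathEdge (p : ℤ → GaussianInt) (z w : GaussianInt) : Prop :=
  ∃ i, (p i = z ∧ p (i + 1) = w) ∨ (p i = w ∧ p (i + 1) = z)

/-- The four edges at `z` belong to the path `p`, whose steps have the form `g * u`. -/
def FullAt (g : GaussianInt) (p : ℤ → GaussianInt) (z : GaussianInt) : Prop :=
  ∀ u, IsUnit u → PathEdge p z (z + g * u)

lemma PathEdge.symm {p : ℤ → GaussianInt} {z w : GaussianInt} (h : PathEdge p z w) :
    PathEdge p w z := by
  obtain ⟨i, hi⟩ := h
  exact ⟨i, hi.symm⟩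

lemma PathEdge.of_shift {p : ℤ → GaussianInt} {c : ℤ} {z w : GaussianInt}
    (h : PathEdge (fun i => p (i + c)) z w) : PathEdge p z w := by
  obtain ⟨i, hi⟩ := h
  refine ⟨i + c, ?_⟩
  rwa [show i + c + 1 = i + 1 + c by ring]

lemma FullAt.of_shift {g : GaussianInt} {p : ℤ → GaussianInt} {c : ℤ} {z : GaussianInt}
    (h : FullAt g (fun i => p (i + c)) z) : FullAt g p z := fun u hu => (h u hu).of_shift

lemma FullAt.exists_index {g : GaussianInt} {p : ℤ → GaussianInt} {z : GaussianInt}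
    (h : FullAt g p z) : ∃ i, p i = z := by
  obtain ⟨i, ⟨h1, -⟩ | ⟨-, h1⟩⟩ := h 1 isUnit_one
  exacts [⟨i, h1⟩, ⟨i + 1, h1⟩]

lemma FullAt.of_eq {g : GaussianInt} {p : ℤ → GaussianInt} {z w : GaussianInt}
    (h : FullAt g p z) (e : w = z) : FullAt g p w := e ▸ h

lemma fullAt_of_mem {g z v : GaussianInt} {p : ℤ → GaussianInt} (hv : ∃ u, IsUnit u ∧ v = g * u)
    (h1 : PathEdge p z (z + v)) (h2 : PathEdge p z (z - v)) (h3 : PathEdge p z (z + gi * v))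
    (h4 : PathEdge p z (z - gi * v)) : FullAt g p z := by
  obtain ⟨w, hw, rfl⟩ := hv
  intro u hu
  obtain ⟨r, hr⟩ := hw
  have e : g * u = g * w * (u * ↑r⁻¹) := by
    rw [← hr, mul_assoc, mul_comm u, ← mul_assoc (r : GaussianInt), Units.mul_inv, one_mul]
  rw [e]
  rcases isUnit_cases (hu.mul (r⁻¹).isUnit) with h | h | h | h <;> rw [h]
  · simpa using h1
  · simpa [sub_eq_add_neg] using h2
  · rw [mul_comm (g * w)]; exact h3
  · rw [mul_neg, mul_comm (g * w), ← sub_eq_add_neg]; exact h4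

lemma sgn_cases (a : ℤˣ) : sgn a = 1 ∨ sgn a = -1 := by
  rcases Int.units_eq_one_or a with rfl | rfl <;> simp

namespace FoldPath

variable {g : GaussianInt} {p : ℤ → GaussianInt} {a : ℤ → ℤˣ}

lemma even_step (H : FoldPath g p a) (i : ℤ) :
    p (2 * i + 1) - p (2 * i) = p 1 - p 0 ∨ p (2 * i + 1) - p (2 * i) = -(p 1 - p 0) := by
  have key : ∀ i : ℤ, p (2 * (i + 1) + 1) - p (2 * (i + 1)) = p (2 * i + 1) - p (2 * i) ∨
      p (2 * (i + 1) + 1) - p (2 * (i + 1)) = -(p (2 * i + 1) - p (2 * i)) := by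
    intro i
    have h1 := H.turn (2 * i + 1)
    have h2 := H.turn (2 * i + 1 + 1)
    rw [add_sub_cancel_right] at h1 h2
    rw [h1] at h2
    rw [show 2 * (i + 1) = 2 * i + 1 + 1 by ring, h2]
    rcases sgn_cases (a (2 * i + 1)) with h3 | h3 <;>
    rcases sgn_cases (a (2 * i + 1 + 1)) with h4 | h4 <;> rw [h3, h4]
    · right; linear_combination (p (2 * i + 1) - p (2 * i)) * gi_sq
    · left; linear_combination -(p (2 * i + 1) - p (2 * i)) * gi_sq
    · left; linear_combination -(p (2 * i + 1) - p (2 * i)) * gi_sq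
    · right; linear_combination (p (2 * i + 1) - p (2 * i)) * gi_sq
  induction i using Int.induction_on with
  | zero => simp
  | succ i ih =>
    rcases ih with h | h <;> rcases key i with h' | h' <;> rw [h', h] <;> simp
  | pred i ih =>
    have h' := key (-i - 1)
    rw [sub_add_cancel] at h'
    rcases ih with h | h <;> rcases h' with h' | h' <;> rw [h] at h'
    · left; rw [h']
    · right; rw [h', neg_neg]
    · right; rw [h']
    · left; exact (neg_injective h').symm

/-- The congruence means that `j - k` is even, by parity in the derived path, and the odd turns have
period `4`. Thus this turn depends only on the position of the even vertex. -/
lemma odd_turn_eq (H : FoldPath g p a) (ha : ∀ i, a (2 * i + 1) = -a (2 * i - 1))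
    (hg : g ≠ 0) {j k : ℤ} (hjk : g * (1 + gi) ^ 2 ∣ p (2 * j) - p (2 * k)) :
    a (2 * j + 1) = a (2 * k + 1) := by
  have Hj := (H.shift (2 * k)).derive fun i => by
    have := ha (i + k)
    convert this using 2
    · ring
    · congr 1; ring
  obtain ⟨s, hs, hsk⟩ := exists_sum_units (f := fun i => p (2 * i + 2 * k)) Hj.step (j - k)
  simp only [mul_zero, zero_add, show 2 * (j - k) + 2 * k = 2 * j by ring] at hs
  rw [hs, sq, ← mul_assoc, mul_dvd_mul_iff_left (mul_ne_zero hg one_add_gi_ne_zero)] at hjk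
  obtain ⟨t, ht⟩ := (one_add_gi_dvd_iff_of_dvd_sub hsk).1 hjk
  obtain rfl : j = k + 2 * t := by linarith
  clear hsk hs hjk Hj ht
  induction t using Int.induction_on with
  | zero => simp
  | succ i ih =>
    rw [← ih]
    have h1 := ha (k + 2 * i + 2)
    have h2 := ha (k + 2 * i + 1)
    rw [show 2 * (k + 2 * (i + 1 : ℤ)) + 1 = 2 * (k + 2 * i + 2) + 1 by ring, h1,
      show 2 * (k + 2 * (i : ℤ) + 2) - 1 = 2 * (k + 2 * i + 1) + 1 by ring, h2, neg_neg]
    congr 1; ring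
  | pred i ih =>
    rw [← ih]
    have h1 := ha (k + 2 * -i)
    have h2 := ha (k + 2 * -i - 1)
    rw [show 2 * (k + 2 * -(i : ℤ) - 1) + 1 = 2 * (k + 2 * -i) - 1 by ring] at h2
    rw [h1, h2, neg_neg]
    congr 1; ring

/-- The edges at a vertex of the derivative are, according to their directions, outgoing or
incoming; in both cases we know the corresponding edges of the path. -/
lemma edge_cases (H : FoldPath g p a) (ha : ∀ i, a (2 * i + 1) = -a (2 * i - 1)) {i₀ : ℤ}
    (hg : g ≠ 0) {z' : GaussianInt} (hz : PathEdge (fun i => p (2 * i)) (p (2 * i₀)) z') :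
    ∃ v, (v = p 1 - p 0 ∨ v = -(p 1 - p 0)) ∧
      ((z' = p (2 * i₀) + v * (1 + gi * sgn (a (2 * i₀ + 1))) ∧
        PathEdge p (p (2 * i₀)) (p (2 * i₀) + v) ∧ PathEdge p (p (2 * i₀) + v) z') ∨
      (z' = p (2 * i₀) - v * (1 - gi * sgn (a (2 * i₀ + 1))) ∧
        PathEdge p (p (2 * i₀)) (p (2 * i₀) + gi * sgn (a (2 * i₀ + 1)) * v) ∧
        PathEdge p (p (2 * i₀) + gi * sgn (a (2 * i₀ + 1)) * v) z')) := by
  have hper : ∀ j k : ℤ, p (2 * j) = p (2 * k) → a (2 * j + 1) = a (2 * k + 1) :=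
    fun j k hjk => H.odd_turn_eq ha hg (by rw [hjk, sub_self]; exact dvd_zero _)
  obtain ⟨i, ⟨h1, h2⟩ | ⟨h1, h2⟩⟩ := hz
  · simp only at h1 h2
    have h3 := hper _ _ h1
    have h4 := H.two_step (2 * i)
    rw [show 2 * i + 2 = 2 * (i + 1) by ring, h1, h2, h3] at h4
    refine ⟨p (2 * i + 1) - p (2 * i), H.even_step i, Or.inl ⟨?_, ⟨2 * i, Or.inl ⟨h1, ?_⟩⟩,
      ⟨2 * i + 1, Or.inl ⟨?_, ?_⟩⟩⟩⟩
    · rw [h1]; linear_combination h4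
    · rw [h1]; ring
    · rw [h1]; ring
    · rw [← h2]; congr 1; ring
  · simp only at h1 h2
    have h3 := hper _ _ h2
    have h4 := H.two_step (2 * i)
    have h5 := ha (i + 1)
    rw [show 2 * (i + 1) - 1 = 2 * i + 1 by ring, h3] at h5
    rw [show 2 * i + 2 = 2 * (i + 1) by ring, h1, h2] at h4
    rw [← neg_eq_iff_eq_neg] at h5
    rw [← h5, sgn_neg] at h4
    have h6 : p (2 * i + 1) = p (2 * i₀) + gi * sgn (a (2 * i₀ + 1)) *
        (p (2 * i + 1) - p (2 * i)) := by
      rw [h1]; linear_combination -h4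
    refine ⟨p (2 * i + 1) - p (2 * i), H.even_step i, Or.inr ⟨?_, ⟨2 * i + 1, Or.inr ⟨h6, ?_⟩⟩,
      ⟨2 * i, Or.inr ⟨h1, h6⟩⟩⟩⟩
    · rw [h1]; linear_combination -h4
    · rw [← h2]; congr 1; ring

/-- The edges at a vertex which is full in the derivative. -/
lemma fullAt_edges (H : FoldPath g p a) (ha : ∀ i, a (2 * i + 1) = -a (2 * i - 1)) {i₀ : ℤ}
    (hg : g ≠ 0) (hz : FullAt (g * (1 + gi)) (fun i => p (2 * i)) (p (2 * i₀)))
    {v : GaussianInt} (hv : v = p 1 - p 0 ∨ v = -(p 1 - p 0)) :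
    (PathEdge p (p (2 * i₀)) (p (2 * i₀) + v) ∧ PathEdge p (p (2 * i₀) + v)
      (p (2 * i₀) + v + gi * sgn (a (2 * i₀ + 1)) * v)) ∧
    (PathEdge p (p (2 * i₀)) (p (2 * i₀) + gi * sgn (a (2 * i₀ + 1)) * v) ∧
      PathEdge p (p (2 * i₀) + gi * sgn (a (2 * i₀ + 1)) * v)
        (p (2 * i₀) + gi * sgn (a (2 * i₀ + 1)) * v - v)) := by
  have hv' : ∃ u, IsUnit u ∧ v = g * u := by
    obtain ⟨u, hu, e⟩ := H.step_zero
    rcases hv with rfl | rfl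
    · exact ⟨u, hu, e⟩
    · exact ⟨-u, hu.neg, by rw [e]; ring⟩
  obtain ⟨u, hu, hvu⟩ := hv'
  have hv0 : v ≠ 0 := by rw [hvu]; exact mul_ne_zero hg hu.ne_zero
  set ε := a (2 * i₀ + 1) with hε
  have hvv : ∀ w, (w = p 1 - p 0 ∨ w = -(p 1 - p 0)) → w = v ∨ w = -v := by
    intro w hw
    rcases hv with rfl | rfl <;> rcases hw with rfl | rfl <;> simp
  -- Outgoing and incoming derived edges at the vertex point in different directions, so fullness in
  -- the derivative provides both outgoing edges and both incoming ones.
  have hne : ∀ w, (w = v ∨ w = -v) → v * (1 + gi * sgn ε) ≠ -(w * (1 - gi * sgn ε)) := by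
    intro w hw h
    have hs := sgn_mul_self ε
    rcases hw with rfl | rfl
    · have : w * 2 = 0 := by linear_combination h
      simp [hv0] at this
    · have h1 : v * (gi * sgn ε * 2) = 0 := by linear_combination h
      simp [hv0, isUnit_gi.ne_zero, (isUnit_sgn ε).ne_zero] at h1
  constructor
  · obtain ⟨r, hr, e⟩ := one_add_gi_mul_sgn ε
    have h := H.edge_cases ha hg (hz (u * r) (hu.mul hr))
    obtain ⟨w, hw, ⟨h1, h2, h3⟩ | ⟨h1, h2, h3⟩⟩ := h
    · have h4 : w = v := by
        have hne0 : (1 + gi * sgn ε) ≠ 0 := by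
          rw [e]; exact mul_ne_zero one_add_gi_ne_zero hr.ne_zero
        refine mul_right_cancel₀ hne0 ?_
        rw [hvu]
        linear_combination -h1 - g * u * e
      subst h4
      refine ⟨h2, ?_⟩
      rw [h1] at h3
      convert h3 using 1
      ring
    · exfalso
      refine hne w (hvv w hw) ?_
      rw [hvu]
      linear_combination h1 + g * u * e
  · obtain ⟨r, hr, e⟩ := one_add_gi_mul_sgn (-ε)
    rw [sgn_neg] at e
    have h := H.edge_cases ha hg (hz (-(u * r)) (hu.mul hr).neg)
    obtain ⟨w, hw, ⟨h1, h2, h3⟩ | ⟨h1, h2, h3⟩⟩ := h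
    · exfalso
      have hw' := hvv w hw
      have : w * (1 + gi * sgn ε) = -(v * (1 - gi * sgn ε)) := by
        rw [hvu]
        linear_combination -h1 + g * u * e
      rcases hw' with rfl | rfl
      · exact hne w (Or.inl rfl) this
      · exact hne (-v) (Or.inr rfl) (by linear_combination -this)
    · have h4 : w = v := by
        have hne0 : (1 + gi * -sgn ε) ≠ 0 := by
          rw [e]; exact mul_ne_zero one_add_gi_ne_zero hr.ne_zero
        refine mul_right_cancel₀ hne0 ?_
        rw [hvu]
        linear_combination h1 - g * u * e
      subst h4
      refine ⟨h2, ?_⟩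
      rw [h1] at h3
      convert h3 using 1
      ring

/-- The two outgoing derived edges begin along `v` and `-v`, the two incoming ones end along `i v`
and `-i v`: all four directions occur. -/
lemma fullAt_of_derive (H : FoldPath g p a) (ha : ∀ i, a (2 * i + 1) = -a (2 * i - 1))
    (hg : g ≠ 0) {z : GaussianInt} (hz : FullAt (g * (1 + gi)) (fun i => p (2 * i)) z) :
    FullAt g p z := by
  obtain ⟨i, rfl⟩ := hz.exists_index
  have hv : ∃ u, IsUnit u ∧ p 1 - p 0 = g * u := H.step_zero
  obtain ⟨⟨h1, -⟩, h2, -⟩ := H.fullAt_edges ha hg hz (Or.inl rfl)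
  obtain ⟨⟨h3, -⟩, h4, -⟩ := H.fullAt_edges ha hg hz (Or.inr rfl)
  refine fullAt_of_mem hv h1 (by rwa [sub_eq_add_neg]) ?_ ?_ <;>
  rcases sgn_cases (a (2 * i + 1)) with h | h <;> rw [h] at h2 h4
  · convert h2 using 1; ring
  · convert h4 using 1; ring
  · convert h4 using 1; ring
  · convert h2 using 1; ring

/-- The two full vertices are opposite corners of a square of the derivative. The turn `ε` is the
same at both, so the derived edges at each bend through the centre of that square and together use
its four edges. -/
lemma fullAt_midpoint (H : FoldPath g p a) (ha : ∀ i, a (2 * i + 1) = -a (2 * i - 1))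
    (hg : g ≠ 0) {z u : GaussianInt} (hu : IsUnit u)
    (hz : FullAt (g * (1 + gi)) (fun i => p (2 * i)) z)
    (hz' : FullAt (g * (1 + gi)) (fun i => p (2 * i)) (z + 2 * (g * u))) :
    FullAt g p (z + g * u) := by
  obtain ⟨i, rfl⟩ := hz.exists_index
  obtain ⟨j, hj⟩ := hz'.exists_index
  rw [← hj] at hz'
  have hε : a (2 * j + 1) = a (2 * i + 1) := H.odd_turn_eq ha hg (by
    rw [hj, add_sub_cancel_left, mul_left_comm]
    exact mul_dvd_mul_left _ (two_dvd_one_add_gi_sq u))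
  obtain ⟨r, hr, hgr⟩ := H.step_zero
  set ε := a (2 * i + 1) with hεi
  have hcases : ∃ v, (v = p 1 - p 0 ∨ v = -(p 1 - p 0)) ∧ (g * u = v ∨ g * u = gi * sgn ε * v) := by
    obtain ⟨s, hs⟩ := hr
    have e : g * u = (p 1 - p 0) * (u * ↑s⁻¹) := by
      rw [hgr, ← hs, mul_assoc, mul_comm u, ← mul_assoc (s : GaussianInt), Units.mul_inv, one_mul]
    rcases isUnit_cases (hu.mul (s⁻¹).isUnit) with h | h | h | h <;> rw [h] at e
    · exact ⟨_, Or.inl rfl, Or.inl (by rw [e]; ring)⟩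
    · exact ⟨_, Or.inr rfl, Or.inl (by rw [e]; ring)⟩
    · rcases sgn_cases ε with h' | h'
      · exact ⟨_, Or.inl rfl, Or.inr (by rw [e, h']; ring)⟩
      · exact ⟨_, Or.inr rfl, Or.inr (by rw [e, h']; ring)⟩
    · rcases sgn_cases ε with h' | h'
      · exact ⟨_, Or.inr rfl, Or.inr (by rw [e, h']; ring)⟩
      · exact ⟨_, Or.inl rfl, Or.inr (by rw [e, h']; ring)⟩
  obtain ⟨v, hv, hv'⟩ := hcases
  have hnv : -v = p 1 - p 0 ∨ -v = -(p 1 - p 0) := by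
    rcases hv with rfl | rfl <;> simp
  have hvu : ∃ u, IsUnit u ∧ v = g * u := by
    rcases hv with rfl | rfl
    · exact ⟨r, hr, hgr⟩
    · exact ⟨-r, hr.neg, by rw [hgr]; ring⟩
  obtain ⟨⟨h1, h2⟩, h3, h4⟩ := H.fullAt_edges ha hg hz hv
  obtain ⟨⟨h1', h2'⟩, h3', h4'⟩ := H.fullAt_edges ha hg hz' hnv
  rw [hj] at h1' h2' h3' h4'
  rw [hε] at h2' h3' h4'
  rw [← hεi] at h2 h3 h4
  have hfin : ∀ M : GaussianInt, PathEdge p M (M + v) → PathEdge p M (M - v) →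
      PathEdge p M (M + gi * sgn ε * v) → PathEdge p M (M - gi * sgn ε * v) → FullAt g p M := by
    intro M k1 k2 k3 k4
    rcases sgn_cases ε with h | h <;> rw [h] at k3 k4
    · rw [mul_one] at k3 k4
      exact fullAt_of_mem hvu k1 k2 k3 k4
    · refine fullAt_of_mem hvu k1 k2 ?_ ?_
      · convert k4 using 1; ring
      · convert k3 using 1; ring
  rcases hv' with h | h <;> simp only [h] at h1' h2' h3' h4' ⊢
  · refine hfin _ ?_ ?_ h2 ?_
    · convert h1'.symm using 1 <;> ring
    · convert h1.symm using 1; ring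
    · convert h2' using 1 <;> ring
  · refine hfin _ ?_ h4 ?_ ?_
    · convert h4' using 1 <;> ring
    · convert h3'.symm using 1 <;> ring
    · convert h3.symm using 1; ring

lemma alternate_of_mem_seqE (ha : IsAlt a) {c : ℤ} (hc : c ∈ seqE a 1) (i : ℤ) :
    a (2 * i + 1 + c) = -a (2 * i - 1 + c) := by
  have h1 := add_mul_pow_mem_seqE ha hc (i - 1)
  have := (altAt_add_pow ha h1).add_pow
  convert this using 2
  · ring
  · congr 1; ring

end FoldPath

lemma IsAlt.derive {a : ℤ → ℤˣ} (ha : IsAlt a) {c : ℤ} (hc : c ∈ seqE a 1) :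
    IsAlt fun i => a (2 * i + c) := by
  intro n
  obtain ⟨h, hh⟩ := ha (n + 1)
  obtain ⟨k, hk⟩ := (mem_seqE_iff_dvd ha hc).1 (seqE_antitone ha (by omega : 1 ≤ n + 1) hh.mem_seqE)
  refine ⟨k, fun j => ?_⟩
  have := hh j
  rw [show h = 2 * k + c by linarith] at this
  simp only
  rw [← this]
  congr 1
  ring

namespace FoldPath

variable {g : GaussianInt} {p : ℤ → GaussianInt} {a : ℤ → ℤˣ}

lemma derive_of_mem (H : FoldPath g p a) (ha : IsAlt a) {c : ℤ} (hc : c ∈ seqE a 1) :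
    FoldPath (g * (1 + gi)) (fun i => p (2 * i + c)) (fun i => a (2 * i + c)) := by
  simpa only [pow_one] using H.iterate ha hc

lemma fullAt_of_derive_of_mem (H : FoldPath g p a) (ha : IsAlt a) (hg : g ≠ 0) {c : ℤ}
    (hc : c ∈ seqE a 1) {z : GaussianInt}
    (hz : FullAt (g * (1 + gi)) (fun i => p (2 * i + c)) z) : FullAt g p z :=
  ((H.shift c).fullAt_of_derive (alternate_of_mem_seqE ha hc) hg hz).of_shift

lemma fullAt_midpoint_of_mem (H : FoldPath g p a) (ha : IsAlt a) (hg : g ≠ 0) {c : ℤ}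
    (hc : c ∈ seqE a 1) {z u : GaussianInt} (hu : IsUnit u)
    (hz : FullAt (g * (1 + gi)) (fun i => p (2 * i + c)) z)
    (hz' : FullAt (g * (1 + gi)) (fun i => p (2 * i + c)) (z + 2 * (g * u))) :
    FullAt g p (z + g * u) :=
  ((H.shift c).fullAt_midpoint (alternate_of_mem_seqE ha hc) hg hu hz hz').of_shift

end FoldPath

/-- The vertices of the `n × n` square with a vertex `P` and edges of directions `v`, `i v` are
full. -/
def FullSquare (g : GaussianInt) (p : ℤ → GaussianInt) (n : ℕ) : Prop :=
  ∃ P u, IsUnit u ∧ ∀ x y : ℕ, x ≤ n → y ≤ n → FullAt g p (P + g * u * (x + y * gi))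

/-- A step of the second derivative has length twice that of `g`. Points with two even coordinates
are its vertices; points with two odd coordinates are centres of its squares, full in the first
derivative; the remaining points are midpoints between two vertices full in the first derivative. -/
lemma FullSquare.double {g : GaussianInt} {p : ℤ → GaussianInt} {a : ℤ → ℤˣ}
    (H : FoldPath g p a) (ha : IsAlt a) (hg : g ≠ 0) {c d : ℤ} (hc : c ∈ seqE a 1)
    (hd : d ∈ seqE (fun i => a (2 * i + c)) 1) {n : ℕ}
    (h : FullSquare (g * (1 + gi) * (1 + gi)) (fun i => p (2 * (2 * i + d) + c)) n) :
    FullSquare g p (2 * n) := by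
  obtain ⟨P, u, hu, hfull⟩ := h
  have H1 := H.derive_of_mem ha hc
  have ha1 := ha.derive hc
  have hg1 : g * (1 + gi) ≠ 0 := mul_ne_zero hg one_add_gi_ne_zero
  have hq : ∀ x y : ℕ, x ≤ n → y ≤ n → FullAt (g * (1 + gi)) (fun i => p (2 * i + c))
      (P + g * (1 + gi) * (1 + gi) * u * (x + y * gi)) := fun x y hx hy =>
    H1.fullAt_of_derive_of_mem ha1 hg1 hd (hfull x y hx hy)
  have hi := isUnit_gi
  refine ⟨P, gi * u, hi.mul hu, fun x y hx hy => ?_⟩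
  rcases Nat.even_or_odd' x with ⟨x, rfl | rfl⟩ <;> rcases Nat.even_or_odd' y with ⟨y, rfl | rfl⟩
  · refine (H.fullAt_of_derive_of_mem ha hg hc (hq x y (by omega) (by omega))).of_eq ?_
    push_cast
    linear_combination (-g * u * (x + y * gi)) * gi_sq
  · refine (H.fullAt_midpoint_of_mem ha hg hc (hi.mul (hi.mul hu))
      (hq x y (by omega) (by omega))
      ((hq x (y + 1) (by omega) (by omega)).of_eq ?_)).of_eq ?_ <;> push_cast
    · linear_combination (-g * u * gi) * gi_sq
    · linear_combination (-g * u * (x + y * gi)) * gi_sq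
  · refine (H.fullAt_midpoint_of_mem ha hg hc (hi.mul hu) (hq x y (by omega) (by omega))
      ((hq (x + 1) y (by omega) (by omega)).of_eq ?_)).of_eq ?_ <;> push_cast
    · linear_combination (-g * u) * gi_sq
    · linear_combination (-g * u * (x + y * gi)) * gi_sq
  · refine (H.fullAt_of_derive_of_mem ha hg hc (H1.fullAt_midpoint_of_mem ha1 hg1 hd (hi.mul hu)
      (hfull x y (by omega) (by omega))
      ((hfull (x + 1) (y + 1) (by omega) (by omega)).of_eq ?_))).of_eq ?_ <;> push_cast
    · linear_combination (-g * u * (1 + gi)) * gi_sq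
    · linear_combination (-g * u * (x + y * gi)) * gi_sq

/-! ### Any folding path contains three full vertices of a unit square -/

/-- `(s, w₁, -s, w₂, s, …)`. -/
def interleave : Bool → List Bool → List Bool
  | s, [] => [s]
  | s, w :: ws => s :: w :: interleave (!s) ws

/-- The finite folding words with given signs at the successive levels. -/
def foldingWord : List Bool → List Bool
  | [] => []
  | s :: ss => interleave s (foldingWord ss)

/-- The steps (initial vertex and direction) of the path which starts from `(x, y)` in the
direction `(dx, dy)` with given turns. -/
def pathSteps : List Bool → ℤ → ℤ → ℤ → ℤ → List (ℤ × ℤ × ℤ × ℤ)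
  | [], x, y, dx, dy => [(x, y, dx, dy)]
  | t :: ts, x, y, dx, dy => (x, y, dx, dy) ::
      pathSteps ts (x + dx) (y + dy) (bif t then -dy else dy) (bif t then dx else -dx)

/-- One of the given steps joins `(x, y)` and `(x + dx, y + dy)`. -/
def hasEdge (l : List (ℤ × ℤ × ℤ × ℤ)) (x y dx dy : ℤ) : Bool :=
  l.any fun e => e == (x, y, dx, dy) || e == (x + dx, y + dy, -dx, -dy)

/-- The four edges at `(x, y)` are among the given steps. -/
def isFull (l : List (ℤ × ℤ × ℤ × ℤ)) (x y : ℤ) : Bool :=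
  hasEdge l x y 1 0 && hasEdge l x y (-1) 0 && hasEdge l x y 0 1 && hasEdge l x y 0 (-1)

/-- Three vertices of some unit square are full. The indices are those of vertices which are
sufficient for the folding words of length `63`. -/
def hasFullCorner (l : List (ℤ × ℤ × ℤ × ℤ)) : Bool :=
  [18, 36, 44, 5, 14].any fun j =>
    let e := l.getD j (0, 0, 0, 0)
    isFull l e.1 e.2.1 && isFull l (e.1 + 1) e.2.1 &&
      (isFull l e.1 (e.2.1 + 1) || isFull l e.1 (e.2.1 - 1))

/-- Exhaustive check of the 64 folding words with 63 turns, which seeds the growth of full squares.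
-/
lemma hasFullCorner_foldingWord : ∀ s₀ s₁ s₂ s₃ s₄ s₅ : Bool,
    hasFullCorner (pathSteps (foldingWord [s₀, s₁, s₂, s₃, s₄, s₅]) 0 0 1 0) = true := by
  decide +kernel

/-- The sign of a turn to the left (`true`) or to the right (`false`). -/
def turnSign (t : Bool) : ℤˣ := bif t then 1 else -1

lemma exists_turnSign (a : ℤˣ) : ∃ t, a = turnSign t := by
  rcases Int.units_eq_one_or a with rfl | rfl
  exacts [⟨true, rfl⟩, ⟨false, rfl⟩]

lemma turnSign_not (t : Bool) : turnSign (!t) = -turnSign t := by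
  cases t <;> simp [turnSign]

/-- The word `w` occurs in `a` just after `i`. -/
def ReadsAt (a : ℤ → ℤˣ) : ℤ → List Bool → Prop
  | _, [] => True
  | i, t :: ts => a (i + 1) = turnSign t ∧ ReadsAt a (i + 1) ts

lemma readsAt_interleave {a : ℤ → ℤˣ} {c : ℤ} (ha : ∀ i, a (2 * i + 1 + c) = -a (2 * i - 1 + c))
    {w : List Bool} {s : Bool} {k : ℤ} (hs : a (2 * k + 1 + c) = turnSign s)
    (hw : ReadsAt (fun i => a (2 * i + c)) k w) : ReadsAt a (2 * k + c) (interleave s w) := by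
  induction w generalizing k s with
  | nil => exact ⟨by rw [← hs]; congr 1; ring, trivial⟩
  | cons t ts ih =>
    refine ⟨by rw [← hs]; congr 1; ring, ?_, ?_⟩
    · rw [← hw.1]; congr 1; ring
    · have := ih (k := k + 1) (s := !s) (by
        rw [ha (k + 1), turnSign_not, ← hs]; congr 2; ring) hw.2
      convert this using 1
      ring

lemma IsAlt.zero_mem_seqE_derive {a : ℤ → ℤˣ} (ha : IsAlt a) {n : ℕ} {c : ℤ}
    (hc : c ∈ seqE a (n + 1)) : 0 ∈ seqE (fun i => a (2 * i + c)) n := by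
  have hc1 := seqE_antitone ha (by omega : 1 ≤ n + 1) hc
  obtain ⟨h, hh⟩ := ha (n + 1)
  obtain ⟨k, hk⟩ := (mem_seqE_iff_dvd ha hc1).1
    (seqE_antitone ha (by omega : 1 ≤ n + 1) hh.mem_seqE)
  have hd := (mem_seqE_iff_dvd ha hc).1 hh.mem_seqE
  rw [hk, pow_one, pow_succ', mul_dvd_mul_iff_left (by norm_num)] at hd
  refine ⟨k, fun j => ?_, by simpa using hd⟩
  have := hh j
  rw [show h = 2 * k + c by linarith] at this
  simp only
  rw [← this]
  congr 1
  ring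

/-- The derived sequence supplies the even terms and one sign fixes the alternating odd terms,
whence the interleaving. -/
lemma IsAlt.exists_readsAt {a : ℤ → ℤˣ} (ha : IsAlt a) {n : ℕ} {c : ℤ} (hc : c ∈ seqE a n) :
    ∃ ss : List Bool, ss.length = n ∧ ReadsAt a c (foldingWord ss) := by
  induction n generalizing a c with
  | zero => exact ⟨[], rfl, trivial⟩
  | succ n ih =>
    have hc1 := seqE_antitone ha (by omega : 1 ≤ n + 1) hc
    obtain ⟨ss, hl, hss⟩ := ih (ha.derive hc1) (ha.zero_mem_seqE_derive hc)
    obtain ⟨s, hs⟩ := exists_turnSign (a (2 * 0 + 1 + c))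
    refine ⟨s :: ss, by simp [hl], ?_⟩
    have := readsAt_interleave (FoldPath.alternate_of_mem_seqE ha hc1) hs hss
    rwa [mul_zero, zero_add] at this

namespace FoldPath

variable {g : GaussianInt} {p : ℤ → GaussianInt} {a : ℤ → ℤˣ}

lemma pathEdge_of_mem_pathSteps (H : FoldPath g p a) {P G : GaussianInt} {ts : List Bool}
    {i x y dx dy : ℤ} (hr : ReadsAt a i ts) (hp : p i = P + G * ⟨x, y⟩)
    (hd : p (i + 1) = P + G * ⟨x + dx, y + dy⟩) {e : ℤ × ℤ × ℤ × ℤ}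
    (he : e ∈ pathSteps ts x y dx dy) :
    PathEdge p (P + G * ⟨e.1, e.2.1⟩) (P + G * ⟨e.1 + e.2.2.1, e.2.1 + e.2.2.2⟩) := by
  induction ts generalizing i x y dx dy with
  | nil =>
    rw [pathSteps, List.mem_singleton] at he
    subst he
    exact ⟨i, Or.inl ⟨hp, hd⟩⟩
  | cons t ts ih =>
    rw [pathSteps, List.mem_cons] at he
    rcases he with rfl | he
    · exact ⟨i, Or.inl ⟨hp, hd⟩⟩
    · refine ih hr.2 hd ?_ he
      have h := H.turn (i + 1)
      rw [add_sub_cancel_right, hr.1, hp, hd] at h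
      rw [eq_add_of_sub_eq h]
      cases t
      · have e : (⟨x + dx + dy, y + dy + -dx⟩ : GaussianInt) =
            ⟨x + dx, y + dy⟩ - gi * (⟨x + dx, y + dy⟩ - ⟨x, y⟩) := by ext <;> simp; ring
        simp only [turnSign, cond_false, e, sgn_neg, sgn_one]
        ring
      · have e : (⟨x + dx + -dy, y + dy + dx⟩ : GaussianInt) =
            ⟨x + dx, y + dy⟩ + gi * (⟨x + dx, y + dy⟩ - ⟨x, y⟩) := by ext <;> simp
        simp only [turnSign, cond_true, e, sgn_one]
        ring

lemma exists_fullCorner (H : FoldPath g p a) (ha : IsAlt a) :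
    ∃ P u, IsUnit u ∧ FullAt g p P ∧ FullAt g p (P + g * u) ∧ FullAt g p (P + g * (gi * u)) := by
  obtain ⟨c, hc⟩ := seqE_nonempty ha 6
  obtain ⟨ss, hl, hss⟩ := ha.exists_readsAt hc
  obtain ⟨s₀, s₁, s₂, s₃, s₄, s₅, rfl⟩ : ∃ s₀ s₁ s₂ s₃ s₄ s₅, ss = [s₀, s₁, s₂, s₃, s₄, s₅] := by
    rcases ss with _ | ⟨s₀, _ | ⟨s₁, _ | ⟨s₂, _ | ⟨s₃, _ | ⟨s₄, _ | ⟨s₅, _ | ⟨s₆, ss⟩⟩⟩⟩⟩⟩⟩ <;>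
      simp at hl
    exact ⟨_, _, _, _, _, _, rfl⟩
  have hcorner := hasFullCorner_foldingWord s₀ s₁ s₂ s₃ s₄ s₅
  generalize foldingWord [s₀, s₁, s₂, s₃, s₄, s₅] = ts at hss hcorner
  obtain ⟨u, hu, hstep⟩ := H.step c
  set l := pathSteps ts 0 0 1 0 with hldef
  have hzero : (⟨0, 0⟩ : GaussianInt) = 0 := rfl
  have hedge : ∀ {x y dx dy : ℤ}, hasEdge l x y dx dy = true →
      PathEdge p (p c + g * u * ⟨x, y⟩) (p c + g * u * ⟨x + dx, y + dy⟩) := by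
    intro x y dx dy h
    obtain ⟨e, he, h⟩ := List.any_eq_true.1 h
    have := H.pathEdge_of_mem_pathSteps (P := p c) (G := g * u) hss (by rw [hzero]; ring) (by
      rw [eq_add_of_sub_eq hstep, add_comm]
      congr 1
      rw [show (⟨0 + 1, 0 + 0⟩ : GaussianInt) = 1 from rfl, mul_one]) he
    rw [Bool.or_eq_true, beq_iff_eq, beq_iff_eq] at h
    rcases h with rfl | rfl
    · exact this
    · simpa using this.symm
  have hfull : ∀ {x y : ℤ}, isFull l x y = true → FullAt g p (p c + g * u * ⟨x, y⟩) := by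
    intro x y h
    simp only [isFull, Bool.and_eq_true] at h
    obtain ⟨⟨⟨h1, h2⟩, h3⟩, h4⟩ := h
    refine fullAt_of_mem ⟨u, hu, rfl⟩ ?_ ?_ ?_ ?_
    · convert hedge h1 using 1
      rw [show (⟨x + 1, y + 0⟩ : GaussianInt) = ⟨x, y⟩ + 1 by ext <;> simp]; ring
    · convert hedge h2 using 1
      rw [show (⟨x + -1, y + 0⟩ : GaussianInt) = ⟨x, y⟩ - 1 by ext <;> simp; ring]; ring
    · convert hedge h3 using 1
      rw [show (⟨x + 0, y + 1⟩ : GaussianInt) = ⟨x, y⟩ + gi by ext <;> simp]; ring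
    · convert hedge h4 using 1
      rw [show (⟨x + 0, y + -1⟩ : GaussianInt) = ⟨x, y⟩ - gi by ext <;> simp; ring]; ring
  obtain ⟨j, -, h⟩ := List.any_eq_true.1 hcorner
  generalize l.getD j (0, 0, 0, 0) = e at h
  obtain ⟨x, y, dx, dy⟩ := e
  simp only [Bool.and_eq_true, Bool.or_eq_true] at h
  obtain ⟨⟨h1, h2⟩, h3⟩ := h
  have h2' := hfull h2
  rw [show (⟨x + 1, y⟩ : GaussianInt) = ⟨x, y⟩ + 1 by ext <;> simp] at h2'
  rcases h3 with h3 | h3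
  · have h3' := hfull h3
    rw [show (⟨x, y + 1⟩ : GaussianInt) = ⟨x, y⟩ + gi by ext <;> simp] at h3'
    exact ⟨_, u, hu, hfull h1, h2'.of_eq (by ring), h3'.of_eq (by ring)⟩
  -- The third vertex lies on the other side; replacing `u` by `-(gi * u)` exchanges the roles of
  -- the two neighbours.
  · have h3' := hfull h3
    rw [show (⟨x, y - 1⟩ : GaussianInt) = ⟨x, y⟩ - gi by ext <;> simp] at h3'
    exact ⟨_, -(gi * u), (isUnit_gi.mul hu).neg, hfull h1, h3'.of_eq (by ring),
      h2'.of_eq (by linear_combination (-g * u) * gi_sq)⟩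

/-- Three full corners of a square of the second derivative suffice: one corner, the midpoints of
its two edges and the centre of the square form a full square of half the size. The centre comes
from the other two, opposite, corners. -/
lemma exists_fullSquare_one (H : FoldPath g p a) (ha : IsAlt a) (hg : g ≠ 0) :
    FullSquare g p 1 := by
  obtain ⟨c, hc⟩ := seqE_nonempty ha 1
  have H1 := H.derive_of_mem ha hc
  have ha1 := ha.derive hc
  have hg1 : g * (1 + gi) ≠ 0 := mul_ne_zero hg one_add_gi_ne_zero
  obtain ⟨d, hd⟩ := seqE_nonempty ha1 1
  have H2 := H1.derive_of_mem ha1 hd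
  have ha2 := ha1.derive hd
  obtain ⟨P, u, hu, h1, h2, h3⟩ := H2.exists_fullCorner ha2
  have hi := isUnit_gi
  have q1 := H1.fullAt_of_derive_of_mem ha1 hg1 hd h1
  have q2 := H1.fullAt_of_derive_of_mem ha1 hg1 hd h2
  have q3 := H1.fullAt_of_derive_of_mem ha1 hg1 hd h3
  refine ⟨P, gi * u, hi.mul hu, fun x y hx hy => ?_⟩
  interval_cases x <;> interval_cases y
  · exact (H.fullAt_of_derive_of_mem ha hg hc q1).of_eq (by simp)
  · refine (H.fullAt_midpoint_of_mem ha hg hc (hi.mul (hi.mul hu)) q1 (q3.of_eq ?_)).of_eq ?_ <;>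
      push_cast
    · linear_combination (-g * u * gi) * gi_sq
    · ring
  · refine (H.fullAt_midpoint_of_mem ha hg hc (hi.mul hu) q1 (q2.of_eq ?_)).of_eq ?_ <;>
      push_cast
    · linear_combination (-g * u) * gi_sq
    · ring
  · refine (H.fullAt_of_derive_of_mem ha hg hc (H1.fullAt_midpoint_of_mem ha1 hg1 hd
      (hi.mul (hi.mul hu)) h2 (h3.of_eq ?_))).of_eq ?_ <;> push_cast
    · linear_combination (g * u * (1 + gi)) * gi_sq
    · linear_combination (-g * u * (1 + gi)) * gi_sq

/-- A folding path contains arbitrarily large squares of full vertices. -/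
lemma exists_fullSquare (H : FoldPath g p a) (ha : IsAlt a) (hg : g ≠ 0) (n : ℕ) :
    FullSquare g p (2 ^ n) := by
  induction n generalizing g p a with
  | zero => exact H.exists_fullSquare_one ha hg
  | succ n ih =>
    obtain ⟨c, hc⟩ := seqE_nonempty ha 1
    have ha1 := ha.derive hc
    have hg1 : g * (1 + gi) ≠ 0 := mul_ne_zero hg one_add_gi_ne_zero
    obtain ⟨d, hd⟩ := seqE_nonempty ha1 1
    rw [pow_succ']
    exact FullSquare.double H ha hg hc hd (ih ((H.derive_of_mem ha hc).derive_of_mem ha1 hd)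
      (ha1.derive hd) (mul_ne_zero hg1 one_add_gi_ne_zero))

end FoldPath

/-! ### Segments and tiles -/

/-- The vector of the plane with given integer coordinates. -/
noncomputable def toPlane (m : ℤ × ℤ) : Plane := !₂[(m.1 : ℝ), (m.2 : ℝ)]

@[simp] lemma toPlane_zero (m : ℤ × ℤ) : toPlane m 0 = m.1 := rfl
@[simp] lemma toPlane_one (m : ℤ × ℤ) : toPlane m 1 = m.2 := rfl

lemma plane_ext {p q : Plane} (h0 : p 0 = q 0) (h1 : p 1 = q 1) : p = q := by
  ext i
  fin_cases i
  exacts [h0, h1]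

lemma signs_cases (u : ℤˣ) : u = 1 ∨ u = -1 := Int.units_eq_one_or u

namespace Segment

/-- The image of a segment under an integral translation. -/
def translate (s : Segment) (m : ℤ × ℤ) : Segment :=
  { s with x := s.x + m.1, y := s.y + m.2 }

/-- The side, as a sign, of the terminal tip of a segment. -/
def endTip (s : Segment) : ℤˣ := if s.dir = 1 then s.η else s.ζ

/-- The side, as a sign, of the initial tip of a segment. -/
def beginTip (s : Segment) : ℤˣ := if s.dir = 1 then s.ζ else s.η

/-- The signs of the coordinates of the terminal tip with respect to the terminal point. -/
def endCorner (s : Segment) : ℤˣ × ℤˣ :=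
  match s.axis with
  | .H => (-s.dir, s.endTip)
  | .V => (s.endTip, -s.dir)

/-- The signs of the coordinates of the initial tip with respect to the initial point. -/
def beginCorner (s : Segment) : ℤˣ × ℤˣ :=
  match s.axis with
  | .H => (s.dir, s.beginTip)
  | .V => (s.beginTip, s.dir)

/-- `1` if the terminal tip is on the left of the oriented segment, `-1` otherwise. -/
def endSide (s : Segment) : ℤˣ :=
  match s.axis with
  | .H => s.dir * s.endTip
  | .V => -(s.dir * s.endTip)

/-- `1` if the initial tip is on the left of the oriented segment, `-1` otherwise. -/
def beginSide (s : Segment) : ℤˣ :=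
  match s.axis with
  | .H => s.dir * s.beginTip
  | .V => -(s.dir * s.beginTip)

/-- The direction of an oriented segment. -/
def dirG (s : Segment) : GaussianInt := toG s.terminal - toG s.initial

@[simp] lemma translate_axis (s : Segment) (m : ℤ × ℤ) : (s.translate m).axis = s.axis := rfl
@[simp] lemma translate_dir (s : Segment) (m : ℤ × ℤ) : (s.translate m).dir = s.dir := rfl

lemma translate_lower (s : Segment) (m : ℤ × ℤ) : (s.translate m).lower = s.lower + m := rfl

lemma translate_upper (s : Segment) (m : ℤ × ℤ) : (s.translate m).upper = s.upper + m := by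
  obtain ⟨_ | _, d, x, y, z, e⟩ := s <;> refine Prod.ext ?_ ?_ <;> simp [upper, translate] <;> ring

lemma translate_initial (s : Segment) (m : ℤ × ℤ) : (s.translate m).initial = s.initial + m := by
  simp only [initial, translate_dir, translate_lower, translate_upper]
  split_ifs <;> rfl

lemma translate_terminal (s : Segment) (m : ℤ × ℤ) :
    (s.translate m).terminal = s.terminal + m := by
  simp only [terminal, translate_dir, translate_lower, translate_upper]
  split_ifs <;> rfl

lemma ending_eq (α : ℝ) (s : Segment) : s.ending α =
    !₂[(s.terminal.1 : ℝ) + ((s.endCorner.1 : ℤ) : ℝ) * α,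
      (s.terminal.2 : ℝ) + ((s.endCorner.2 : ℤ) : ℝ) * α] := by
  obtain ⟨_ | _, d, x, y, z, e⟩ := s <;> rcases signs_cases d with rfl | rfl <;>
    apply plane_ext <;>
    simp [ending, upperTip, lowerTip, pt, terminal, endCorner, endTip, upper, lower] <;> ring

lemma beginning_eq (α : ℝ) (s : Segment) : s.beginning α =
    !₂[(s.initial.1 : ℝ) + ((s.beginCorner.1 : ℤ) : ℝ) * α,
      (s.initial.2 : ℝ) + ((s.beginCorner.2 : ℤ) : ℝ) * α] := by
  obtain ⟨_ | _, d, x, y, z, e⟩ := s <;> rcases signs_cases d with rfl | rfl <;>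
    apply plane_ext <;>
    simp [beginning, upperTip, lowerTip, pt, initial, beginCorner, beginTip, upper, lower] <;> ring

/-- The combinatorial content of the fact that `s` and `t` are consecutive. -/
def Follows (s t : Segment) : Prop :=
  s.terminal = t.initial ∧ s.endCorner = t.beginCorner ∧ s.support ≠ t.support

lemma int_eq_of_add_mul {α : ℝ} (hα : 0 < α) (hα' : α < 1 / 4) {x y : ℤ} {e f : ℤˣ}
    (h : (x : ℝ) + ((e : ℤ) : ℝ) * α = (y : ℝ) + ((f : ℤ) : ℝ) * α) : x = y ∧ e = f := by
  have h1 : |((x - y : ℤ) : ℝ)| < 1 := by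
    rw [abs_lt]
    push_cast
    rcases signs_cases e with rfl | rfl <;> rcases signs_cases f with rfl | rfl <;>
      constructor <;>
      simp only [Units.val_one, Units.val_neg, Int.cast_one, Int.cast_neg, one_mul, neg_mul] at h <;>
      linarith
  rw [← Int.cast_abs] at h1
  have h2 : |x - y| < 1 := by exact_mod_cast h1
  have h3 : x = y := by rw [Int.abs_lt_one_iff] at h2; omega
  refine ⟨h3, ?_⟩
  subst h3
  have h4 : ((e : ℤ) : ℝ) = ((f : ℤ) : ℝ) := mul_right_cancel₀ hα.ne' (add_left_cancel h)
  exact Units.ext (by exact_mod_cast h4)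

/-- Since `2 * α < 1`, the position of a tip determines the lattice point and the corner. Equal
supports would give two common points, the ends of the straight middle part. -/
lemma follows_of_consecutive {α : ℝ} (hα : 0 < α) (hα' : α < 1 / 4) {s t : Segment}
    (h : Consecutive α s t) : s.Follows t := by
  obtain ⟨h1, p, hp⟩ := h
  rw [ending_eq, beginning_eq] at h1
  have h2 := int_eq_of_add_mul hα hα' (congrArg (fun q : Plane => q 0) h1)
  have h3 := int_eq_of_add_mul hα hα' (congrArg (fun q : Plane => q 1) h1)
  refine ⟨Prod.ext h2.1 h3.1, Prod.ext h2.2 h3.2, fun hs => ?_⟩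
  have hpt : ∀ a b, s.pt a b = t.pt a b := by
    obtain ⟨ax, d, x, y, z, e⟩ := s
    obtain ⟨ax', d', x', y', z', e'⟩ := t
    simp only [support, Prod.mk.injEq] at hs
    obtain ⟨rfl, rfl, rfl⟩ := hs
    intro a b
    rfl
  have m1 : s.pt (2 * α) 0 ∈ s.carrier α ∩ t.carrier α := by
    refine ⟨Or.inl (Or.inr (left_mem_segment ℝ _ _)), ?_⟩
    rw [hpt]
    exact Or.inl (Or.inr (left_mem_segment ℝ _ _))
  have m2 : s.pt (1 - 2 * α) 0 ∈ s.carrier α ∩ t.carrier α := by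
    refine ⟨Or.inl (Or.inr (right_mem_segment ℝ _ _)), ?_⟩
    rw [hpt]
    exact Or.inl (Or.inr (right_mem_segment ℝ _ _))
  rw [hp, Set.mem_singleton_iff] at m1 m2
  have h4 := m1.trans m2.symm
  obtain ⟨_ | _, d, x, y, z, e⟩ := s
  · have := congrArg (fun q : Plane => q 0) h4
    simp [pt] at this
    linarith
  · have := congrArg (fun q : Plane => q 1) h4
    simp [pt] at this
    linarith

lemma Follows.translate {s t : Segment} (h : s.Follows t) (m : ℤ × ℤ) :
    (s.translate m).Follows (t.translate m) := by
  obtain ⟨h1, h2, h3⟩ := h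
  refine ⟨by rw [translate_terminal, translate_initial, h1], h2, fun h => h3 ?_⟩
  simpa [support, Segment.translate] using h

lemma dirG_eq (s : Segment) : s.dirG = sgn s.dir * (match s.axis with | .H => 1 | .V => gi) := by
  obtain ⟨_ | _, d, x, y, z, e⟩ := s <;> rcases signs_cases d with rfl | rfl <;>
    ext <;> simp [dirG, terminal, initial, upper, lower]

lemma isUnit_dirG (s : Segment) : IsUnit s.dirG := by
  rw [dirG_eq]
  refine (isUnit_sgn _).mul ?_
  cases s.axis
  exacts [isUnit_one, isUnit_gi]

lemma Follows.axis_ne {s t : Segment} (h : s.Follows t) : s.axis ≠ t.axis := by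
  obtain ⟨h1, h2, h3⟩ := h
  obtain ⟨_ | _, d, x, y, z, e⟩ := s <;> obtain ⟨_ | _, d', x', y', z', e'⟩ := t <;>
    rcases signs_cases d with rfl | rfl <;> rcases signs_cases d' with rfl | rfl <;>
    simp [terminal, initial, upper, lower, endCorner, beginCorner, support] at h1 h2 h3 ⊢ <;>
    omega

lemma Follows.endSide_eq {s t : Segment} (h : s.Follows t) : s.endSide = t.beginSide := by
  have h0 := h.axis_ne
  obtain ⟨h1, h2, h3⟩ := h
  obtain ⟨_ | _, d, x, y, z, e⟩ := s <;> obtain ⟨_ | _, d', x', y', z', e'⟩ := t <;>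
    simp only [ne_eq, not_true_eq_false] at h0 <;>
    simp only [endCorner, beginCorner, Prod.mk.injEq] at h2 <;> obtain ⟨h4, h5⟩ := h2 <;>
    simp only [endSide, beginSide]
  · rw [h5, ← h4]; simp [mul_comm]
  · rw [h4, ← h5]; simp [mul_comm]

/-- The turn made after `s` is the side of its terminal tip; so turns are attributes of single
segments, which translations preserve. -/
lemma Follows.dirG_eq {s t : Segment} (h : s.Follows t) :
    t.dirG = gi * sgn s.endSide * s.dirG := by
  have h0 := h.axis_ne
  obtain ⟨h1, h2, h3⟩ := h
  rw [Segment.dirG_eq, Segment.dirG_eq]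
  obtain ⟨_ | _, d, x, y, z, e⟩ := s <;> obtain ⟨_ | _, d', x', y', z', e'⟩ := t <;>
    simp only [ne_eq, not_true_eq_false] at h0 <;>
    simp only [endCorner, beginCorner, Prod.mk.injEq] at h2 <;>
    obtain ⟨h4, h5⟩ := h2 <;> simp only [endSide]
  · rw [h5]
    rcases signs_cases d with rfl | rfl <;> rcases signs_cases d' with rfl | rfl <;> simp
  · rw [h4]
    rcases signs_cases d with rfl | rfl <;> rcases signs_cases d' with rfl | rfl <;> simp [gi_mul_gi]

lemma support_eq_of_dirG {s t : Segment} (h1 : s.initial = t.initial) (h2 : s.dirG = t.dirG) :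
    s.support = t.support ∧ s.dir = t.dir := by
  rw [dirG_eq, dirG_eq] at h2
  have h3 := congrArg Zsqrtd.re h2
  have h4 := congrArg Zsqrtd.im h2
  obtain ⟨_ | _, d, x, y, z, e⟩ := s <;> obtain ⟨_ | _, d', x', y', z', e'⟩ := t <;>
    rcases signs_cases d with rfl | rfl <;> rcases signs_cases d' with rfl | rfl <;>
    simp [initial, upper, lower, support] at h1 h3 h4 ⊢ <;> omega

lemma eq_of_sides {s t : Segment} (h1 : s.support = t.support) (h2 : s.dir = t.dir)
    (h3 : s.endSide = t.endSide) (h4 : s.beginSide = t.beginSide) : s = t := by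
  obtain ⟨a, d, x, y, z, e⟩ := s
  obtain ⟨a', d', x', y', z', e'⟩ := t
  simp only [support, Prod.mk.injEq] at h1
  obtain ⟨rfl, rfl, rfl⟩ := h1
  obtain rfl : d = d' := h2
  cases a <;> rcases signs_cases d with rfl | rfl <;>
    simp [endSide, beginSide, endTip, beginTip] at h3 h4 <;> simp [h3, h4]

/-- Membership of a tile in coordinates: `a` and `b` are the coordinates of a point along the
support and perpendicularly to it, measured from the middle of the support, while `d`, `e`, `f`
are the signs of the orientation, of the terminal tip and of the initial tip. -/
def TileShape (α : ℝ) (d e f : ℤˣ) (a b : ℝ) : Prop :=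
  (|a| + |b| ≤ 1 / 2 ∨
    max |((d : ℤ) : ℝ) * a - (1 / 2 - α)| |b - ((e : ℤ) : ℝ) * α| ≤ α) ∧
    ¬ max |((d : ℤ) : ℝ) * a + (1 / 2 - α)| |b - ((f : ℤ) : ℝ) * α| < α

/-- The coordinate along the support of a point, measured from the middle of the support. -/
noncomputable def coordA (s : Segment) (p : Plane) : ℝ :=
  match s.axis with
  | .H => p 0 - s.x - 1 / 2
  | .V => p 1 - s.y - 1 / 2

/-- The coordinate of a point perpendicularly to the support. -/
noncomputable def coordB (s : Segment) (p : Plane) : ℝ :=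
  match s.axis with
  | .H => p 1 - s.y
  | .V => p 0 - s.x

lemma eq_pt_iff (s : Segment) (p : Plane) (a b : ℝ) :
    p = s.pt a b ↔ a = s.coordA p + 1 / 2 ∧ b = s.coordB p := by
  obtain ⟨_ | _, d, x, y, z, e⟩ := s <;> simp only [pt, coordA, coordB] <;> constructor
  · rintro rfl; constructor <;> simp
  · rintro ⟨rfl, rfl⟩; apply plane_ext <;> simp
  · rintro rfl; constructor <;> simp
  · rintro ⟨rfl, rfl⟩; apply plane_ext <;> simp

lemma mem_tile_iff (α : ℝ) (s : Segment) (p : Plane) :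
    p ∈ s.tile α ↔ TileShape α s.dir s.endTip s.beginTip (s.coordA p) (s.coordB p) := by
  have key : ∀ R : ℝ → ℝ → Prop, (∃ a b, p = s.pt a b ∧ R a b) ↔
      R (s.coordA p + 1 / 2) (s.coordB p) := by
    intro R
    simp only [eq_pt_iff]
    constructor
    · rintro ⟨a, b, ⟨rfl, rfl⟩, h⟩; exact h
    · exact fun h => ⟨_, _, ⟨rfl, rfl⟩, h⟩
  have hneg : ∀ x y : ℝ, |-x - y| = |x + y| := fun x y => by
    rw [← abs_neg]; congr 1; ring
  have hneg' : ∀ x y : ℝ, |-x + y| = |x - y| := fun x y => by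
    rw [← abs_neg]; congr 1; ring
  unfold tile diamond TileShape endTip beginTip
  rcases signs_cases s.dir with h | h
  · simp only [h, if_true, Set.mem_sdiff, Set.mem_union, Set.mem_ofPred_eq, key, Units.val_one,
      Int.cast_one, one_mul, add_sub_cancel_right]
    rw [show s.coordA p + 1 / 2 - (1 - α) = s.coordA p - (1 / 2 - α) by ring,
      show s.coordA p + 1 / 2 - α = s.coordA p + (1 / 2 - α) by ring]
  · simp only [h, show (-1 : ℤˣ) ≠ 1 by decide, if_false, Set.mem_sdiff, Set.mem_union,
      Set.mem_ofPred_eq, key, Units.val_neg, Units.val_one, Int.cast_neg,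
      Int.cast_one, neg_mul, one_mul, add_sub_cancel_right, hneg, hneg']
    rw [show s.coordA p + 1 / 2 - (1 - α) = s.coordA p - (1 / 2 - α) by ring,
      show s.coordA p + 1 / 2 - α = s.coordA p + (1 / 2 - α) by ring]

end Segment

/-! ### Recovering a segment from its tile -/

lemma sign_cast_cases (u : ℤˣ) : (((u : ℤ) : ℝ) = 1 ∧ u = 1) ∨ (((u : ℤ) : ℝ) = -1 ∧ u = -1) := by
  rcases signs_cases u with rfl | rfl <;> simp

namespace Segment

variable {α : ℝ} {d e f : ℤˣ}

lemma TileShape.abs_le_half (hα' : α < 1 / 4) {a b : ℝ} (h : TileShape α d e f a b) :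
    |a| ≤ 1 / 2 ∧ |b| ≤ 1 / 2 := by
  obtain ⟨h | h, -⟩ := h
  · have := abs_nonneg a; have := abs_nonneg b
    constructor <;> linarith
  · obtain ⟨h1, h2⟩ := max_le_iff.1 h
    rw [abs_le] at h1 h2
    rw [abs_le, abs_le]
    rcases sign_cast_cases d with ⟨hd, -⟩ | ⟨hd, -⟩ <;>
      rcases sign_cast_cases e with ⟨he, -⟩ | ⟨he, -⟩ <;> rw [hd] at h1 <;> rw [he] at h2 <;>
      refine ⟨⟨?_, ?_⟩, ?_, ?_⟩ <;> linarith

/-- The tile touches the four sides of its bounding square at their midpoints; the dent, being open,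
leaves the end of the support in place. -/
lemma tileShape_axis (hα' : α < 1 / 4) (u : ℤˣ) :
    TileShape α d e f (((u : ℤ) : ℝ) / 2) 0 ∧ TileShape α d e f 0 (((u : ℤ) : ℝ) / 2) := by
  have hu : |((u : ℤ) : ℝ) / 2| = 1 / 2 := by
    rcases sign_cast_cases u with ⟨h, -⟩ | ⟨h, -⟩ <;> rw [h] <;> norm_num [abs_of_pos, abs_of_neg]
  refine ⟨⟨Or.inl (by rw [hu, abs_zero]; norm_num), ?_⟩, ⟨Or.inl (by rw [hu, abs_zero]; norm_num), ?_⟩⟩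
  · rw [not_lt, le_max_iff]
    right
    rcases sign_cast_cases f with ⟨h, -⟩ | ⟨h, -⟩ <;> rw [h] <;> simp [le_abs_self]
  · rw [not_lt, le_max_iff]
    left
    rw [le_abs]; left; linarith

/-- The point tested is a corner of a possible bump on the boundary of the bounding square, outside
the diamond; it detects the orientation and the terminal tip. -/
lemma tileShape_bump (hα : 0 < α) (hα' : α < 1 / 4) (u v : ℤˣ) :
    TileShape α d e f (((u : ℤ) : ℝ) / 2) (2 * α * ((v : ℤ) : ℝ)) ↔ u = d ∧ v = e := by
  have hu : |((u : ℤ) : ℝ) / 2| = 1 / 2 := by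
    rcases sign_cast_cases u with ⟨h, -⟩ | ⟨h, -⟩ <;> rw [h] <;> norm_num [abs_of_pos, abs_of_neg]
  have hv : |2 * α * ((v : ℤ) : ℝ)| = 2 * α := by
    rcases sign_cast_cases v with ⟨h, -⟩ | ⟨h, -⟩ <;> rw [h] <;> simp [abs_of_pos hα]
  constructor
  · rintro ⟨h | h, -⟩
    · rw [hu, hv] at h; linarith
    · obtain ⟨h1, h2⟩ := max_le_iff.1 h
      rw [abs_le] at h1 h2
      constructor
      · rcases sign_cast_cases u with ⟨h3, rfl⟩ | ⟨h3, rfl⟩ <;>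
        rcases sign_cast_cases d with ⟨h4, rfl⟩ | ⟨h4, rfl⟩ <;> simp only [h3, h4] at h1 <;>
        first | rfl | (exfalso; linarith)
      · rcases sign_cast_cases v with ⟨h3, rfl⟩ | ⟨h3, rfl⟩ <;>
        rcases sign_cast_cases e with ⟨h4, rfl⟩ | ⟨h4, rfl⟩ <;> simp only [h3, h4] at h2 <;>
        first | rfl | (exfalso; linarith)
  · rintro ⟨rfl, rfl⟩
    have h1 : ((u : ℤ) : ℝ) * (((u : ℤ) : ℝ) / 2) = 1 / 2 := by
      rcases sign_cast_cases u with ⟨h, -⟩ | ⟨h, -⟩ <;> rw [h] <;> norm_num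
    refine ⟨Or.inr (max_le ?_ ?_), ?_⟩
    · rw [h1, abs_le]; constructor <;> linarith
    · rcases sign_cast_cases v with ⟨h, -⟩ | ⟨h, -⟩ <;> rw [h, abs_le] <;> constructor <;> linarith
    · rw [h1, not_lt, le_max_iff]
      left
      rw [le_abs]; left; linarith

lemma not_tileShape_bump (hα : 0 < α) (hα' : α < 1 / 4) (u v : ℤˣ) :
    ¬ TileShape α d e f (2 * α * ((v : ℤ) : ℝ)) (((u : ℤ) : ℝ) / 2) := by
  have hu : |((u : ℤ) : ℝ) / 2| = 1 / 2 := by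
    rcases sign_cast_cases u with ⟨h, -⟩ | ⟨h, -⟩ <;> rw [h] <;> norm_num [abs_of_pos, abs_of_neg]
  have hv : |2 * α * ((v : ℤ) : ℝ)| = 2 * α := by
    rcases sign_cast_cases v with ⟨h, -⟩ | ⟨h, -⟩ <;> rw [h] <;> simp [abs_of_pos hα]
  rintro ⟨h | h, -⟩
  · rw [hu, hv] at h; linarith
  · have h2 := (max_le_iff.1 h).2
    rw [abs_le] at h2
    rcases sign_cast_cases u with ⟨h3, -⟩ | ⟨h3, -⟩ <;>
    rcases sign_cast_cases e with ⟨h4, -⟩ | ⟨h4, -⟩ <;> rw [h3, h4] at h2 <;> linarith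

/-- The point tested lies in the diamond near the initial point, inside a possible dent; it detects
the initial tip. -/
lemma tileShape_dent (hα : 0 < α) (hα' : α < 1 / 4) (v : ℤˣ) :
    TileShape α d e f (-((d : ℤ) : ℝ) * (1 / 2 - 3 / 2 * α)) (((v : ℤ) : ℝ) * (α / 2)) ↔ v ≠ f := by
  have h1 : ((d : ℤ) : ℝ) * (-((d : ℤ) : ℝ) * (1 / 2 - 3 / 2 * α)) + (1 / 2 - α) = α / 2 := by
    rcases sign_cast_cases d with ⟨h, -⟩ | ⟨h, -⟩ <;> rw [h] <;> ring
  have h2 : |-((d : ℤ) : ℝ) * (1 / 2 - 3 / 2 * α)| = 1 / 2 - 3 / 2 * α := by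
    have : |-((d : ℤ) : ℝ)| = 1 := by
      rcases sign_cast_cases d with ⟨h, -⟩ | ⟨h, -⟩ <;> rw [h] <;> simp
    rw [abs_mul, this, one_mul, abs_of_pos (by linarith)]
  have h3 : |((v : ℤ) : ℝ) * (α / 2)| = α / 2 := by
    have : |((v : ℤ) : ℝ)| = 1 := by
      rcases sign_cast_cases v with ⟨h, -⟩ | ⟨h, -⟩ <;> rw [h] <;> simp
    rw [abs_mul, this, one_mul, abs_of_pos (by linarith)]
  constructor
  · rintro ⟨-, h⟩ rfl
    apply h
    rw [h1, max_lt_iff]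
    constructor
    · rw [abs_lt]; constructor <;> linarith
    · rcases sign_cast_cases v with ⟨h, -⟩ | ⟨h, -⟩ <;> rw [h, abs_lt] <;> constructor <;> linarith
  · intro hvf
    refine ⟨Or.inl (by rw [h2, h3]; linarith), ?_⟩
    rw [not_lt, le_max_iff]
    right
    rcases sign_cast_cases v with ⟨h4, rfl⟩ | ⟨h4, rfl⟩ <;>
    rcases sign_cast_cases f with ⟨h5, rfl⟩ | ⟨h5, rfl⟩ <;> simp only [h4, h5] <;> rw [le_abs] <;>
    first
      | exact absurd rfl hvf
      | (left; linarith)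
      | (right; linarith)

/-- The point of given coordinates with respect to the support of a segment. -/
noncomputable def mid (s : Segment) (a b : ℝ) : Plane := s.pt (a + 1 / 2) b

lemma mid_mem_tile_iff (s : Segment) (a b : ℝ) :
    s.mid a b ∈ s.tile α ↔ TileShape α s.dir s.endTip s.beginTip a b := by
  have := (eq_pt_iff s (s.mid a b) (a + 1 / 2) b).1 rfl
  rw [mem_tile_iff, ← this.2, ← add_right_cancel this.1]

lemma coordA_translate (s : Segment) (m : ℤ × ℤ) (p : Plane) :
    (s.translate m).coordA (toPlane m + p) = s.coordA p := by
  obtain ⟨_ | _, d, x, y, z, e⟩ := s <;> simp [coordA, translate] <;> ring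

lemma coordB_translate (s : Segment) (m : ℤ × ℤ) (p : Plane) :
    (s.translate m).coordB (toPlane m + p) = s.coordB p := by
  obtain ⟨_ | _, d, x, y, z, e⟩ := s <;> simp [coordB, translate] <;> ring

lemma tile_translate (s : Segment) (m : ℤ × ℤ) :
    (s.translate m).tile α = (fun p => toPlane m + p) '' s.tile α := by
  ext p
  rw [Set.image_add_left, Set.mem_preimage, mem_tile_iff, mem_tile_iff]
  have h : p = toPlane m + (-toPlane m + p) := by abel
  conv_lhs => rw [h, coordA_translate, coordB_translate]
  rfl

lemma abs_sub_lower_le {s : Segment} (hα' : α < 1 / 4) {p : Plane} (hp : p ∈ s.tile α) :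
    |p 0 - s.x| ≤ 1 ∧ |p 1 - s.y| ≤ 1 := by
  have h := ((mem_tile_iff α s p).1 hp).abs_le_half hα'
  rw [abs_le, abs_le] at h
  rw [abs_le, abs_le]
  obtain ⟨_ | _, d, x, y, z, e⟩ := s <;> simp only [coordA, coordB] at h ⊢ <;>
    obtain ⟨⟨h1, h2⟩, h3, h4⟩ := h <;> refine ⟨⟨?_, ?_⟩, ?_, ?_⟩ <;> linarith

lemma lower_mem_tile (hα' : α < 1 / 4) (s : Segment) :
    toPlane s.lower ∈ s.tile α := by
  have h0 : toPlane s.lower = s.mid (((-1 : ℤˣ) : ℤ) / 2) 0 := by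
    obtain ⟨_ | _, d, x, y, z, e⟩ := s <;> apply plane_ext <;> simp [pt, mid, lower] <;> norm_num
  rw [h0, mid_mem_tile_iff]
  exact (tileShape_axis hα' _).1

/-- A tile determines its segment up to translation. -/
lemma eq_translate_of_tile (hα : 0 < α) (hα' : α < 1 / 4) {s t : Segment} {v : Plane}
    (h : ∀ p ∈ s.tile α, v + p ∈ t.tile α) : ∃ m, t = s.translate m ∧ v = toPlane m := by
  have hbox : ∀ a b, TileShape α s.dir s.endTip s.beginTip a b →
      |t.coordA (v + s.mid a b)| ≤ 1 / 2 ∧ |t.coordB (v + s.mid a b)| ≤ 1 / 2 := fun a b hab =>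
    ((mem_tile_iff α t _).1 (h _ ((mid_mem_tile_iff s a b).2 hab))).abs_le_half hα'
  -- The four midpoints of the bounding square of `s` must remain in the bounding square of `t`,
  -- which forces the two squares to coincide after translation.
  have b1 := hbox _ _ (tileShape_axis hα' 1).1
  have b2 := hbox _ _ (tileShape_axis hα' (-1)).1
  have b3 := hbox _ _ (tileShape_axis hα' 1).2
  have b4 := hbox _ _ (tileShape_axis hα' (-1)).2
  have hshape : ∀ a b, TileShape α s.dir s.endTip s.beginTip a b →
      TileShape α t.dir t.endTip t.beginTip (t.coordA (v + s.mid a b))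
        (t.coordB (v + s.mid a b)) := fun a b hab =>
    (mem_tile_iff α t _).1 (h _ ((mid_mem_tile_iff s a b).2 hab))
  have c1 := hshape _ _ ((tileShape_bump hα hα' s.dir s.endTip).2 ⟨rfl, rfl⟩)
  have c2 := hshape _ _ ((tileShape_dent hα hα' (-s.beginTip)).2 (unit_ne_neg _).symm)
  clear hshape hbox h
  simp only [abs_le, Units.val_one, Units.val_neg, Int.cast_one, Int.cast_neg] at b1 b2 b3 b4
  have fin : ∀ {r r' : Segment}, r.axis = r'.axis → r.dir = r'.dir → r.endTip = r'.endTip →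
      r.beginTip = r'.beginTip → r' = r.translate (r'.x - r.x, r'.y - r.y) := by
    rintro ⟨a, d, x, y, z, e⟩ ⟨a', d', x', y', z', e'⟩ h1 h2 h3 h4
    simp only at h1 h2
    subst h1 h2
    rcases signs_cases d with rfl | rfl <;> simp [endTip, beginTip] at h3 h4 <;>
      simp [translate, h3, h4]
  by_cases hax : s.axis = t.axis
  · obtain ⟨A, B, hAB⟩ : ∃ A B : ℝ, (∀ a b, t.coordA (v + s.mid a b) = a + A) ∧
        (∀ a b, t.coordB (v + s.mid a b) = b + B) ∧
        (A = 0 → B = 0 → v = toPlane (t.x - s.x, t.y - s.y)) := by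
      obtain ⟨ax, d, x, y, z, e⟩ := s
      obtain ⟨ax', d', x', y', z', e'⟩ := t
      obtain rfl : ax = ax' := hax
      cases ax
      · refine ⟨v 0 + x - x', v 1 + y - y', fun a b => ?_, fun a b => ?_, fun hA hB => ?_⟩
        · simp [coordA, mid, pt]; ring
        · simp [coordB, mid, pt]; ring
        · apply plane_ext <;> simp <;> linarith
      · refine ⟨v 1 + y - y', v 0 + x - x', fun a b => ?_, fun a b => ?_, fun hA hB => ?_⟩
        · simp [coordA, mid, pt]; ring
        · simp [coordB, mid, pt]; ring
        · apply plane_ext <;> simp <;> linarith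
    obtain ⟨hA, hB, hv⟩ := hAB
    simp only [hA, hB] at b1 b2 b3 b4 c1 c2
    obtain rfl : A = 0 := by linarith [b1.1.2, b2.1.1]
    obtain rfl : B = 0 := by linarith [b3.2.2, b4.2.1]
    rw [add_zero, add_zero] at c1 c2
    obtain ⟨hd, he⟩ := (tileShape_bump hα hα' _ _).1 c1
    rw [hd] at c2
    have hf := (tileShape_dent hα hα' _).1 c2
    have hf' : s.beginTip = t.beginTip := by
      rcases signs_cases s.beginTip with h1 | h1 <;> rcases signs_cases t.beginTip with h2 | h2 <;>
        simp [h1, h2] at hf ⊢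
    exact ⟨_, fin hax hd he hf', hv rfl rfl⟩
  -- With perpendicular supports, the bump of `s` would protrude on a side of the square where the
  -- tile of `t` has none.
  · exfalso
    obtain ⟨A, B, hA, hB⟩ : ∃ A B : ℝ, (∀ a b, t.coordA (v + s.mid a b) = b + A) ∧
        (∀ a b, t.coordB (v + s.mid a b) = a + B) := by
      obtain ⟨_ | _, d, x, y, z, e⟩ := s <;> obtain ⟨_ | _, d', x', y', z', e'⟩ := t <;>
        simp only [not_true_eq_false] at hax
      · refine ⟨v 1 + y - y' - 1 / 2, v 0 + x + 1 / 2 - x', fun a b => ?_, fun a b => ?_⟩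
        · simp [coordA, mid, pt]; ring
        · simp [coordB, mid, pt]; ring
      · refine ⟨v 0 + x - x' - 1 / 2, v 1 + y + 1 / 2 - y', fun a b => ?_, fun a b => ?_⟩
        · simp [coordA, mid, pt]; ring
        · simp [coordB, mid, pt]; ring
    simp only [hA, hB] at b1 b2 b3 b4 c1
    obtain rfl : A = 0 := by linarith [b3.1.2, b4.1.1]
    obtain rfl : B = 0 := by linarith [b1.2.2, b2.2.1]
    rw [add_zero, add_zero] at c1
    exact not_tileShape_bump hα hα' _ _ c1

end Segment

/-! ### The curves of a covering -/

namespace Segment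

lemma terminal_eq_of_dirG {s t : Segment} (h1 : s.terminal = t.terminal) (h2 : s.dirG = t.dirG) :
    s.initial = t.initial := by
  apply toG_injective
  have : toG s.terminal - s.dirG = toG t.terminal - t.dirG := by rw [h1, h2]
  simpa [dirG] using this

lemma support_eq_of_reverse {s t : Segment} (h1 : s.initial = t.terminal)
    (h2 : s.terminal = t.initial) : s.support = t.support := by
  obtain ⟨_ | _, d, x, y, z, e⟩ := s <;> obtain ⟨_ | _, d', x', y', z', e'⟩ := t <;>
    rcases signs_cases d with rfl | rfl <;> rcases signs_cases d' with rfl | rfl <;>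
    simp [initial, terminal, upper, lower, support] at h1 h2 ⊢ <;> omega

end Segment

section

variable {α : ℝ} {𝓔 : Set Segment}

lemma IsCovering.eq_of_support (h : IsCovering α 𝓔) {s t : Segment} (hs : s ∈ 𝓔) (ht : t ∈ 𝓔)
    (hst : s.support = t.support) : s = t :=
  (h.existsUnique_support t.support).unique ⟨hs, hst⟩ ⟨ht, rfl⟩

/-- The terminal tip of `s` fixes the initial point and direction of a successor, hence its support,
and a support carries one segment. -/
lemma IsCovering.successor_unique (h : IsCovering α 𝓔) {s t t' : Segment} (ht : t ∈ 𝓔)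
    (ht' : t' ∈ 𝓔) (h1 : s.Follows t) (h2 : s.Follows t') : t = t' := by
  refine h.eq_of_support ht ht' (Segment.support_eq_of_dirG ?_ ?_).1
  · rw [← h1.1, h2.1]
  · rw [h1.dirG_eq, h2.dirG_eq]

lemma IsCovering.predecessor_unique (h : IsCovering α 𝓔) {s s' t : Segment} (hs : s ∈ 𝓔)
    (hs' : s' ∈ 𝓔) (h1 : s.Follows t) (h2 : s'.Follows t) : s = s' := by
  have h3 : s.dirG = s'.dirG := by
    have h4 := h1.dirG_eq
    rw [h2.dirG_eq, h1.endSide_eq, h2.endSide_eq] at h4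
    exact (mul_left_cancel₀ (isUnit_gi.mul (isUnit_sgn _)).ne_zero h4).symm
  refine h.eq_of_support hs hs' (Segment.support_eq_of_dirG ?_ h3).1
  exact Segment.terminal_eq_of_dirG (h1.1.trans h2.1.symm) h3

lemma IsCompleteCurve.follows (hα : 0 < α) (hα' : α < 1 / 4) {C : ℤ → Segment}
    (h : IsCompleteCurve α C) (i : ℤ) : (C i).Follows (C (i + 1)) :=
  Segment.follows_of_consecutive hα hα' (h.1 i)

lemma step_eq_dirG {C : ℤ → Segment} (h : ∀ i, (C i).Follows (C (i + 1))) (i : ℤ) :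
    toG (vertexSeq C (i + 1)) - toG (vertexSeq C i) = (C (i + 1)).dirG := by
  rw [vertexSeq, vertexSeq, (h i).1]
  rfl

lemma foldPath_endSide {C : ℤ → Segment} (h : ∀ i, (C i).Follows (C (i + 1))) :
    FoldPath 1 (fun i => toG (vertexSeq C i)) fun i => (C i).endSide where
  step_zero := ⟨(C 1).dirG, Segment.isUnit_dirG _, by
    have := step_eq_dirG h 0
    rw [zero_add] at this
    rw [this, one_mul]⟩
  turn i := by
    have h1 := step_eq_dirG h (i - 1)
    rw [sub_add_cancel] at h1
    rw [h1, step_eq_dirG h, (h i).dirG_eq]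

lemma assocSeq_eq {C : ℤ → Segment} (h : ∀ i, (C i).Follows (C (i + 1))) (i : ℤ) :
    assocSeq C i = (C i).endSide :=
  congrFun ((foldPath_endSide h).turnSeq_eq one_ne_zero) i

lemma assocSeq_eq_beginSide {C : ℤ → Segment} (h : ∀ i, (C i).Follows (C (i + 1))) (i : ℤ) :
    assocSeq C i = (C (i + 1)).beginSide := by
  rw [assocSeq_eq h, (h i).endSide_eq]

lemma foldPath_assocSeq {C : ℤ → Segment} (h : ∀ i, (C i).Follows (C (i + 1))) :
    FoldPath 1 (fun i => toG (vertexSeq C i)) (assocSeq C) := by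
  have := foldPath_endSide h
  rwa [← show assocSeq C = fun i => (C i).endSide from funext (assocSeq_eq h)] at this

/-- The properties of the curves of a covering by complete folding curves which are used below. -/
structure IsGoodCurve (𝓔 : Set Segment) (C : ℤ → Segment) : Prop where
  follows : ∀ i, (C i).Follows (C (i + 1))
  mem : ∀ i, C i ∈ 𝓔
  isAlt : IsAlt (assocSeq C)

lemma isAlt_of_shift {a b : ℤ → ℤˣ} {j : ℤ} (hb : IsAlt b) (h : ∀ i, a i = b (i + j)) :
    IsAlt a := by
  intro n
  obtain ⟨k, hk⟩ := hb n
  refine ⟨k - j, fun t => ?_⟩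
  rw [h, h, sub_add_cancel, ← hk t]
  congr 1
  ring

/-- By uniqueness of successors and predecessors, any curve of the covering is a shift of the
folding curve through one of its segments. -/
lemma IsCurveOf.isGoodCurve (hα : 0 < α) (hα' : α < 1 / 4)
    (h𝓔 : IsCoveringByCompleteFoldingCurves α 𝓔) {C : ℤ → Segment} (hC : IsCurveOf α 𝓔 C) :
    IsGoodCurve 𝓔 C := by
  have hf := hC.1.follows hα hα'
  refine ⟨hf, hC.2, ?_⟩
  obtain ⟨D, hD, hDm, j, hj⟩ := h𝓔.2 _ (hC.2 0)
  have hDf := hD.1.follows hα hα'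
  have heq : ∀ i, C i = D (i + j) := by
    intro i
    induction i using Int.induction_on with
    | zero => rw [zero_add, hj]
    | succ i ih =>
      have h2 := hDf (i + j)
      rw [← ih, show (i : ℤ) + j + 1 = i + 1 + j by ring] at h2
      exact h𝓔.1.successor_unique (hC.2 _) (hDm _) (hf i) h2
    | pred i ih =>
      have h1 := hf (-i - 1)
      have h2 := hDf (-i - 1 + j)
      rw [sub_add_cancel] at h1
      rw [show -(i : ℤ) - 1 + j + 1 = -i + j by ring, ← ih] at h2
      exact h𝓔.1.predecessor_unique (hC.2 _) (hDm _) h1 h2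
  refine isAlt_of_shift (j := j) hD.2.isAlt fun i => ?_
  rw [assocSeq_eq hf, assocSeq_eq hDf, heq]

lemma exists_isCurveOf (h𝓔 : IsCoveringByCompleteFoldingCurves α 𝓔) {s : Segment} (hs : s ∈ 𝓔) :
    ∃ C i, IsCurveOf α 𝓔 C ∧ C i = s := by
  obtain ⟨C, hC, hm, i, hi⟩ := h𝓔.2 s hs
  exact ⟨C, i, ⟨hC.1, hm⟩, hi⟩

lemma axis_eq_of_ne {A B B' : Axis} (h : B ≠ A) (h' : B' ≠ A) : B = B' := by
  cases A <;> cases B <;> cases B' <;> simp_all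

namespace IsGoodCurve

variable {C : ℤ → Segment}

lemma foldPath (h : IsGoodCurve 𝓔 C) : FoldPath 1 (fun i => toG (vertexSeq C i)) (assocSeq C) :=
  foldPath_assocSeq h.follows

lemma dvd_sub_iff (h : IsGoodCurve 𝓔 C) {n : ℕ} {i j : ℤ} (hi : i ∈ seqE (assocSeq C) n) :
    (1 + gi) ^ n ∣ toG (vertexSeq C j) - toG (vertexSeq C i) ↔ j ∈ seqE (assocSeq C) n := by
  have := h.foldPath.dvd_sub_iff one_ne_zero h.isAlt hi (j := j)
  rwa [one_mul] at this

lemma mem_curveE (h : IsGoodCurve 𝓔 C) {n : ℕ} {i : ℤ} (hi : i ∈ seqE (assocSeq C) n)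
    {X : ℤ × ℤ} : X ∈ curveE C n ↔ (1 + gi) ^ n ∣ toG X - toG (vertexSeq C i) :=
  h.foldPath.mem_curveE_iff isUnit_one h.isAlt hi

lemma vertexSeq_mem_curveE (h : IsGoodCurve 𝓔 C) {n : ℕ} {i : ℤ} :
    vertexSeq C i ∈ curveE C n ↔ i ∈ seqE (assocSeq C) n := by
  obtain ⟨j, hj⟩ := seqE_nonempty h.isAlt n
  rw [h.mem_curveE hj, h.dvd_sub_iff hj]

lemma mem_seqE_one_succ (h : IsGoodCurve 𝓔 C) (i : ℤ) :
    i + 1 ∈ seqE (assocSeq C) 1 ↔ i ∉ seqE (assocSeq C) 1 := by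
  obtain ⟨j, hj⟩ := seqE_nonempty h.isAlt 1
  rw [mem_seqE_iff_dvd h.isAlt hj, mem_seqE_iff_dvd h.isAlt hj]
  omega

lemma axis_eq_iff (h : IsGoodCurve 𝓔 C) {A : Axis} (hA : HasType C A) (i : ℤ) :
    (C i).axis = A ↔ i ∈ seqE (assocSeq C) 1 := by
  refine ⟨fun hi => ?_, fun hi => hA i hi⟩
  by_contra hn
  have := hA _ ((h.mem_seqE_one_succ i).2 hn)
  exact (h.follows i).axis_ne (hi.trans this.symm)

lemma axis_add_two (h : IsGoodCurve 𝓔 C) (i : ℤ) : (C (i + 2)).axis = (C i).axis := by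
  have h1 := (h.follows i).axis_ne
  have h2 := (h.follows (i + 1)).axis_ne
  rw [show i + 1 + 1 = i + 2 by ring] at h2
  exact axis_eq_of_ne h2.symm h1

lemma hasType (h : IsGoodCurve 𝓔 C) {i : ℤ} (hi : i ∈ seqE (assocSeq C) 1) :
    HasType C (C i).axis := by
  intro j hj
  obtain ⟨t, ht⟩ := (mem_seqE_iff_dvd h.isAlt hi).1 hj
  obtain rfl : j = i + 2 * t := by linarith
  clear ht hj
  induction t using Int.induction_on with
  | zero => simp
  | succ t ih =>
    rw [← ih, ← h.axis_add_two (i + 2 * t)]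
    congr 2
    ring
  | pred t ih =>
    rw [← ih, ← h.axis_add_two (i + 2 * (-t - 1))]
    congr 2
    ring

end IsGoodCurve

end

/-! ### Consequences of the local isomorphism property -/

lemma abs_coord_le_norm (p : Plane) : |p 0| ≤ ‖p‖ ∧ |p 1| ≤ ‖p‖ :=
  ⟨PiLp.norm_apply_le p 0, PiLp.norm_apply_le p 1⟩

lemma norm_le_abs_add_abs (p : Plane) : ‖p‖ ≤ |p 0| + |p 1| := by
  rw [EuclideanSpace.norm_eq, Fin.sum_univ_two]
  refine Real.sqrt_le_iff.2 ⟨by positivity, ?_⟩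
  simp only [Real.norm_eq_abs]
  nlinarith [abs_nonneg (p 0), abs_nonneg (p 1)]

lemma toPlane_injective : Function.Injective toPlane := by
  intro m n h
  have h0 := congrArg (fun p : Plane => p 0) h
  have h1 := congrArg (fun p : Plane => p 1) h
  simp only [toPlane_zero, toPlane_one, Int.cast_inj] at h0 h1
  exact Prod.ext h0 h1

/-- A folding path contains all the edges at the vertices of arbitrarily large squares. -/
lemma FoldPath.exists_full_box {p : ℤ → GaussianInt} {a : ℤ → ℤˣ} (H : FoldPath 1 p a)
    (ha : IsAlt a) (R : ℕ) : ∃ Z : GaussianInt, ∀ X : GaussianInt, |X.re - Z.re| ≤ R →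
      |X.im - Z.im| ≤ R → FullAt 1 p X := by
  obtain ⟨P, u, hu, h⟩ := H.exists_fullSquare ha one_ne_zero (2 * R)
  have hR : 2 * R ≤ 2 ^ (2 * R) := Nat.lt_two_pow_self.le
  have key : ∀ x y : ℤ, |x| ≤ R → |y| ≤ R → FullAt 1 p (P + u * ⟨R, R⟩ + u * ⟨x, y⟩) := by
    intro x y hx hy
    rw [abs_le] at hx hy
    have hx' : ((R + x).toNat : ℤ) = R + x := Int.toNat_of_nonneg (by omega)
    have hy' : ((R + y).toNat : ℤ) = R + y := Int.toNat_of_nonneg (by omega)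
    refine (h (R + x).toNat (R + y).toNat (by omega) (by omega)).of_eq ?_
    have e : (((R + x).toNat : GaussianInt) + ((R + y).toNat : GaussianInt) * gi) =
        ⟨R, R⟩ + ⟨x, y⟩ := by
      ext <;> simp <;> omega
    rw [e]
    ring
  refine ⟨P + u * ⟨R, R⟩, fun X hre him => ?_⟩
  generalize P + u * ⟨R, R⟩ = Z at key hre him
  rcases isUnit_cases hu with rfl | rfl | rfl | rfl
  · refine (key _ _ hre him).of_eq ?_
    ext <;> simp
  · refine (key (-(X.re - Z.re)) (-(X.im - Z.im)) (by rwa [abs_neg]) (by rwa [abs_neg])).of_eq ?_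
    ext <;> simp
  · refine (key (X.im - Z.im) (-(X.re - Z.re)) him (by rwa [abs_neg])).of_eq ?_
    ext <;> simp
  · refine (key (-(X.im - Z.im)) (X.re - Z.re) (by rwa [abs_neg]) hre).of_eq ?_
    ext <;> simp

namespace IsGoodCurve

variable {α : ℝ} {𝓔 : Set Segment} {C D : ℤ → Segment}

/-- The curve uses the support of `t`, in one direction or the other, and `𝓔` has only one segment
on that support. -/
lemma mem_range_of_fullAt (h : IsGoodCurve 𝓔 C) (hcov : IsCovering α 𝓔) {t : Segment}
    (ht : t ∈ 𝓔) (hfull : FullAt 1 (fun i => toG (vertexSeq C i)) (toG t.lower)) :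
    ∃ i, C i = t := by
  have hedge : PathEdge (fun i => toG (vertexSeq C i)) (toG t.initial) (toG t.terminal) := by
    have hd := Segment.isUnit_dirG t
    rcases signs_cases t.dir with h1 | h1
    · have e1 : t.initial = t.lower := by simp [Segment.initial, h1]
      rw [← e1] at hfull
      have := hfull _ hd
      rwa [one_mul, Segment.dirG, add_sub_cancel] at this
    · have e1 : t.terminal = t.lower := by
        simp [Segment.terminal, h1]
      rw [← e1] at hfull
      have := hfull _ hd.neg
      rw [one_mul, Segment.dirG, neg_sub, add_sub_cancel] at this
      exact this.symm
  obtain ⟨i, ⟨h1, h2⟩ | ⟨h1, h2⟩⟩ := hedge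
  · refine ⟨i + 1, hcov.eq_of_support (h.mem _) ht (Segment.support_eq_of_dirG ?_ ?_).1⟩
    · rw [← (h.follows i).1]; exact toG_injective h1
    · have := step_eq_dirG h.follows i
      simp only at h1 h2
      rw [← this, h1, h2]
      rfl
  · refine ⟨i + 1, hcov.eq_of_support (h.mem _) ht (Segment.support_eq_of_reverse ?_ ?_)⟩
    · rw [← (h.follows i).1]; exact toG_injective h1
    · exact toG_injective h2

lemma translate_window (hC : IsGoodCurve 𝓔 C) (hD : IsGoodCurve 𝓔 D) (hcov : IsCovering α 𝓔)
    {N : ℕ} {c k : ℤ} {m : ℤ × ℤ} (h0 : C k = (D c).translate m)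
    (h : ∀ i : ℕ, i ≤ N → (D (c + i)).translate m ∈ 𝓔) (i : ℕ) (hi : i ≤ N) :
    C (k + i) = (D (c + i)).translate m := by
  induction i with
  | zero => simpa using h0
  | succ i ih =>
    have h1 := ih (by omega)
    have h2 := hC.follows (k + i)
    rw [h1] at h2
    have h3 := (hD.follows (c + i)).translate m
    push_cast
    rw [← add_assoc, ← add_assoc]
    refine hcov.successor_unique (hC.mem _) ?_ h2 h3
    have := h (i + 1) hi
    push_cast at this
    rwa [← add_assoc] at this

/-- If a covering satisfies the local isomorphism property, then each curve contains translates
of any two finite parts of curves, with the same vector. -/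
lemma exists_translate (hα : 0 < α) (hα' : α < 1 / 4) (hcov : IsCovering α 𝓔)
    (hloc : LocalIsomorphismProperty α 𝓔) (hC : IsGoodCurve 𝓔 C) (hD : IsGoodCurve 𝓔 D)
    (c d : ℤ) (N : ℕ) : ∃ (m : ℤ × ℤ) (k l : ℤ),
      (∀ i : ℕ, i ≤ N → C (k + i) = (C (c + i)).translate m) ∧
      ∀ i : ℕ, i ≤ N → C (l + i) = (D (d + i)).translate m := by
  set W : Set Segment := (fun i : ℕ => C (c + i)) '' Set.Iic N ∪
    (fun i : ℕ => D (d + i)) '' Set.Iic N with hW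
  have hWfin : W.Finite := ((Set.finite_Iic N).image _).union ((Set.finite_Iic N).image _)
  have hWsub : W ⊆ 𝓔 := by
    rintro s (⟨i, -, rfl⟩ | ⟨i, -, rfl⟩)
    exacts [hC.mem _, hD.mem _]
  have hbdd : Bornology.IsBounded (⋃₀ (Segment.tile α '' W)) := by
    rw [Bornology.isBounded_sUnion (hWfin.image _)]
    rintro _ ⟨s, -, rfl⟩
    rw [isBounded_iff_forall_norm_le]
    refine ⟨(|(s.x : ℝ)| + 1) + (|(s.y : ℝ)| + 1), fun p hp => ?_⟩
    obtain ⟨h1, h2⟩ := Segment.abs_sub_lower_le hα' hp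
    refine (norm_le_abs_add_abs p).trans (add_le_add ?_ ?_)
    · have := abs_sub_abs_le_abs_sub (p 0) s.x; linarith
    · have := abs_sub_abs_le_abs_sub (p 1) s.y; linarith
  obtain ⟨r, hr, hloc⟩ := hloc _ (Set.image_mono hWsub) hbdd
  obtain ⟨R, hR⟩ := exists_nat_gt r
  obtain ⟨Z, hZ⟩ := hC.foldPath.exists_full_box hC.isAlt R
  -- The ball is centred in a box filled by `C`, so every translated segment of `W` lies on `C`. The
  -- vector `v` is common to both windows, which is what allows positions to be compared.
  obtain ⟨v, hv⟩ := hloc (toPlane (Z.re, Z.im))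
  have htr : ∀ s ∈ W, ∃ m, v = toPlane m ∧ s.translate m ∈ 𝓔 ∧ ∃ k, C k = s.translate m := by
    intro s hs
    obtain ⟨⟨t, ht, hts⟩, hball⟩ := hv _ ⟨s, hs, rfl⟩
    obtain ⟨m, rfl, hm⟩ := Segment.eq_translate_of_tile hα hα' (s := s) (t := t) (v := v)
      fun p hp => by rw [hts]; exact ⟨p, hp, rfl⟩
    refine ⟨m, hm, ht, hC.mem_range_of_fullAt hcov ht ?_⟩
    rw [← hts] at hball
    have h1 := hball (Segment.lower_mem_tile hα' _)
    rw [Metric.mem_ball, dist_eq_norm] at h1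
    obtain ⟨h2, h3⟩ := abs_coord_le_norm
      (toPlane (s.translate m).lower - toPlane (Z.re, Z.im))
    simp only [PiLp.sub_apply, toPlane_zero, toPlane_one] at h2 h3
    apply hZ
    · have : |((s.translate m).lower.1 : ℝ) - Z.re| ≤ R := by linarith
      exact_mod_cast this
    · have : |((s.translate m).lower.2 : ℝ) - Z.im| ≤ R := by linarith
      exact_mod_cast this
  have hCW : ∀ i : ℕ, i ≤ N → C (c + i) ∈ W := fun i hi => Or.inl ⟨i, hi, rfl⟩
  have hDW : ∀ i : ℕ, i ≤ N → D (d + i) ∈ W := fun i hi => Or.inr ⟨i, hi, rfl⟩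
  obtain ⟨m, rfl, -, k, hk⟩ := htr _ (hCW 0 (Nat.zero_le _))
  have htr' : ∀ s ∈ W, s.translate m ∈ 𝓔 ∧ ∃ k, C k = s.translate m := by
    intro s hs
    obtain ⟨m', hm, h⟩ := htr s hs
    rwa [← toPlane_injective hm] at h
  obtain ⟨-, l, hl⟩ := htr' _ (hDW 0 (Nat.zero_le _))
  simp only [Nat.cast_zero, add_zero] at hk hl
  exact ⟨m, k, l, hC.translate_window hC hcov hk fun i hi => (htr' _ (hCW i hi)).1,
    hC.translate_window hD hcov hl fun i hi => (htr' _ (hDW i hi)).1⟩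

lemma assocSeq_eq_of_translate (hC : IsGoodCurve 𝓔 C) (hD : IsGoodCurve 𝓔 D) {i j : ℤ}
    {m : ℤ × ℤ} (h : C i = (D j).translate m) : assocSeq C i = assocSeq D j := by
  rw [assocSeq_eq hC.follows, assocSeq_eq hD.follows, h]
  rfl

lemma vertexSeq_of_translate {i j : ℤ} {m : ℤ × ℤ} (h : C i = (D j).translate m) :
    toG (vertexSeq C i) = toG (vertexSeq D j) + toG m := by
  rw [vertexSeq, h, Segment.translate_terminal, toG_add]
  rfl

section

variable (hα : 0 < α) (hα' : α < 1 / 4) (hcov : IsCovering α 𝓔)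
  (hloc : LocalIsomorphismProperty α 𝓔) (hC : IsGoodCurve 𝓔 C) (hD : IsGoodCurve 𝓔 D)
include hα hα' hcov hloc hC hD

lemma isSubword_of_isSubword {w : List ℤˣ} (hw : IsSubword w (assocSeq D)) :
    IsSubword w (assocSeq C) := by
  obtain ⟨d, hd⟩ := isSubword_iff.1 hw
  obtain ⟨m, k, l, -, hl⟩ := exists_translate hα hα' hcov hloc hC hD 0 d w.length
  refine isSubword_iff.2 ⟨l, ?_⟩
  nth_rewrite 1 [hd]
  refine List.map_congr_left fun i hi => ?_
  exact (hC.assocSeq_eq_of_translate hD (hl i (List.mem_range.1 hi).le)).symm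

/-- Windows of length `2 ^ (n + 2)` are translated, long enough for membership in `E_n` to be
inherited. -/
lemma exists_mem_seqE_translate (n : ℕ) {c d : ℤ} (hc : c ∈ seqE (assocSeq C) n)
    (hd : d ∈ seqE (assocSeq D) n) : ∃ (m : ℤ × ℤ) (k l : ℤ), k ∈ seqE (assocSeq C) n ∧
      l ∈ seqE (assocSeq C) n ∧ C k = (C c).translate m ∧ C l = (D d).translate m := by
  obtain ⟨m, k, l, hk, hl⟩ := exists_translate hα hα' hcov hloc hC hD c d (2 ^ (n + 2))
  refine ⟨m, k, l, ?_, ?_, by simpa using hk 0 (by positivity), by simpa using hl 0 (by positivity)⟩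
  · exact (mem_seqE_iff_of_agree hC.isAlt hC.isAlt fun i hi =>
      hC.assocSeq_eq_of_translate hC (hk i hi.le)).2 hc
  · exact (mem_seqE_iff_of_agree hC.isAlt hD.isAlt fun i hi =>
      hC.assocSeq_eq_of_translate hD (hl i hi.le)).2 hd

/-- The translated vertices both belong to `E_n(C)`, so they are congruent; the common translation
cancels, leaving a congruence between the original vertices of `C` and `D`. -/
lemma curveE_eq (n : ℕ) : curveE C n = curveE D n := by
  obtain ⟨c, hc⟩ := seqE_nonempty hC.isAlt n
  obtain ⟨d, hd⟩ := seqE_nonempty hD.isAlt n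
  obtain ⟨m, k, l, hk, hl, hkm, hlm⟩ :=
    exists_mem_seqE_translate hα hα' hcov hloc hC hD n hc hd
  have h1 := (hC.dvd_sub_iff hl (j := k)).2 hk
  rw [vertexSeq_of_translate hkm, vertexSeq_of_translate hlm, add_sub_add_right_eq_sub] at h1
  ext X
  rw [hC.mem_curveE hc, hD.mem_curveE hd,
    ← sub_add_sub_cancel (toG X) (toG (vertexSeq C c)) (toG (vertexSeq D d)), dvd_add_left h1]

lemma hasType_of_hasType {A : Axis} (hA : HasType C A) : HasType D A := by
  obtain ⟨c, hc⟩ := seqE_nonempty hC.isAlt 1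
  obtain ⟨d, hd⟩ := seqE_nonempty hD.isAlt 1
  obtain ⟨m, k, l, hk, hl, hkm, hlm⟩ :=
    exists_mem_seqE_translate hα hα' hcov hloc hC hD 1 hc hd
  have h1 := hD.hasType hd
  have h2 := hA l hl
  rw [hlm, Segment.translate_axis] at h2
  rwa [h2] at h1

end

end IsGoodCurve

/-! ### Markings of the vertices -/

/-- Nested cosets `E n` of the lattices `(1 + i)ⁿ ℤ[i]`, and signs at the points of `ℤ²` which
depend, on `E n \ E (n + 1)`, only on the class modulo `(1 + i)ⁿ⁺²`. -/
structure IsMarking (E : ℕ → Set (ℤ × ℤ)) (τ : ℤ × ℤ → ℤˣ) : Prop where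
  mem_zero : ∀ X, X ∈ E 0
  antitone : Antitone E
  nonempty : ∀ n, (E n).Nonempty
  mem_iff : ∀ {n X Y}, X ∈ E n → (Y ∈ E n ↔ (1 + gi) ^ n ∣ toG Y - toG X)
  eq_iff : ∀ {n X Y}, X ∈ E n → X ∉ E (n + 1) → Y ∈ E n → Y ∉ E (n + 1) →
    (τ X = τ Y ↔ (1 + gi) ^ (n + 2) ∣ toG X - toG Y)
  exists_eq : ∀ n ε, ∃ X ∈ E n, X ∉ E (n + 1) ∧ τ X = ε

lemma eq_zero_of_forall_pow_dvd {z : GaussianInt} (h : ∀ n, (1 + gi) ^ n ∣ z) : z = 0 := by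
  by_contra hz
  have hfin : FiniteMultiplicity (1 + gi) z := by
    refine FiniteMultiplicity.of_not_isUnit (fun hu => ?_) hz
    have := one_add_gi_dvd.1 (hu.dvd (a := 1))
    simp at this
  exact hfin.not_pow_dvd_of_multiplicity_lt (Nat.lt_succ_self _) (h _)

namespace IsMarking

variable {E : ℕ → Set (ℤ × ℤ)} {τ : ℤ × ℤ → ℤˣ}

/-- The intersection of all the `E n` has at most one point, and a finite set leaves every other
point behind at some finite level. If that intersection is empty, any `w` of `E (N + 1)` serves. -/
lemma exists_center (h : IsMarking E τ) {V : Set (ℤ × ℤ)} (hV : V.Finite) :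
    ∃ (N : ℕ) (w : ℤ × ℤ), w ∈ E (N + 1) ∧ ∀ X ∈ V, X ∈ E N → X = w := by
  have h1 : ∀ X : ℤ × ℤ, ∃ n, X ∈ E n → ∀ k, X ∈ E k := by
    intro X
    by_cases hX : ∀ k, X ∈ E k
    · exact ⟨0, fun _ => hX⟩
    · push Not at hX
      obtain ⟨k, hk⟩ := hX
      exact ⟨k, fun h => absurd h hk⟩
  choose f hf using h1
  obtain ⟨N, hN⟩ := (hV.image f).bddAbove
  have h2 : ∀ X ∈ V, X ∈ E N → ∀ k, X ∈ E k := fun X hX hXN =>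
    hf X (h.antitone (hN ⟨X, hX, rfl⟩) hXN)
  by_cases h3 : ∃ w, ∀ k, w ∈ E k
  · obtain ⟨w, hw⟩ := h3
    refine ⟨N, w, hw _, fun X hX hXN => toG_injective (sub_eq_zero.1 ?_)⟩
    exact eq_zero_of_forall_pow_dvd fun n => (h.mem_iff (hw n)).1 (h2 X hX hXN n)
  · obtain ⟨w, hw⟩ := h.nonempty (N + 1)
    exact ⟨N, w, hw, fun X hX hXN => absurd ⟨X, h2 X hX hXN⟩ h3⟩

lemma mem_add_iff (h : IsMarking E τ) {n : ℕ} {m X : ℤ × ℤ} (hm : (1 + gi) ^ n ∣ toG m) :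
    X + m ∈ E n ↔ X ∈ E n := by
  obtain ⟨Y, hY⟩ := h.nonempty n
  rw [h.mem_iff hY, h.mem_iff hY, toG_add, add_sub_right_comm]
  exact dvd_add_left hm

/-- A point outside `E (n + 1)` has a level `k ≤ n`, and its sign depends only on its class modulo
`(1 + gi) ^ (k + 2)`. -/
lemma add_eq (h : IsMarking E τ) {n : ℕ} {m X : ℤ × ℤ} (hX : X ∉ E (n + 1))
    (hm : (1 + gi) ^ (n + 2) ∣ toG m) : τ (X + m) = τ X := by
  classical
  have hex : ∃ k, X ∉ E (k + 1) := ⟨n, hX⟩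
  set k := Nat.find hex with hk
  have h1 : X ∉ E (k + 1) := Nat.find_spec hex
  have hkn : k ≤ n := Nat.find_min' hex hX
  have h2 : X ∈ E k := by
    rcases Nat.eq_zero_or_pos k with h0 | h0
    · rw [h0]; exact h.mem_zero X
    · have := Nat.find_min hex (m := k - 1) (by omega)
      rw [not_not] at this
      rwa [Nat.sub_add_cancel h0] at this
  have hd : ∀ j ≤ k + 2, (1 + gi) ^ j ∣ toG m := fun j hj =>
    (pow_dvd_pow _ (by omega)).trans hm
  refine (h.eq_iff ((h.mem_add_iff (hd k (by omega))).2 h2)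
    (fun h3 => h1 ((h.mem_add_iff (hd _ (by omega))).1 h3)) h2 h1).2 ?_
  rw [toG_add, add_sub_cancel_left]
  exact hd _ le_rfl

lemma exists_translation (h : IsMarking E τ) {V : Set (ℤ × ℤ)} (hV : V.Finite) :
    ∃ K : ℤ, ∀ c : ℤ × ℤ, ∃ m : ℤ × ℤ, (∀ X ∈ V, τ (X + m) = τ X) ∧
      (∀ X, X + m ∈ E 1 ↔ X ∈ E 1) ∧ |m.1 - c.1| ≤ K ∧ |m.2 - c.2| ≤ K := by
  obtain ⟨N, w, hw, hVw⟩ := h.exists_center hV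
  -- The exceptional point `w`, possibly of infinite level, is sent to a point congruent to `Y`, of
  -- finite level and with the same sign.
  obtain ⟨Y, hY, hY', hτ⟩ := h.exists_eq (N + 1) (τ w)
  have hpos : (0 : ℤ) < 2 ^ (N + 3) := by positivity
  refine ⟨2 ^ (N + 3), fun c => ?_⟩
  -- Rounding in the lattice `2 ^ (N + 3) ℤ²`, contained in the ideal of `(1 + gi) ^ (N + 3)`,
  -- brings the translation near `c` without affecting the sign at `Y`.
  set q : ℤ × ℤ := ((c.1 - (Y.1 - w.1)) / 2 ^ (N + 3), (c.2 - (Y.2 - w.2)) / 2 ^ (N + 3)) with hq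
  set l : ℤ × ℤ := (2 ^ (N + 3) * q.1, 2 ^ (N + 3) * q.2) with hl
  have hld : (1 + gi) ^ (N + 3) ∣ toG l := by
    refine (pow_dvd_pow _ (by omega : N + 3 ≤ 2 * (N + 3))).trans ?_
    rw [(associated_one_add_gi_pow (N + 3)).dvd_iff_dvd_left, two_pow_dvd_iff]
    exact ⟨_, _, rfl⟩
  have hmd : (1 + gi) ^ (N + 1) ∣ toG (Y - w + l) := by
    rw [toG_add, toG_sub]
    exact dvd_add ((h.mem_iff hw).1 hY) ((pow_dvd_pow _ (by omega)).trans hld)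
  refine ⟨Y - w + l, fun X hX => ?_, fun X => ?_, ?_, ?_⟩
  · by_cases hXw : X = w
    · subst hXw
      rw [show X + (Y - X + l) = Y + l by abel, ← hτ]
      exact h.add_eq hY' hld
    -- Levels are here below `N`, so divisibility by `(1 + gi) ^ (N + 1)` is enough; for `N = 0` no
    -- such point exists.
    · have hXN : X ∉ E N := fun h' => hXw (hVw X hX h')
      cases N with
      | zero => exact absurd (h.mem_zero X) hXN
      | succ N => exact h.add_eq hXN hmd
  · exact h.mem_add_iff ((pow_dvd_pow _ (by omega)).trans hmd)
  · have h1 := Int.emod_add_mul_ediv (c.1 - (Y.1 - w.1)) (2 ^ (N + 3))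
    have h2 := Int.emod_nonneg (c.1 - (Y.1 - w.1)) hpos.ne'
    have h3 := Int.emod_lt_of_pos (c.1 - (Y.1 - w.1)) hpos
    simp only [Prod.fst_add, Prod.fst_sub, hl, hq]
    rw [abs_le]
    constructor <;> linarith
  · have h1 := Int.emod_add_mul_ediv (c.2 - (Y.2 - w.2)) (2 ^ (N + 3))
    have h2 := Int.emod_nonneg (c.2 - (Y.2 - w.2)) hpos.ne'
    have h3 := Int.emod_lt_of_pos (c.2 - (Y.2 - w.2)) hpos
    simp only [Prod.snd_add, Prod.snd_sub, hl, hq]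
    rw [abs_le]
    constructor <;> linarith

end IsMarking

/-! ### Coverings by curves with the same types, sets `E_n` and subwords -/

section

variable {α : ℝ} {𝓔 : Set Segment} {A : Axis}

namespace IsGoodCurve

variable {C D : ℤ → Segment}

/-- The common type and `E_1` make the incoming segments parallel. If they are equal, so are the
turns; if they are opposite, different turns would give the same outgoing segment, whose initial tip
allows only one turn. -/
lemma assocSeq_eq_of_vertexSeq_eq (hC : IsGoodCurve 𝓔 C) (hD : IsGoodCurve 𝓔 D)
    (hcov : IsCovering α 𝓔) (hCA : HasType C A) (hDA : HasType D A)
    (hE : curveE C 1 = curveE D 1) {i j : ℤ} (h : vertexSeq C i = vertexSeq D j) :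
    assocSeq C i = assocSeq D j := by
  have haxis : (C i).axis = (D j).axis := by
    have h1 : (C i).axis = A ↔ (D j).axis = A := by
      rw [hC.axis_eq_iff hCA, hD.axis_eq_iff hDA, ← hC.vertexSeq_mem_curveE,
        ← hD.vertexSeq_mem_curveE, hE, h]
    by_cases h2 : (C i).axis = A
    · rw [h2, h1.1 h2]
    · exact axis_eq_of_ne h2 fun h3 => h2 (h1.2 h3)
  have hd : (C i).dirG = (D j).dirG ∨ (C i).dirG = -(D j).dirG := by
    rw [Segment.dirG_eq, Segment.dirG_eq, haxis]
    rcases signs_cases (C i).dir with h1 | h1 <;>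
      rcases signs_cases (D j).dir with h2 | h2 <;> simp [h1, h2]
  rcases hd with hd | hd
  · have h1 := hcov.eq_of_support (hC.mem i) (hD.mem j)
      (Segment.support_eq_of_dirG (Segment.terminal_eq_of_dirG h hd) hd).1
    rw [assocSeq_eq hC.follows, assocSeq_eq hD.follows, h1]
  · by_contra hne
    have hneg : (C i).endSide = -(D j).endSide := by
      rw [assocSeq_eq hC.follows, assocSeq_eq hD.follows] at hne
      rcases signs_cases (C i).endSide with h1 | h1 <;>
        rcases signs_cases (D j).endSide with h2 | h2 <;> simp_all
    have h2 : (C (i + 1)).dirG = (D (j + 1)).dirG := by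
      rw [(hC.follows i).dirG_eq, (hD.follows j).dirG_eq, hd, hneg, sgn_neg]
      ring
    have h3 : (C (i + 1)).initial = (D (j + 1)).initial := by
      rw [← (hC.follows i).1, ← (hD.follows j).1]
      exact h
    have h4 := hcov.eq_of_support (hC.mem _) (hD.mem _) (Segment.support_eq_of_dirG h3 h2).1
    rw [assocSeq_eq_beginSide hC.follows, assocSeq_eq_beginSide hD.follows, h4] at hne
    exact hne rfl

/-- Equality of the sets `E_n` gives the congruences between the paths, and equality of the types
makes the steps following `E_1` parallel. -/
lemma eq_iff_dvd (hC : IsGoodCurve 𝓔 C) (hD : IsGoodCurve 𝓔 D) (hCA : HasType C A)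
    (hDA : HasType D A) (hE : ∀ n, curveE C n = curveE D n)
    (hCD : SeqLocallyIsomorphic (assocSeq C) (assocSeq D)) {n : ℕ} {i j : ℤ}
    (hi : AltAt (assocSeq C) n i) (hj : AltAt (assocSeq D) n j) :
    assocSeq C i = assocSeq D j ↔
      (1 + gi) ^ (n + 2) ∣ toG (vertexSeq C i) - toG (vertexSeq D j) := by
  have := hC.foldPath.eq_iff_dvd_of_locallyIsomorphic hD.foldPath one_ne_zero hC.isAlt hD.isAlt hCD
    (fun k a ha b hb => ?_) (fun a ha b hb => ?_) hi hj
  · rwa [one_mul] at this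
  · rw [one_mul, ← hD.mem_curveE hb, ← hE, hC.vertexSeq_mem_curveE]
    exact ha
  · rw [step_eq_dirG hC.follows, step_eq_dirG hD.follows]
    have h1 : (C (a + 1)).axis ≠ A := fun h =>
      (hC.mem_seqE_one_succ a).1 ((hC.axis_eq_iff hCA _).1 h) ha
    have h2 : (D (b + 1)).axis ≠ A := fun h =>
      (hD.mem_seqE_one_succ b).1 ((hD.axis_eq_iff hDA _).1 h) hb
    rw [Segment.dirG_eq, Segment.dirG_eq, axis_eq_of_ne h1 h2]
    rcases signs_cases (C (a + 1)).dir with h1 | h1 <;>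
      rcases signs_cases (D (b + 1)).dir with h2 | h2 <;> simp [h1, h2]

end IsGoodCurve

lemma IsGoodCurve.initial_eq {C : ℤ → Segment} (h : IsGoodCurve 𝓔 C) (i : ℤ) :
    (C i).initial = vertexSeq C (i - 1) := by
  have := (h.follows (i - 1)).1
  rw [sub_add_cancel] at this
  exact this.symm

lemma Segment.terminal_eq_of_support {s t : Segment} (h : s.support = t.support) :
    (s.dir = t.dir → s.terminal = t.terminal) ∧ (s.dir ≠ t.dir → s.terminal = t.initial) := by
  obtain ⟨a, d, x, y, z, e⟩ := s
  obtain ⟨a', d', x', y', z', e'⟩ := t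
  simp only [support, Prod.mk.injEq] at h
  obtain ⟨rfl, rfl, rfl⟩ := h
  cases a <;> rcases signs_cases d with rfl | rfl <;> rcases signs_cases d' with rfl | rfl <;>
    simp [terminal, initial, upper, lower]

lemma exists_vertexSeq_eq (hα : 0 < α) (hα' : α < 1 / 4)
    (h𝓔 : IsCoveringByCompleteFoldingCurves α 𝓔) (X : ℤ × ℤ) :
    ∃ C i, IsCurveOf α 𝓔 C ∧ vertexSeq C i = X := by
  obtain ⟨s, ⟨hs, hsX⟩, -⟩ := h𝓔.1.existsUnique_support (.H, X)
  have hX : s.lower = X := congrArg Prod.snd hsX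
  obtain ⟨C, i, hC, rfl⟩ := exists_isCurveOf h𝓔 hs
  rcases signs_cases (C i).dir with h | h
  · refine ⟨C, i - 1, hC, ?_⟩
    rw [← (hC.isGoodCurve hα hα' h𝓔).initial_eq, ← hX, Segment.initial, if_pos h]
  · exact ⟨C, i, hC, by rw [← hX, vertexSeq, Segment.terminal, h]; rfl⟩

/-- The conditions on the curves of a covering which characterize the local isomorphism
property. -/
structure HasUniformCurves (α : ℝ) (𝓔 : Set Segment) (A : Axis) : Prop where
  hasType : ∀ C, IsCurveOf α 𝓔 C → HasType C A
  curveE_eq : ∀ C D, IsCurveOf α 𝓔 C → IsCurveOf α 𝓔 D → ∀ k, curveE C k = curveE D k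
  locallyIsomorphic : ∀ C D, IsCurveOf α 𝓔 C → IsCurveOf α 𝓔 D →
    SeqLocallyIsomorphic (assocSeq C) (assocSeq D)

namespace HasUniformCurves

lemma exists_marking (hα : 0 < α) (hα' : α < 1 / 4)
    (h𝓔 : IsCoveringByCompleteFoldingCurves α 𝓔) (h : HasUniformCurves α 𝓔 A) :
    ∃ E τ, IsMarking E τ ∧ ∀ C, IsCurveOf α 𝓔 C → (∀ n, curveE C n = E n) ∧
      ∀ i, τ (vertexSeq C i) = assocSeq C i := by
  -- The sign of a point is the turn of an arbitrary curve passing there; `hτ` below shows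
  -- independence of the choice.
  choose C i hC hCX using exists_vertexSeq_eq hα hα' h𝓔
  have hg : ∀ X, IsGoodCurve 𝓔 (C X) := fun X => (hC X).isGoodCurve hα hα' h𝓔
  have hE : ∀ X n, curveE (C X) n = curveE (C 0) n := fun X n => h.curveE_eq _ _ (hC X) (hC 0) n
  have hτ : ∀ D, IsCurveOf α 𝓔 D → ∀ j,
      assocSeq (C (vertexSeq D j)) (i (vertexSeq D j)) = assocSeq D j := fun D hD j =>
    (hg _).assocSeq_eq_of_vertexSeq_eq (hD.isGoodCurve hα hα' h𝓔) h𝓔.1 (h.hasType _ (hC _))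
      (h.hasType _ hD) (h.curveE_eq _ _ (hC _) hD 1) (hCX _)
  have hmem : ∀ X n, X ∈ curveE (C 0) n ↔ i X ∈ seqE (assocSeq (C X)) n := by
    intro X n
    rw [← (hg X).vertexSeq_mem_curveE, hCX, hE X]
  have hmem' : ∀ j n, vertexSeq (C 0) j ∈ curveE (C 0) n ↔ j ∈ seqE (assocSeq (C 0)) n :=
    fun j n => (hg 0).vertexSeq_mem_curveE
  refine ⟨curveE (C 0), fun X => assocSeq (C X) (i X), ⟨fun X => ?_, fun m n hmn X hX => ?_,
    fun n => ?_, fun {n X Y} hX => ?_, fun {n X Y} hX hX' hY hY' => ?_, fun n ε => ?_⟩,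
    fun D hD => ⟨fun n => h.curveE_eq _ _ hD (hC 0) n, hτ D hD⟩⟩
  · rw [hmem]
    exact mem_seqE_zero (hg X).isAlt _
  · rw [hmem] at hX ⊢
    exact seqE_antitone (hg X).isAlt hmn hX
  · obtain ⟨j, hj⟩ := seqE_nonempty (hg 0).isAlt n
    exact ⟨_, (hmem' j n).2 hj⟩
  · rw [hmem] at hX
    rw [← hE X, (hg X).mem_curveE hX, hCX]
  · rw [hmem] at hX hX' hY hY'
    have := (hg X).eq_iff_dvd (hg Y) (h.hasType _ (hC X)) (h.hasType _ (hC Y))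
      (h.curveE_eq _ _ (hC X) (hC Y)) (h.locallyIsomorphic _ _ (hC X) (hC Y))
      ((altAt_iff (hg X).isAlt).2 ⟨hX, hX'⟩) ((altAt_iff (hg Y).isAlt).2 ⟨hY, hY'⟩)
    rwa [hCX, hCX] at this
  · obtain ⟨j, hj⟩ : ∃ j, AltAt (assocSeq (C 0)) n j ∧ assocSeq (C 0) j = ε := by
      obtain ⟨j, hj⟩ := seqE_nonempty (hg 0).isAlt (n + 1)
      have h1 := altAt_add_pow (hg 0).isAlt hj
      rcases eq_or_ne (assocSeq (C 0) (j + 2 ^ n)) ε with h2 | h2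
      · exact ⟨_, h1, h2⟩
      · refine ⟨_, h1.shift 1, ?_⟩
        rw [one_mul, h1.add_pow]
        rcases signs_cases (assocSeq (C 0) (j + 2 ^ n)) with h3 | h3 <;>
          rcases signs_cases ε with h4 | h4 <;> simp_all
    obtain ⟨h1, h2⟩ := (altAt_iff (hg 0).isAlt).1 hj.1
    exact ⟨_, (hmem' j n).2 h1, fun h3 => h2 ((hmem' j _).1 h3), (hτ _ (hC 0) j).trans hj.2⟩

/-- Translations which preserve the marking near a segment and the coset `E 1` preserve the
segment. -/
lemma translate_mem (hα : 0 < α) (hα' : α < 1 / 4)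
    (h𝓔 : IsCoveringByCompleteFoldingCurves α 𝓔) (h : HasUniformCurves α 𝓔 A)
    {E : ℕ → Set (ℤ × ℤ)} {τ : ℤ × ℤ → ℤˣ} (hE : ∀ C, IsCurveOf α 𝓔 C →
      (∀ n, curveE C n = E n) ∧ ∀ i, τ (vertexSeq C i) = assocSeq C i)
    {s : Segment} (hs : s ∈ 𝓔) {m : ℤ × ℤ} (h1 : ∀ X, X + m ∈ E 1 ↔ X ∈ E 1)
    (hi : τ (s.initial + m) = τ s.initial) (ht : τ (s.terminal + m) = τ s.terminal) :
    s.translate m ∈ 𝓔 := by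
  have key : ∀ t ∈ 𝓔, (t.axis = A ↔ t.terminal ∈ E 1) ∧ (t.initial ∈ E 1 ↔ t.terminal ∉ E 1) ∧
      t.endSide = τ t.terminal ∧ t.beginSide = τ t.initial := by
    intro t ht
    obtain ⟨C, i, hC, rfl⟩ := exists_isCurveOf h𝓔 ht
    have hg := hC.isGoodCurve hα hα' h𝓔
    obtain ⟨h2, h3⟩ := hE C hC
    have h4 := hg.mem_seqE_one_succ (i - 1)
    have h5 := assocSeq_eq_beginSide hg.follows (i - 1)
    rw [sub_add_cancel] at h4 h5
    rw [hg.initial_eq, h3, show (C i).terminal = vertexSeq C i from rfl, h3, ← h2 1,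
      hg.vertexSeq_mem_curveE, hg.vertexSeq_mem_curveE, hg.axis_eq_iff (h.hasType _ hC),
      assocSeq_eq hg.follows, h5, h4, not_not]
    exact ⟨Iff.rfl, Iff.rfl, rfl, rfl⟩
  obtain ⟨t, ⟨ht𝓔, hts⟩, -⟩ := h𝓔.1.existsUnique_support (s.translate m).support
  obtain ⟨a1, a2, a3, a4⟩ := key s hs
  obtain ⟨b1, b2, b3, b4⟩ := key t ht𝓔
  obtain ⟨e1, e2⟩ := Segment.terminal_eq_of_support hts
  have haxis : t.axis = s.axis := congrArg Prod.fst hts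
  -- The type tells from the axis which endpoint lies in `E 1`; since translation by `m` preserves
  -- `E 1`, a reversed orientation would have the wrong endpoint as terminal point.
  have hdir : t.dir = (s.translate m).dir := by
    by_contra hne
    rw [e2 hne, Segment.translate_initial, h1, a2, haxis, a1] at b1
    tauto
  have hterm := e1 hdir
  have hinit := Segment.terminal_eq_of_dirG hterm (by
    rw [Segment.dirG_eq, Segment.dirG_eq, hdir, haxis, Segment.translate_axis])
  rw [Segment.translate_terminal] at hterm
  rw [Segment.translate_initial] at hinit
  rw [← Segment.eq_of_sides hts hdir ?_ ?_]
  · exact ht𝓔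
  · rw [b3, hterm, ht, ← a3]; rfl
  · rw [b4, hinit, hi, ← a4]; rfl

lemma localIsomorphismProperty (hα : 0 < α) (hα' : α < 1 / 4)
    (h𝓔 : IsCoveringByCompleteFoldingCurves α 𝓔) (h : HasUniformCurves α 𝓔 A) :
    LocalIsomorphismProperty α 𝓔 := by
  obtain ⟨E, τ, hEτ, hE⟩ := h.exists_marking hα hα' h𝓔
  intro F hF hbdd
  obtain ⟨R₀, hR₀⟩ := isBounded_iff_forall_norm_le.1 hbdd
  obtain ⟨R, hR⟩ := exists_nat_gt R₀
  -- Lower endpoints belong to their tiles, hence have coordinates at most `R`; upper endpoints need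
  -- the extra unit.
  have hV : {X : ℤ × ℤ | |X.1| ≤ R + 1 ∧ |X.2| ≤ R + 1}.Finite := by
    refine ((Set.finite_Icc (-(R + 1 : ℤ)) (R + 1)).prod
      (Set.finite_Icc (-(R + 1 : ℤ)) (R + 1))).subset ?_
    rintro X ⟨h1, h2⟩
    exact ⟨abs_le.1 h1, abs_le.1 h2⟩
  obtain ⟨K, hK⟩ := hEτ.exists_translation hV
  have hK0 : 0 ≤ K := by
    obtain ⟨m, -, -, h1, -⟩ := hK 0
    exact (abs_nonneg _).trans h1
  have hK0' : (0 : ℝ) ≤ K := by exact_mod_cast hK0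
  -- Each coordinate of the translation is within `K + 1` of that of `c`, one unit coming from the
  -- integer part, and points of the tiles have norm less than `R`.
  refine ⟨2 * (K + 1 + R), by positivity, fun c => ?_⟩
  obtain ⟨m, hm, hm1, hmx, hmy⟩ := hK (⌊c 0⌋, ⌊c 1⌋)
  have hc : ∀ (x : ℝ) (k : ℤ), |k - ⌊x⌋| ≤ K → |(k : ℝ) - x| ≤ K + 1 := by
    intro x k hk
    have h1 : |(k : ℝ) - ⌊x⌋| ≤ K := by exact_mod_cast hk
    have h2 := Int.floor_le x
    have h3 := Int.lt_floor_add_one x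
    rw [abs_le] at h1 ⊢
    constructor <;> linarith [h1.1, h1.2]
  refine ⟨toPlane m, fun P hP => ?_⟩
  obtain ⟨s, hs, rfl⟩ := hF hP
  have hnorm : ∀ p ∈ s.tile α, ‖p‖ < R := fun p hp => (hR₀ p ⟨_, hP, hp⟩).trans_lt hR
  obtain ⟨hx, hy⟩ := abs_coord_le_norm (toPlane s.lower)
  have hl := hnorm _ (Segment.lower_mem_tile hα' s)
  simp only [toPlane_zero, toPlane_one] at hx hy
  replace hx : |s.lower.1| ≤ R := by
    have : |(s.lower.1 : ℝ)| ≤ R := by linarith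
    exact_mod_cast this
  replace hy : |s.lower.2| ≤ R := by
    have : |(s.lower.2 : ℝ)| ≤ R := by linarith
    exact_mod_cast this
  have hlV : |s.lower.1| ≤ R + 1 ∧ |s.lower.2| ≤ R + 1 := ⟨by omega, by omega⟩
  have huV : |s.upper.1| ≤ R + 1 ∧ |s.upper.2| ≤ R + 1 := by
    rw [abs_le] at hx hy
    rw [abs_le, abs_le]
    unfold Segment.upper
    simp only [Segment.lower] at hx hy
    split <;> simp only <;> omega
  constructor
  · refine ⟨s.translate m, h.translate_mem hα hα' h𝓔 hE hs hm1 (hm _ ?_) (hm _ ?_),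
      Segment.tile_translate s m⟩
    · unfold Segment.initial; split <;> assumption
    · unfold Segment.terminal; split <;> assumption
  · rintro _ ⟨p, hp, rfl⟩
    rw [Metric.mem_ball, dist_eq_norm]
    have h1 := hnorm p hp
    have h2 := norm_add_le (toPlane m - c) p
    have h3 := norm_le_abs_add_abs (toPlane m - c)
    simp only [PiLp.sub_apply, toPlane_zero, toPlane_one] at h3
    have h4 := hc _ _ hmx
    have h5 := hc _ _ hmy
    have h6 : (fun p => toPlane m + p) p - c = toPlane m - c + p := by
      simp only
      abel
    rw [h6]
    have h7 := (norm_nonneg p).trans_lt h1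
    linarith

end HasUniformCurves

end

end Paperfolding

/-! ### The characterization of the local isomorphism property -/

theorem theorem3p5 (α : ℝ) (hα : 0 < α) (hα' : α < 1 / 4) (𝓔 : Set Segment)
    (h𝓔 : IsCoveringByCompleteFoldingCurves α 𝓔) :
    LocalIsomorphismProperty α 𝓔 ↔
      (∃ A : Axis, ∀ C : ℤ → Segment, IsCurveOf α 𝓔 C → HasType C A) ∧
      (∀ C D : ℤ → Segment, IsCurveOf α 𝓔 C → IsCurveOf α 𝓔 D →
        ∀ k : ℕ, curveE C k = curveE D k) ∧
      (∀ C D : ℤ → Segment, IsCurveOf α 𝓔 C → IsCurveOf α 𝓔 D →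
        SeqLocallyIsomorphic (assocSeq C) (assocSeq D)) := by
  have good := fun (C : ℤ → Segment) (hC : IsCurveOf α 𝓔 C) => hC.isGoodCurve hα hα' h𝓔
  constructor
  · intro hloc
    -- Any curve serves as a reference for the type; one passing through the origin exists because
    -- each support carries a segment.
    obtain ⟨C₀, -, hC₀, -⟩ := exists_vertexSeq_eq hα hα' h𝓔 0
    obtain ⟨i, hi⟩ := seqE_nonempty (good _ hC₀).isAlt 1
    exact ⟨⟨(C₀ i).axis, fun C hC => (good _ hC₀).hasType_of_hasType hα hα' h𝓔.1 hloc (good _ hC)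
        ((good _ hC₀).hasType hi)⟩,
      fun C D hC hD k => (good _ hC).curveE_eq hα hα' h𝓔.1 hloc (good _ hD) k,
      fun C D hC hD w =>
        ⟨(good _ hD).isSubword_of_isSubword hα hα' h𝓔.1 hloc (good _ hC),
          (good _ hC).isSubword_of_isSubword hα hα' h𝓔.1 hloc (good _ hD)⟩⟩
  · rintro ⟨⟨A, hA⟩, hE, hl⟩
    exact HasUniformCurves.localIsomorphismProperty hα hα' h𝓔 ⟨hA, hE, hl⟩
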